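/- **Theorem (excess risk of quantized SGD).** *Setting.* Let $\mathcal H$ be a real separable Hilbert space (of finite or countably infinite dimension), let $(\mathbf x,y)\sim\mathcal D$ be a random pair in $\mathcal H\times\mathbb R$, $L(\mathbf w)=\frac12\mathbb E[(y-\langle\mathbf w,\mathbf x\rangle)^2]$, $\mathbf w^*=\arg\min L$ and $\mathcal E(\mathbf w)=L(\mathbf w)-L(\mathbf w^*)$. Let $\mathcal Q_d,\mathcal Q_l,\mathcal Q_p,\mathcal Q_a,\mathcal Q_o$ be independent randomized quantization operations (for features, labels, parameters, activations and output gradients), each unbiased, $\mathbb E[\mathcal Q_i(\mathbf u)\mid\mathbf u]=\mathbf u$; the features and labels are quantized sample by sample, and the errors of $\mathcal Q_a,\mathcal Q_o$ have finite second moments at every input. For $t=1,\dots,N$ an i.i.d. batch $(\mathbf X_t,\mathbf y_t)$ of $B\ge1$ samples is drawn, and with stepsize $\gamma>0$ and $\mathbf w_0=\mathbf 0$, $$\mathbf w_t=\mathbf w_{t-1}+\frac{\gamma}{B}\mathcal Q_d(\mathbf X_t)^\top\mathcal Q_o(\mathbf o_t),\qquad \mathbf o_t=\mathcal Q_l(\mathbf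 y_t)-\mathcal Q_a(\mathbf a_t),\qquad \mathbf a_t=\mathcal Q_d(\mathbf X_t)\mathcal Q_p(\mathbf w_{t-1}),$$ all quantizations being independent of each other and of the data. Put $\overline{\mathbf w}_N=\frac1N\sum_{t=0}^{N-1}\mathbf w_t$, $N\ge1$. The quantization errors are $\epsilon^{(l)}=\mathcal Q_l(y)-y$, $\boldsymbol\epsilon_t^{(p)}=\mathcal Q_p(\mathbf w_t)-\mathbf w_t$, $\boldsymbol\epsilon_t^{(a)}=\mathcal Q_a(\mathbf a_t)-\mathbf a_t$, $\boldsymbol\epsilon_t^{(o)}=\mathcal Q_o(\mathbf o_t)-\mathbf o_t$. *Assumptions.* Write $\mathbf x^{(q)}=\mathcal Q_d(\mathbf x)$, $\mathbf H=\mathbb E[\mathbf x\mathbf x^\top]$, $\mathbf H^{(q)}=\mathbb E[\mathbf x^{(q)}{\mathbf x^{(q)}}^\top]$, $\mathbf D=\mathbb E[(\mathbf x^{(q)}-\mathbf x)(\mathbf x^{(q)}-\mathbf x)^\top]$ (so that $\mathbf H^{(q)}=\mathbf H+\mathbf D$). Assume that $\mathrm{tr}(\mathbf H)$, $\mathrm{tr}(\mathbf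 H^{(q)})$, $\mathbb E[y^2]$, $\mathbb E[\mathcal Q_l(y)^2]$ are finite, that $\mathbf H$ is strictly positive definite, and that ${\mathbf w^{(q)}}^*=\arg\min_{\mathbf w}\mathbb E[(\mathcal Q_l(y)-\langle\mathbf w,\mathbf x^{(q)}\rangle)^2]$ exists. Assume that there are constants $\alpha_B>0$ and $\sigma>0$ such that $\mathbb E[\mathbf x^{(q)}{\mathbf x^{(q)}}^\top\mathbf A\,\mathbf x^{(q)}{\mathbf x^{(q)}}^\top]\preceq\alpha_B\,\mathrm{tr}(\mathbf H^{(q)}\mathbf A)\,\mathbf H^{(q)}$ for every positive semidefinite $\mathbf A$, and $\mathbb E[\xi^2\mathbf x^{(q)}{\mathbf x^{(q)}}^\top]\preceq\sigma^2\mathbf H^{(q)}$ for $\xi=\mathcal Q_l(y)-\langle{\mathbf w^{(q)}}^*,\mathbf x^{(q)}\rangle$, and that $$\gamma<\frac{1}{\alpha_B\,\mathrm{tr}(\mathbf H+\mathbf D)}.$$ *Notation.* $\|\mathbf w\|_{\mathbf A}^2=\langle\mathbf w,\mathbf A\mathbf w\rangle$, and $\|\mathbf D\|$ is the spectral norm.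 Let $\mathbf H^{(q)}=\sum_i\lambda_i^{(q)}\mathbf v_i^{(q)}{\mathbf v_i^{(q)}}^\top$ with eigenvalues in non-increasing order, let $\mathbf H^{(q)}_{0:k},\mathbf I^{(q)}_{0:k}$ (resp. $\mathbf H^{(q)}_{k:\infty},\mathbf I^{(q)}_{k:\infty}$) be the parts of $\mathbf H^{(q)}$ and of the identity on the span of the eigenvectors with $i\le k$ (resp. $i>k$), $(\mathbf H^{(q)}_{0:k})^{-1}$ and $(\mathbf H^{(q)}_{0:k})^{-2}$ being taken on that span, and let $k^*=\max\{k:\lambda_k^{(q)}\ge\frac1{N\gamma}\}$ ($0$ if there is none). Let $\mathbf D_1^H=\mathbf H(\mathbf H+\mathbf D)^{-1}\mathbf D(\mathbf H+\mathbf D)^{-1}\mathbf H$ and $\mathbf D_2^H=\mathbf D(\mathbf H+\mathbf D)^{-1}\mathbf H(\mathbf H+\mathbf D)^{-1}\mathbf D$ (in infinite dimension $\|\mathbf w^*\|_{\mathbf D_1^H}=\|(\mathbf H+\mathbf D)^{-1}\mathbf H\mathbf w^*\|_{\mathbf D}$ and $\|\mathbf w^*\|_{\mathbf D_2^H}=\|(\mathbf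 H+\mathbf D)^{-1}\mathbf D\mathbf w^*\|_{\mathbf H}$). Let $${\sigma_G^{(q)}}^2=\frac{\sigma^2+\sup_{t}\left\|\mathbb E[\boldsymbol\epsilon_t^{(o)}{\boldsymbol\epsilon_t^{(o)}}^\top|\mathbf o_t]+\mathbb E[\boldsymbol\epsilon_t^{(a)}{\boldsymbol\epsilon_t^{(a)}}^\top|\mathbf a_t]\right\|}{B}+\alpha_B\sup_t\mathbb E\left[\mathrm{tr}\left(\mathbf H^{(q)}\boldsymbol\epsilon_{t-1}^{(p)}{\boldsymbol\epsilon_{t-1}^{(p)}}^\top\right)\right],$$ where $t$ ranges over $1,\dots,N$ and the supremum of the random norm is the essential one; assume that this is finite (otherwise there is nothing to prove). Put $$V=\frac{{\sigma_G^{(q)}}^2+\frac{2\alpha_B}{N\gamma}\left(\|{\mathbf w^{(q)}}^*\|^2_{\mathbf I^{(q)}_{0:k^*}}+N\gamma\|{\mathbf w^{(q)}}^*\|^2_{\mathbf H^{(q)}_{k^*:\infty}}\right)}{1-\gamma\alpha_B\mathrm{tr}(\mathbf H+\mathbf D)}.$$ *Conclusion.* $\mathcal E(\overline{\mathbf w}_N)$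 is integrable and $$\mathbb E[\mathcal E(\overline{\mathbf w}_N)]\le\mathrm{VarErr}+\mathrm{BiasErr}+\mathrm{ApproxErr}+\mathrm{QuantizedErr},$$ where $$\mathrm{VarErr}=V\left(\frac{k^*}{N}+N\gamma^2\sum_{i>k^*}(\lambda_i^{(q)})^2\right),\qquad \mathrm{BiasErr}=\frac1{\gamma^2N^2}\|{\mathbf w^{(q)}}^*\|^2_{(\mathbf H^{(q)}_{0:k^*})^{-1}}+\|{\mathbf w^{(q)}}^*\|^2_{\mathbf H^{(q)}_{k^*:\infty}},$$ $$\mathrm{ApproxErr}=\mathbb E[(\epsilon^{(l)})^2]+\frac32\|\mathbf w^*\|^2_{\mathbf D_1^H}+\frac12\|\mathbf w^*\|^2_{\mathbf D_2^H},$$ $$\mathrm{QuantizedErr}=2\|\mathbf D\|\left[\frac1{\gamma^2N^2}\|{\mathbf w^{(q)}}^*\|^2_{(\mathbf H^{(q)}_{0:k^*})^{-2}}+\|{\mathbf w^{(q)}}^*\|^2_{\mathbf I^{(q)}_{k^*:\infty}}\right]+2\|\mathbf D\|\,V\left(\sum_{i\le k^*}\frac1{N\lambda_i^{(q)}}+N\gamma^2\sum_{i>k^*}\lambda_i^{(q)}\right).$$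 -/

import Mathlib

open MeasureTheory ProbabilityTheory InnerProductSpace
open scoped ENNReal RealInnerProductSpace

noncomputable section

namespace QuantSGD

/-! ### Randomized quantizers -/

/-- A randomized quantization operation on `V`: a jointly measurable map of the input and of a
random seed, together with the law of the seed. -/
structure Quantizer (V S : Type*) [MeasurableSpace V] [MeasurableSpace S] where
  /-- quantized value of an input for a given seed -/
  toFun : V → S → V
  measurable_toFun : Measurable (Function.uncurry toFun)
  /-- law of the seed -/
  seedLaw : Measure S
  isProb : IsProbabilityMeasure seedLaw

attribute [instance] Quantizer.isProb

namespace Quantizer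

variable {V S : Type*} [MeasurableSpace V] [MeasurableSpace S]
  [NormedAddCommGroup V] [InnerProductSpace ℝ V]

/-- `E[Q(u) | u] = u` for every input `u`. -/
def Unbiased (Q : Quantizer V S) : Prop :=
  ∀ u : V, Integrable (fun s => Q.toFun u s) Q.seedLaw ∧ ∫ s, Q.toFun u s ∂Q.seedLaw = u

/-- The quantization error has a finite second moment at every input. -/
def FiniteErrorMoment (Q : Quantizer V S) : Prop :=
  ∀ u : V, Integrable (fun s => ‖Q.toFun u s - u‖ ^ 2) Q.seedLaw

/-- Conditional second moment `E[(Q(u) - u)(Q(u) - u)ᵀ | u]` of the quantization error, as a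
function of the input `u`. -/
def errCov (Q : Quantizer V S) (u : V) : V →L[ℝ] V :=
  ∫ s, rankOne ℝ (Q.toFun u s - u) (Q.toFun u s - u) ∂Q.seedLaw

end Quantizer

/-! ### Operators on a Hilbert space -/

section Operators

variable {E : Type*} [NormedAddCommGroup E] [InnerProductSpace ℝ E]

/-- Squared weighted seminorm `‖w‖²_A = ⟨w, A w⟩`. -/
def normSq (A : E →L[ℝ] E) (w : E) : ℝ := ⟪w, A w⟫

/-- Trace of an operator, `∑ᵢ ⟨bᵢ, T bᵢ⟩` along a Hilbert basis (the choice of the basis is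
irrelevant for trace-class operators). -/
def opTrace [CompleteSpace E] (T : E →L[ℝ] E) : ℝ :=
  ∑' i, ⟪(exists_hilbertBasis ℝ E).choose_spec.choose i,
    T ((exists_hilbertBasis ℝ E).choose_spec.choose i)⟫

/-- Inverse of an injective operator on its range (in infinite dimension the inverse of a compact
injective operator is only defined there). -/
def opInv (T : E →L[ℝ] E) : E → E := Function.invFun T

/-- `‖w‖²_{D₁}` for `D₁ = H (H + D)⁻¹ D (H + D)⁻¹ H`, read as `‖(H + D)⁻¹ H w‖²_D`. -/
def d1NormSq (H D : E →L[ℝ] E) (w : E) : ℝ := normSq D (opInv (H + D) (H w))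

/-- `‖w‖²_{D₂}` for `D₂ = D (H + D)⁻¹ H (H + D)⁻¹ D`, read as `‖(H + D)⁻¹ D w‖²_H`. -/
def d2NormSq (H D : E →L[ℝ] E) (w : E) : ℝ := normSq H (opInv (H + D) (D w))

theorem opInv_eq {T S : E →L[ℝ] E} (hTS : T ∘L S = 1) (hST : S ∘L T = 1) (w : E) :
    opInv T w = S w := by
  have hinj : Function.Injective T := by
    intro a b hab
    have h := congrArg S hab
    have ha : S (T a) = a := DFunLike.congr_fun hST a
    have hb : S (T b) = b := DFunLike.congr_fun hST b
    rwa [ha, hb] at h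
  have h1 : T (S w) = w := DFunLike.congr_fun hTS w
  conv_lhs => rw [← h1]
  exact Function.leftInverse_invFun hinj (S w)

theorem inv_symm {T S : E →L[ℝ] E} (hT : T.IsSymmetric)
    (hTS : T ∘L S = 1) (a b : E) : ⟪S a, b⟫ = ⟪a, S b⟫ := by
  have ha : T (S a) = a := DFunLike.congr_fun hTS a
  have hb : T (S b) = b := DFunLike.congr_fun hTS b
  have h := hT (S a) (S b)
  simp only [ContinuousLinearMap.coe_coe] at h
  rw [ha, hb] at h
  exact h.symm

/-- When `H + D` is invertible, `d1NormSq` is the quadratic form of `D₁`. -/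
theorem d1NormSq_eq {H D S : E →L[ℝ] E} (hH : H.IsSymmetric) (hD : D.IsSymmetric)
    (hTS : (H + D) ∘L S = 1) (hST : S ∘L (H + D) = 1) (w : E) :
    d1NormSq H D w = normSq (H ∘L S ∘L D ∘L S ∘L H) w := by
  have hT : (H + D).IsSymmetric := hH.add hD
  rw [d1NormSq, opInv_eq hTS hST]
  simp only [normSq, ContinuousLinearMap.comp_apply]
  rw [inv_symm hT hTS]
  exact hH _ _

/-- When `H + D` is invertible, `d2NormSq` is the quadratic form of `D₂`. -/
theorem d2NormSq_eq {H D S : E →L[ℝ] E} (hH : H.IsSymmetric) (hD : D.IsSymmetric)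
    (hTS : (H + D) ∘L S = 1) (hST : S ∘L (H + D) = 1) (w : E) :
    d2NormSq H D w = normSq (D ∘L S ∘L H ∘L S ∘L D) w := by
  have hT : (H + D).IsSymmetric := hH.add hD
  rw [d2NormSq, opInv_eq hTS hST]
  simp only [normSq, ContinuousLinearMap.comp_apply]
  rw [inv_symm hT hTS]
  exact hD _ _

/-- `T = ∑ᵢ lam i • v i (v i)ᵀ` is an eigen-decomposition with non-increasing eigenvalues and a
complete orthonormal system of eigenvectors. Positions `0, 1, 2, …` hold `λ₁, λ₂, λ₃, …`; in finite dimension `d` both sequences are continued by zeros beyond the first `d`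
entries. -/
structure IsEigenDecomp (T : E →L[ℝ] E) (lam : ℕ → ℝ) (v : ℕ → E) : Prop where
  antitone : Antitone lam
  unit_or_zero : ∀ i, ‖v i‖ = 1 ∨ (v i = 0 ∧ lam i = 0)
  orthogonal : ∀ i j, i ≠ j → ⟪v i, v j⟫ = 0
  complete : (Submodule.span ℝ (Set.range v)).topologicalClosure = ⊤
  eigen : ∀ i, T (v i) = lam i • v i

/-- `max {k : λ_k ≥ c}` for 1-based indices (`0` if there is no such `k`). -/
def effDim (lam : ℕ → ℝ) (c : ℝ) : ℕ := sSup {k : ℕ | 1 ≤ k ∧ c ≤ lam (k - 1)}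

/-- `‖w‖²_A` for `A = ∑_{i ≤ k} f(λ_i) v_i v_iᵀ`. -/
def headNormSq (f : ℝ → ℝ) (lam : ℕ → ℝ) (v : ℕ → E) (k : ℕ) (w : E) : ℝ :=
  ∑ i ∈ Finset.range k, f (lam i) * ⟪v i, w⟫ ^ 2

/-- `‖w‖²_A` for `A = ∑_{i > k} f(λ_i) v_i v_iᵀ`. -/
def tailNormSq (f : ℝ → ℝ) (lam : ℕ → ℝ) (v : ℕ → E) (k : ℕ) (w : E) : ℝ :=
  ∑' i, f (lam (k + i)) * ⟪v (k + i), w⟫ ^ 2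

end Operators

/-! ### The linear regression model with quantization -/

/-- A law of the pair (feature, label) and the five quantizers: data, label, parameter, activation
and output gradient. Activations and output gradients are vectors of length the batch size `B`. -/
structure Model (E Sd Sl Sp Sa So : Type*) (B : ℕ) [MeasurableSpace E]
    [MeasurableSpace Sd] [MeasurableSpace Sl] [MeasurableSpace Sp] [MeasurableSpace Sa]
    [MeasurableSpace So] where
  /-- law of `(x, y)` -/
  law : Measure (E × ℝ)
  isProb : IsProbabilityMeasure law
  Qd : Quantizer E Sd
  Ql : Quantizer ℝ Sl
  Qp : Quantizer E Sp
  Qa : Quantizer (EuclideanSpace ℝ (Fin B)) Sa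
  Qo : Quantizer (EuclideanSpace ℝ (Fin B)) So

attribute [instance] Model.isProb

/-- One sample `(x, y)` together with the seeds used to quantize `x` and `y`. -/
abbrev Sample (E Sd Sl : Type*) := (E × ℝ) × (Sd × Sl)

/-- All the randomness of one iteration: a batch of `B` samples with their seeds, and the seeds of
the parameter, activation and output gradient quantizers. -/
abbrev StepInput (E Sd Sl Sp Sa So : Type*) (B : ℕ) :=
  (Fin B → Sample E Sd Sl) × (Sp × Sa × So)

namespace Model

variable {E Sd Sl Sp Sa So : Type*} {B : ℕ} [NormedAddCommGroup E] [InnerProductSpace ℝ E]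
  [MeasurableSpace E] [MeasurableSpace Sd] [MeasurableSpace Sl] [MeasurableSpace Sp]
  [MeasurableSpace Sa] [MeasurableSpace So] (M : Model E Sd Sl Sp Sa So B)

/-- Law of one sample with independent quantization seeds. -/
def sampleLaw : Measure (Sample E Sd Sl) := M.law.prod (M.Qd.seedLaw.prod M.Ql.seedLaw)

/-- Law of the randomness of one iteration: the samples of the batch are i.i.d., and all the
quantization seeds are independent. -/
def stepLaw : Measure (StepInput E Sd Sl Sp Sa So B) :=
  (Measure.pi fun _ : Fin B => M.sampleLaw).prod
    (M.Qp.seedLaw.prod (M.Qa.seedLaw.prod M.Qo.seedLaw))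

/-- Quantized feature `Q_d(x)`. -/
def xq (p : Sample E Sd Sl) : E := M.Qd.toFun p.1.1 p.2.1

/-- Quantized label `Q_l(y)`. -/
def yq (p : Sample E Sd Sl) : ℝ := M.Ql.toFun p.1.2 p.2.2

/-- `H = E[x xᵀ]`. -/
def H : E →L[ℝ] E := ∫ z, rankOne ℝ z.1 z.1 ∂M.law

/-- `H^(q) = E[Q_d(x) Q_d(x)ᵀ]`. -/
def Hq : E →L[ℝ] E := ∫ p, rankOne ℝ (M.xq p) (M.xq p) ∂M.sampleLaw

/-- `D = E[(Q_d(x) - x)(Q_d(x) - x)ᵀ]`. -/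
def D : E →L[ℝ] E := ∫ p, rankOne ℝ (M.xq p - p.1.1) (M.xq p - p.1.1) ∂M.sampleLaw

/-- Population risk `L(w) = ½ E[(y - ⟨w, x⟩)²]`. -/
def risk (w : E) : ℝ := (1 / 2) * ∫ z, (z.2 - ⟪w, z.1⟫) ^ 2 ∂M.law

/-- Quantized squared loss `E[(Q_l(y) - ⟨w, Q_d(x)⟩)²]`. -/
def quantRisk (w : E) : ℝ := ∫ p, (M.yq p - ⟪w, M.xq p⟫) ^ 2 ∂M.sampleLaw

/-! #### Assumptions -/

/-- All five quantizers are unbiased. -/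
def UnbiasedQuantizers : Prop :=
  M.Qd.Unbiased ∧ M.Ql.Unbiased ∧ M.Qp.Unbiased ∧ M.Qa.Unbiased ∧ M.Qo.Unbiased

/-- `tr H = E‖x‖²` and `tr H^(q) = E‖Q_d(x)‖²` are finite, and so are `E[y²]` and `E[Q_l(y)²]`
(finiteness of the two population losses). -/
def FiniteMoments : Prop :=
  Integrable (fun z : E × ℝ => ‖z.1‖ ^ 2) M.law ∧
  Integrable (fun p => ‖M.xq p‖ ^ 2) M.sampleLaw ∧
  Integrable (fun z : E × ℝ => z.2 ^ 2) M.law ∧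
  Integrable (fun p => M.yq p ^ 2) M.sampleLaw

/-- Fourth-order moment condition: for every positive semidefinite `A`,
`E[x_q x_qᵀ A x_q x_qᵀ] ≼ α tr(H^(q) A) H^(q)` with `x_q = Q_d(x)`. -/
def FourthMoment [CompleteSpace E] (α : ℝ) : Prop :=
  ∀ A : E →L[ℝ] E, A.IsPositive →
    Integrable (fun p => rankOne ℝ (M.xq p) (M.xq p) ∘L A ∘L rankOne ℝ (M.xq p) (M.xq p))
      M.sampleLaw ∧
    ∫ p, rankOne ℝ (M.xq p) (M.xq p) ∘L A ∘L rankOne ℝ (M.xq p) (M.xq p) ∂M.sampleLaw ≤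
      (α * opTrace (M.Hq ∘L A)) • M.Hq

/-- Model noise condition: `E[ξ² x_q x_qᵀ] ≼ σ² H^(q)` with `ξ = Q_l(y) - ⟨wq, x_q⟩`. -/
def NoiseBound (wq : E) (σ : ℝ) : Prop :=
  Integrable (fun p => (M.yq p - ⟪wq, M.xq p⟫) ^ 2 • rankOne ℝ (M.xq p) (M.xq p)) M.sampleLaw ∧
  ∫ p, (M.yq p - ⟪wq, M.xq p⟫) ^ 2 • rankOne ℝ (M.xq p) (M.xq p) ∂M.sampleLaw ≤ σ ^ 2 • M.Hq

/-! #### The quantized SGD iteration -/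

/-- Quantized parameter `Q_p(w)`. -/
def wquant (w : E) (z : StepInput E Sd Sl Sp Sa So B) : E := M.Qp.toFun w z.2.1

/-- Activation `a = Q_d(X) Q_p(w)`. -/
def activation (w : E) (z : StepInput E Sd Sl Sp Sa So B) : EuclideanSpace ℝ (Fin B) :=
  WithLp.toLp 2 fun i => ⟪M.xq (z.1 i), M.wquant w z⟫

/-- Output gradient `o = Q_l(y) - Q_a(a)`. -/
def outGrad (w : E) (z : StepInput E Sd Sl Sp Sa So B) : EuclideanSpace ℝ (Fin B) :=
  WithLp.toLp 2 (fun i => M.yq (z.1 i)) - M.Qa.toFun (M.activation w z) z.2.2.1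

/-- One update `w + (γ / B) Q_d(X)ᵀ Q_o(o)`. -/
def step (γ : ℝ) (w : E) (z : StepInput E Sd Sl Sp Sa So B) : E :=
  w + (γ * (1 / (B : ℝ))) • ∑ i, M.Qo.toFun (M.outGrad w z) z.2.2.2 i • M.xq (z.1 i)

/-- Iterates `w_t` started from `w_0 = 0`; the input of step `t ≥ 1` is `z t`. -/
def iter (γ : ℝ) (z : ℕ → StepInput E Sd Sl Sp Sa So B) : ℕ → E
  | 0 => 0
  | t + 1 => M.step γ (iter γ z t) (z (t + 1))

/-- Iterate average `(1/N) ∑_{t=0}^{N-1} w_t`. -/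
def avgIter (γ : ℝ) (N : ℕ) (z : ℕ → StepInput E Sd Sl Sp Sa So B) : E :=
  (1 / (N : ℝ)) • ∑ t ∈ Finset.range N, M.iter γ z t

variable {Ω : Type*} [MeasurableSpace Ω]

/-- Effective noise level
`(σ² + sup_t ‖E[ε_t^(o) ε_t^(o)ᵀ | o_t] + E[ε_t^(a) ε_t^(a)ᵀ | a_t]‖) / B
  + α sup_t E[tr(H^(q) ε_{t-1}^(p) ε_{t-1}^(p)ᵀ)]`, with `t` ranging over `1, …, N`.
The norm of the conditional second moments is random, and its supremum is the essential one.
The value may be `∞`. -/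
def sigmaG2 [CompleteSpace E] (γ α σ : ℝ) (N : ℕ) (P : Measure Ω)
    (Z : ℕ → Ω → StepInput E Sd Sl Sp Sa So B) : ℝ≥0∞ :=
  (ENNReal.ofReal (σ ^ 2) +
      ⨆ t ∈ Finset.Icc 1 N, essSup (fun ω =>
        ‖M.Qo.errCov (M.outGrad (M.iter γ (fun s => Z s ω) (t - 1)) (Z t ω)) +
          M.Qa.errCov (M.activation (M.iter γ (fun s => Z s ω) (t - 1)) (Z t ω))‖ₑ) P) / (B : ℝ≥0∞)
    + ENNReal.ofReal α * ⨆ t ∈ Finset.Icc 1 N, ∫⁻ ω, ENNReal.ofReal (opTrace (M.Hq ∘L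
        rankOne ℝ
          (M.wquant (M.iter γ (fun s => Z s ω) (t - 1)) (Z t ω) - M.iter γ (fun s => Z s ω) (t - 1))
          (M.wquant (M.iter γ (fun s => Z s ω) (t - 1)) (Z t ω)
            - M.iter γ (fun s => Z s ω) (t - 1)))) ∂P

/-! #### The four error terms

Here `s` is the effective noise level, `wq` the optimum on quantized data, `lam`, `v` the
eigen-decomposition of `H^(q)` and `k` the effective dimension. -/

/-- Common factor
`(s + (2α/(Nγ)) (‖wq‖²_{I_{0:k}} + Nγ ‖wq‖²_{H_{k:∞}})) / (1 - γ α tr(H + D))`. -/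
def varFactor [CompleteSpace E] (γ α s : ℝ) (N : ℕ) (lam : ℕ → ℝ) (v : ℕ → E) (k : ℕ) (wq : E) :
    ℝ :=
  (s + 2 * α / (N * γ) *
      (headNormSq (fun _ => 1) lam v k wq + N * γ * tailNormSq (fun l => l) lam v k wq)) /
    (1 - γ * α * opTrace (M.H + M.D))

/-- Variance error. -/
def varErr [CompleteSpace E] (γ α s : ℝ) (N : ℕ) (lam : ℕ → ℝ) (v : ℕ → E) (k : ℕ) (wq : E) : ℝ :=
  M.varFactor γ α s N lam v k wq * ((k : ℝ) / N + N * γ ^ 2 * ∑' i, lam (k + i) ^ 2)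

/-- Approximation error. -/
def approxErr (wstar : E) : ℝ :=
  (∫ p, (M.yq p - p.1.2) ^ 2 ∂M.sampleLaw) + 3 / 2 * d1NormSq M.H M.D wstar
    + 1 / 2 * d2NormSq M.H M.D wstar

/-- Quantized error. -/
def quantizedErr [CompleteSpace E] (γ α s : ℝ) (N : ℕ) (lam : ℕ → ℝ) (v : ℕ → E) (k : ℕ) (wq : E) :
    ℝ :=
  2 * ‖M.D‖ * (1 / (γ ^ 2 * N ^ 2) * headNormSq (fun l => (l ^ 2)⁻¹) lam v k wq
      + tailNormSq (fun _ => 1) lam v k wq)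
  + 2 * ‖M.D‖ * (M.varFactor γ α s N lam v k wq *
      ((∑ i ∈ Finset.range k, 1 / (N * lam i)) + N * γ ^ 2 * ∑' i, lam (k + i)))

end Model

/-- Bias error. -/
def biasErr {E : Type*} [NormedAddCommGroup E] [InnerProductSpace ℝ E]
    (γ : ℝ) (N : ℕ) (lam : ℕ → ℝ) (v : ℕ → E) (k : ℕ) (wq : E) : ℝ :=
  1 / (γ ^ 2 * N ^ 2) * headNormSq (fun l => l⁻¹) lam v k wq + tailNormSq (fun l => l) lam v k wq

end QuantSGD

end

/-! ### Scalar recursions and the deterministic bound for averaged iterates -/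

namespace QuantSGD

/-! ### Geometric sums -/

/-! The comparison point is the quantized optimum `wq`, not `wstar`. Since the quantizers are
unbiased and independent given the sample, one has Hq = H + D, and the two normal equations combine
to Hq wq = H wstar. Hence ‖wq‖²_D and ‖wstar - wq‖²_H are exactly the D₁ and D₂ seminorms of
`wstar`, and one square in D gives: excess risk at w ≤ ½‖w - wq‖²_Hq + ½‖wstar‖²_D₁ + ½‖wstar‖²_D₂
(`risk_sub_risk_le`). The distance is already measured in Hq, so QuantizedErr, the label error and
one full D₁ term remain as nonnegative slack.

What is left is averaged SGD for the least squares problem (x_q, y_q). Given the history, the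
stochastic gradient has mean -B Hq (w_t - wq), and its second moment in direction u is at most
B²‖u‖²_Hq R_t with R_t = α τ_t + α b_t + 2s, where τ_t = E‖w_t - wq‖²_Hq, b_t = ‖E w_t - wq‖²_Hq and
s is the effective noise level (`stepDir_moments`). The residual at `wq` need not be independent of
x_q, so the second moment contains a term linear in Q_p(w_t) - wq. Averaged over the history, this
term sees only the mean iterate, and costs σ² and α b_t instead of another α τ_t. The coefficient of
τ_t stays α, which is why γ α tr Hq < 1 is enough.

In the eigenbasis of Hq the problem splits into scalars. The second moment of each coordinate of w_t
- wq contracts by (1 - γλ_i)², with input γ²λ_i R_t. Weighted by λ_i and summed, this bounds ∑τ_t by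
the initial energy plus γ tr(Hq) ∑R_t; as R_t contains α τ_t, the inequality closes on itself and
yields (1/2N)∑R_t ≤ V. Each coordinate of ∑(w_t - wq) is the last value of a martingale: the sum so
far plus G_{N-t} times the current coordinate, with G_n = ∑_{j<n} (1 - γλ_i)^j. Its increments are
orthogonal and carry the weights G_{N-1-t}. Using G_n ≤ 1/(γλ_i) on the head and G_n ≤ N on the tail
produces VarErr and BiasErr (`average_energy_le`, `average_energy_bound`). -/

theorem geom_sum_le_nat {q : ℝ} (h0 : 0 ≤ q) (h1 : q ≤ 1) (n : ℕ) :
    ∑ j ∈ Finset.range n, q ^ j ≤ n := by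
  calc ∑ j ∈ Finset.range n, q ^ j ≤ ∑ _j ∈ Finset.range n, (1 : ℝ) :=
        Finset.sum_le_sum fun j _ => pow_le_one₀ h0 h1
    _ = n := by simp

theorem one_sub_mul_geom_sum_le_one {q : ℝ} (h0 : 0 ≤ q) (n : ℕ) :
    (1 - q) * ∑ j ∈ Finset.range n, q ^ j ≤ 1 := by
  have h := mul_neg_geom_sum q n
  rw [h]
  have := pow_nonneg h0 n
  linarith

/-- Summed version of the recursion `m (t + 1) ≤ q² m t + c R t`. -/
theorem sum_le_of_contraction {q A c : ℝ} (h0 : 0 ≤ q) (h1 : q ≤ 1) (hc : 0 ≤ c)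
    {N : ℕ} {m R : ℕ → ℝ} (hR : ∀ t < N, 0 ≤ R t) (hm0 : m 0 ≤ A)
    (hm : ∀ t < N, m (t + 1) ≤ q ^ 2 * m t + c * R t) :
    (1 - q) * ∑ t ∈ Finset.range N, m t ≤
      A * ((1 - q) * ∑ t ∈ Finset.range N, (q ^ t) ^ 2) + c * ∑ t ∈ Finset.range N, R t := by
  set n : ℕ → ℝ := fun t => Nat.rec 0 (fun t x => q ^ 2 * x + c * R t) t with hn
  have hn0 : n 0 = 0 := rfl
  have hns : ∀ t, n (t + 1) = q ^ 2 * n t + c * R t := fun t => rfl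
  have hcmp : ∀ t ≤ N, 0 ≤ n t ∧ m t ≤ A * (q ^ t) ^ 2 + n t := by
    intro t
    induction t with
    | zero => intro _; simp [hn0, hm0]
    | succ t ih =>
      intro ht
      obtain ⟨ih1, ih2⟩ := ih (by omega)
      have hRt := hR t (by omega)
      rw [hns]
      refine ⟨by positivity, (hm t (by omega)).trans ?_⟩
      have := mul_le_mul_of_nonneg_left ih2 (sq_nonneg q)
      have h3 : q ^ 2 * (A * (q ^ t) ^ 2 + n t) = A * (q ^ (t + 1)) ^ 2 + q ^ 2 * n t := by ring
      linarith
  have htel : ∀ t ≤ N, (1 - q ^ 2) * ∑ j ∈ Finset.range t, n j + n t =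
      c * ∑ j ∈ Finset.range t, R j := by
    intro t
    induction t with
    | zero => intro _; simp [hn0]
    | succ t ih =>
      intro ht
      rw [Finset.sum_range_succ, Finset.sum_range_succ, hns, mul_add c, ← ih (by omega)]
      ring
  have hsn : 0 ≤ ∑ j ∈ Finset.range N, n j :=
    Finset.sum_nonneg fun j hj => (hcmp j (Finset.mem_range.1 hj).le).1
  have h2 : (1 - q) * ∑ j ∈ Finset.range N, n j ≤ c * ∑ j ∈ Finset.range N, R j := by
    rw [← htel N le_rfl]
    have := (hcmp N le_rfl).1
    -- Telescoping produces the factor 1 - q², which dominates 1 - q on [0, 1].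
    have hq : 1 - q ≤ 1 - q ^ 2 := by nlinarith
    have := mul_le_mul_of_nonneg_right hq hsn
    linarith
  have h3 : ∑ t ∈ Finset.range N, m t ≤
      A * ∑ t ∈ Finset.range N, (q ^ t) ^ 2 + ∑ t ∈ Finset.range N, n t := by
    rw [Finset.mul_sum, ← Finset.sum_add_distrib]
    exact Finset.sum_le_sum fun t ht => (hcmp t (Finset.mem_range.1 ht).le).2
  have := mul_le_mul_of_nonneg_left h3 (sub_nonneg.2 h1)
  linarith

/-! ### Series split into a head and a tail -/

/-- The cut `k` is arbitrary, and the two sides of it may be dominated by unrelated sequences: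
1/(γλ)-type bounds below it, N-type bounds above it. -/
theorem hasSum_le_head_add_tail {f g h : ℕ → ℝ} {T : ℝ} (hf : HasSum f T) (k : ℕ)
    (hg : ∀ i < k, f i ≤ g i) (hh : ∀ i, f (k + i) ≤ h i) (hs : Summable h) :
    T ≤ ∑ i ∈ Finset.range k, g i + ∑' i, h i := by
  rw [← hf.tsum_eq, ← hf.summable.sum_add_tsum_nat_add k]
  refine add_le_add (Finset.sum_le_sum fun i hi => hg i (Finset.mem_range.1 hi)) ?_
  refine Summable.tsum_le_tsum (fun i => ?_) ((summable_nat_add_iff k).2 hf.summable) hs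
  rw [add_comm i k]
  exact hh i

theorem summable_add_left {f : ℕ → ℝ} (hf : Summable f) (k : ℕ) :
    Summable fun i => f (k + i) := by
  simpa only [add_comm] using (summable_nat_add_iff k).2 hf

/-- Deterministic part of the analysis of averaged SGD: `m t i` are the second moments of the
coordinates of the centred iterates, `τ t` and `b t` the energies of the iterates and of their
means, `S i` the second moments of the coordinates of the sum of the iterates. -/
theorem average_energy_le {N : ℕ} (hN : 1 ≤ N) {γ α s tr : ℝ} (hγ : 0 < γ) (hα : 0 ≤ α)
    (hs : 0 ≤ s) {lam a : ℕ → ℝ} (hlam : ∀ i, 0 ≤ lam i) (htr : HasSum lam tr)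
    (hstep : γ * α * tr < 1) (hq : ∀ i, γ * lam i ≤ 1) (ha : Summable fun i => a i ^ 2)
    {m : ℕ → ℕ → ℝ} {τ b : ℕ → ℝ} (hmn : ∀ t i, 0 ≤ m t i) (hm0 : ∀ i, m 0 i ≤ a i ^ 2)
    (hm : ∀ t < N, ∀ i, m (t + 1) i ≤
      (1 - γ * lam i) ^ 2 * m t i + γ ^ 2 * lam i * (α * τ t + α * b t + 2 * s))
    (hτ : ∀ t < N, HasSum (fun i => lam i * m t i) (τ t))
    (hb : ∀ t < N, HasSum (fun i => lam i * ((1 - γ * lam i) ^ t * a i) ^ 2) (b t))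
    {S : ℕ → ℝ} {T : ℝ}
    (hS : ∀ i, S i ≤ (∑ j ∈ Finset.range N, (1 - γ * lam i) ^ j) ^ 2 * a i ^ 2 +
      ∑ t ∈ Finset.range N, (∑ j ∈ Finset.range (N - 1 - t), (1 - γ * lam i) ^ j) ^ 2 *
        (γ ^ 2 * lam i * (α * τ t + α * b t + 2 * s)))
    (hT : HasSum (fun i => lam i * S i) T) (k : ℕ) :
    1 / 2 * (T / N ^ 2) ≤
      (s + 2 * α / (N * γ) * ((∑ i ∈ Finset.range k, a i ^ 2) +
          N * γ * ∑' i, lam (k + i) * a (k + i) ^ 2)) / (1 - γ * α * tr) *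
        ((k : ℝ) / N + N * γ ^ 2 * ∑' i, lam (k + i) ^ 2) +
      (1 / (γ ^ 2 * N ^ 2) * (∑ i ∈ Finset.range k, (lam i)⁻¹ * a i ^ 2) +
        ∑' i, lam (k + i) * a (k + i) ^ 2) := by
  have hN' : (1 : ℝ) ≤ N := by exact_mod_cast hN
  set R : ℕ → ℝ := fun t => α * τ t + α * b t + 2 * s with hRdef
  have hτ0 : ∀ t < N, 0 ≤ τ t := fun t ht =>
    (hτ t ht).nonneg fun i => mul_nonneg (hlam i) (hmn t i)
  have hb0 : ∀ t < N, 0 ≤ b t := fun t ht =>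
    (hb t ht).nonneg fun i => mul_nonneg (hlam i) (sq_nonneg _)
  have hR0 : ∀ t < N, 0 ≤ R t := fun t ht => by
    have := hτ0 t ht
    have := hb0 t ht
    simp only [hRdef]
    positivity
  have q0 : ∀ i, 0 ≤ 1 - γ * lam i := fun i => by linarith [hq i]
  have q1 : ∀ i, 1 - γ * lam i ≤ 1 := fun i => by linarith [mul_nonneg hγ.le (hlam i)]
  have hlamle : ∀ i, lam i ≤ 1 / γ := fun i => by
    rw [le_div_iff₀ hγ, mul_comm]; exact hq i
  have hsl : Summable fun i => lam i * a i ^ 2 :=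
    Summable.of_nonneg_of_le (fun i => mul_nonneg (hlam i) (sq_nonneg _))
      (fun i => mul_le_mul_of_nonneg_right (hlamle i) (sq_nonneg _)) (ha.mul_left (1 / γ))
  have hsl2 : Summable fun i => lam i ^ 2 :=
    Summable.of_nonneg_of_le (fun i => sq_nonneg _)
      (fun i => by rw [sq]; exact mul_le_mul_of_nonneg_right (hlamle i) (hlam i))
      (htr.summable.mul_left (1 / γ))
  set Sa := ∑ i ∈ Finset.range k, a i ^ 2 with hA
  set Λ := ∑' i, lam (k + i) * a (k + i) ^ 2 with hΛ
  set Λ2 := ∑' i, lam (k + i) ^ 2 with hΛ2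
  set SR := ∑ t ∈ Finset.range N, R t with hSR
  have hSR0 : 0 ≤ SR := Finset.sum_nonneg fun t ht => hR0 t (Finset.mem_range.1 ht)
  have hA0 : 0 ≤ Sa := Finset.sum_nonneg fun i _ => sq_nonneg _
  have hΛ0 : 0 ≤ Λ := tsum_nonneg fun i => mul_nonneg (hlam _) (sq_nonneg _)
  have hΛ20 : 0 ≤ Λ2 := tsum_nonneg fun i => sq_nonneg _
  -- Dropping the square lets a single geometric sum supply both bounds, N and 1/(γλ).
  have geomsq : ∀ i, ∑ t ∈ Finset.range N, ((1 - γ * lam i) ^ t) ^ 2 ≤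
      ∑ t ∈ Finset.range N, (1 - γ * lam i) ^ t := fun i =>
    Finset.sum_le_sum fun t _ => by
      have h1 := pow_le_one₀ (n := t) (q0 i) (q1 i)
      have h2 := pow_nonneg (q0 i) t
      nlinarith
  have hbN : ∀ i, ∑ t ∈ Finset.range N, ((1 - γ * lam i) ^ t) ^ 2 ≤ (N : ℝ) := fun i =>
    (geomsq i).trans (geom_sum_le_nat (q0 i) (q1 i) N)
  have hb1 : ∀ i, γ * lam i * ∑ t ∈ Finset.range N, ((1 - γ * lam i) ^ t) ^ 2 ≤ 1 := fun i => by
    have h1 := one_sub_mul_geom_sum_le_one (q0 i) N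
    have h2 := mul_le_mul_of_nonneg_left (geomsq i) (mul_nonneg hγ.le (hlam i))
    have h3 : 1 - (1 - γ * lam i) = γ * lam i := by ring
    rw [h3] at h1
    exact h2.trans h1
  -- energy of the means
  have hsumb : ∑ t ∈ Finset.range N, b t ≤ (1 / γ) * (Sa + N * γ * Λ) := by
    have hs1 : HasSum (fun i => ∑ t ∈ Finset.range N, lam i * ((1 - γ * lam i) ^ t * a i) ^ 2)
        (∑ t ∈ Finset.range N, b t) :=
      hasSum_sum fun t ht => hb t (Finset.mem_range.1 ht)
    have hrew : ∀ i, ∑ t ∈ Finset.range N, lam i * ((1 - γ * lam i) ^ t * a i) ^ 2 =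
        lam i * a i ^ 2 * ∑ t ∈ Finset.range N, ((1 - γ * lam i) ^ t) ^ 2 := fun i => by
      rw [Finset.mul_sum]
      exact Finset.sum_congr rfl fun t _ => by ring
    have h := hasSum_le_head_add_tail hs1 k (g := fun i => (1 / γ) * a i ^ 2)
      (h := fun i => N * (lam (k + i) * a (k + i) ^ 2)) (fun i _ => by
        rw [hrew, one_div, ← div_eq_inv_mul, le_div_iff₀ hγ]
        have := mul_le_mul_of_nonneg_right (hb1 i) (sq_nonneg (a i))
        linarith) (fun i => by
        rw [hrew, mul_comm (N : ℝ)]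
        exact mul_le_mul_of_nonneg_left (hbN _) (mul_nonneg (hlam _) (sq_nonneg _)))
      ((summable_add_left hsl k).mul_left _)
    rw [← Finset.mul_sum, tsum_mul_left] at h
    refine h.trans (le_of_eq ?_)
    rw [hA, hΛ]
    field_simp
  -- energy of the iterates
  have hsumτ : ∑ t ∈ Finset.range N, τ t ≤ (1 / γ) * (Sa + N * γ * Λ) + γ * tr * SR := by
    have hs1 : HasSum (fun i => ∑ t ∈ Finset.range N, lam i * m t i)
        (∑ t ∈ Finset.range N, τ t) :=
      hasSum_sum fun t ht => hτ t (Finset.mem_range.1 ht)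
    -- The noise contribution γ λ_i `SR` has total γ tr `SR` and needs no head/tail distinction, so
    -- it is subtracted before the split.
    have hs2 := hs1.sub ((htr.mul_left γ).mul_right SR)
    have hkey : ∀ i, γ * (lam i * ∑ t ∈ Finset.range N, m t i) ≤
        a i ^ 2 * (γ * lam i * ∑ t ∈ Finset.range N, ((1 - γ * lam i) ^ t) ^ 2) +
          γ ^ 2 * lam i * SR := fun i => by
      have := sum_le_of_contraction (q0 i) (q1 i) (c := γ ^ 2 * lam i)
        (mul_nonneg (sq_nonneg _) (hlam i)) hR0 (m := fun t => m t i) (hm0 i)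
        (fun t ht => hm t ht i)
      have h3 : 1 - (1 - γ * lam i) = γ * lam i := by ring
      rw [h3] at this
      linarith
    have h := hasSum_le_head_add_tail hs2 k (g := fun i => (1 / γ) * a i ^ 2)
      (h := fun i => N * (lam (k + i) * a (k + i) ^ 2)) (fun i _ => by
        rw [← Finset.mul_sum, one_div, ← div_eq_inv_mul, le_div_iff₀ hγ]
        have := mul_le_mul_of_nonneg_left (hb1 i) (sq_nonneg (a i))
        have := hkey i
        nlinarith) (fun i => by
        rw [← Finset.mul_sum]
        have h1 := mul_le_mul_of_nonneg_left (hbN (k + i))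
          (mul_nonneg (mul_nonneg hγ.le (hlam (k + i))) (sq_nonneg (a (k + i))))
        have h2 := hkey (k + i)
        refine le_of_mul_le_mul_left ?_ hγ
        linarith)
      ((summable_add_left hsl k).mul_left _)
    rw [← Finset.mul_sum, tsum_mul_left] at h
    have : (1 / γ) * (Sa + N * γ * Λ) = 1 / γ * Sa + N * Λ := by field_simp
    rw [this]
    linarith
  have hden : 0 < 1 - γ * α * tr := by linarith
  -- `SR` contains α∑τ, and ∑τ is bounded through `SR`; moving γ α tr `SR` to the left closes the
  -- loop. The 2α collects the equal bounds for ∑τ and ∑b.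
  have hSRle : SR * (1 - γ * α * tr) ≤ 2 * α * ((1 / γ) * (Sa + N * γ * Λ)) + 2 * s * N := by
    have h1 : SR = α * ∑ t ∈ Finset.range N, τ t + α * ∑ t ∈ Finset.range N, b t + N * (2 * s) := by
      simp only [hSR, hRdef, Finset.sum_add_distrib, Finset.mul_sum]
      simp
    have h2 := mul_le_mul_of_nonneg_left hsumτ hα
    have h3 := mul_le_mul_of_nonneg_left hsumb hα
    nlinarith
  -- The factor 1/2 from the risk turns 2s into s, and 2α into α, below what the right-hand side
  -- allows.
  have hV : 1 / 2 * (SR / N) ≤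
      (s + 2 * α / (N * γ) * (Sa + N * γ * Λ)) / (1 - γ * α * tr) := by
    rw [le_div_iff₀ hden]
    have h1 : 1 / 2 * (SR / N) * (1 - γ * α * tr) =
        1 / (2 * N) * (SR * (1 - γ * α * tr)) := by field_simp
    have h2 : 1 / (2 * N) * (2 * α * ((1 / γ) * (Sa + N * γ * Λ)) + 2 * s * N) =
        s + α / (N * γ) * (Sa + N * γ * Λ) := by field_simp; ring
    have h3 : 0 ≤ α / (N * γ) * (Sa + N * γ * Λ) := by positivity
    have h4 : 2 * α / (N * γ) * (Sa + N * γ * Λ) = 2 * (α / (N * γ) * (Sa + N * γ * Λ)) := by ring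
    rw [h1, h4]
    have := mul_le_mul_of_nonneg_left hSRle (by positivity : (0 : ℝ) ≤ 1 / (2 * N))
    linarith
  -- weights
  have g0 : ∀ i n, 0 ≤ ∑ j ∈ Finset.range n, (1 - γ * lam i) ^ j := fun i n =>
    Finset.sum_nonneg fun j _ => pow_nonneg (q0 i) j
  have gN : ∀ i n, n ≤ N → (∑ j ∈ Finset.range n, (1 - γ * lam i) ^ j) ^ 2 ≤ (N : ℝ) ^ 2 :=
    fun i n hn => by
      refine pow_le_pow_left₀ (g0 i n) ((geom_sum_le_nat (q0 i) (q1 i) n).trans ?_) 2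
      exact_mod_cast hn
  have g1 : ∀ i n, γ ^ 2 * lam i ^ 2 * (∑ j ∈ Finset.range n, (1 - γ * lam i) ^ j) ^ 2 ≤ 1 :=
    fun i n => by
      have h := one_sub_mul_geom_sum_le_one (q0 i) n
      have h3 : 1 - (1 - γ * lam i) = γ * lam i := by ring
      rw [h3] at h
      have h4 := pow_le_one₀ (n := 2) (mul_nonneg (mul_nonneg hγ.le (hlam i)) (g0 i n)) h
      calc _ = (γ * lam i * ∑ j ∈ Finset.range n, (1 - γ * lam i) ^ j) ^ 2 := by ring
        _ ≤ 1 := h4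
  have hhead : ∀ i < k, lam i * S i ≤ (1 / γ ^ 2) * ((lam i)⁻¹ * a i ^ 2) + SR := fun i _ => by
    refine (mul_le_mul_of_nonneg_left (hS i) (hlam i)).trans ?_
    rw [mul_add]
    refine add_le_add ?_ ?_
    -- For a zero eigenvalue `(lam i)⁻¹ = 0`, and both sides vanish.
    · rcases (hlam i).eq_or_lt with h | h
      · rw [← h]; simp
      · have := mul_le_mul_of_nonneg_right (g1 i N) (sq_nonneg (a i))
        rw [show 1 / γ ^ 2 * ((lam i)⁻¹ * a i ^ 2) = a i ^ 2 / (γ ^ 2 * lam i) by field_simp,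
          le_div_iff₀ (by positivity)]
        linarith
    · rw [hSR, Finset.mul_sum]
      refine Finset.sum_le_sum fun t ht => ?_
      have := mul_le_mul_of_nonneg_right (g1 i (N - 1 - t)) (hR0 t (Finset.mem_range.1 ht))
      linarith
  have htail : ∀ i, lam (k + i) * S (k + i) ≤
      N ^ 2 * (lam (k + i) * a (k + i) ^ 2) + N ^ 2 * γ ^ 2 * SR * lam (k + i) ^ 2 := fun i => by
    refine (mul_le_mul_of_nonneg_left (hS _) (hlam _)).trans ?_
    rw [mul_add]
    refine add_le_add ?_ ?_
    · have := mul_le_mul_of_nonneg_right (gN (k + i) N le_rfl)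
        (mul_nonneg (hlam (k + i)) (sq_nonneg (a (k + i))))
      linarith
    · have : N ^ 2 * γ ^ 2 * SR * lam (k + i) ^ 2 =
          ∑ t ∈ Finset.range N, N ^ 2 * (γ ^ 2 * lam (k + i) ^ 2 * R t) := by
        rw [← Finset.mul_sum, ← Finset.mul_sum]; ring
      rw [this, Finset.mul_sum]
      refine Finset.sum_le_sum fun t ht => ?_
      have := mul_le_mul_of_nonneg_right (gN (k + i) (N - 1 - t) (by omega))
        (mul_nonneg (mul_nonneg (sq_nonneg γ) (sq_nonneg (lam (k + i))))
          (hR0 t (Finset.mem_range.1 ht)))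
      refine le_trans (le_of_eq ?_) this
      simp only [hRdef]; ring
  have hfin := hasSum_le_head_add_tail hT k hhead htail
    (((summable_add_left hsl k).mul_left _).add ((summable_add_left hsl2 k).mul_left _))
  rw [Summable.tsum_add ((summable_add_left hsl k).mul_left _)
    ((summable_add_left hsl2 k).mul_left _), tsum_mul_left, tsum_mul_left,
    Finset.sum_add_distrib, ← Finset.mul_sum, Finset.sum_const, Finset.card_range,
    nsmul_eq_mul] at hfin
  set I := ∑ i ∈ Finset.range k, (lam i)⁻¹ * a i ^ 2 with hI
  have hI0 : 0 ≤ I := Finset.sum_nonneg fun i _ =>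
    mul_nonneg (inv_nonneg.2 (hlam i)) (sq_nonneg _)
  have hW0 : 0 ≤ (k : ℝ) / N + N * γ ^ 2 * Λ2 := by positivity
  have hfin2 : 1 / 2 * (T / N ^ 2) ≤ 1 / 2 * (SR / N) * ((k : ℝ) / N + N * γ ^ 2 * Λ2) +
      1 / 2 * (1 / (γ ^ 2 * N ^ 2) * I + Λ) := by
    have h1 := mul_le_mul_of_nonneg_left hfin (by positivity : (0 : ℝ) ≤ 1 / 2 / N ^ 2)
    refine le_trans (le_of_eq (by ring)) (h1.trans (le_of_eq ?_))
    field_simp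
    ring
  have h5 := mul_le_mul_of_nonneg_right hV hW0
  have h6 : 0 ≤ 1 / (γ ^ 2 * N ^ 2) * I + Λ := by positivity
  linarith

end QuantSGD

/-! ### Spectral expansions, integration of squares, least squares -/

namespace QuantSGD

/-! ### Eigen-decompositions -/

section Eigen

variable {E : Type*} [NormedAddCommGroup E] [InnerProductSpace ℝ E]

theorem IsEigenDecomp.inner_self {T : E →L[ℝ] E} {lam : ℕ → ℝ} {v : ℕ → E}
    (h : IsEigenDecomp T lam v) (i : ℕ) : ⟪v i, T (v i)⟫ = lam i := by
  rw [h.eigen, real_inner_smul_right, real_inner_self_eq_norm_sq]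
  rcases h.unit_or_zero i with h1 | ⟨_, h1⟩ <;> simp [h1]

/-- Parseval's identity for the eigenvectors. -/
theorem IsEigenDecomp.hasSum_inner_mul_inner [CompleteSpace E] {T : E →L[ℝ] E} {lam : ℕ → ℝ}
    {v : ℕ → E} (h : IsEigenDecomp T lam v) (x y : E) :
    HasSum (fun i => ⟪v i, x⟫ * ⟪v i, y⟫) ⟪x, y⟫ := by
  -- The zero vectors that pad a finite-dimensional decomposition are discarded; the remaining ones
  -- form a Hilbert basis.
  set I : Set ℕ := {i | v i ≠ 0} with hI
  have hon : Orthonormal ℝ (fun i : I => v i) := by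
    refine ⟨fun i => ?_, fun i j hij => h.orthogonal i j fun hc => hij (Subtype.ext hc)⟩
    rcases h.unit_or_zero i with h1 | h1
    · exact h1
    · exact absurd h1.1 i.2
  have hsp : ⊤ ≤ (Submodule.span ℝ (Set.range fun i : I => v i)).topologicalClosure := by
    rw [← h.complete]
    refine Submodule.topologicalClosure_mono (Submodule.span_le.2 ?_)
    rintro _ ⟨i, rfl⟩
    by_cases hi : v i = 0
    · rw [hi]; exact Submodule.zero_mem _
    · exact Submodule.subset_span ⟨⟨i, hi⟩, rfl⟩
  have hb := (HilbertBasis.mk hon hsp).hasSum_inner_mul_inner x y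
  rw [HilbertBasis.coe_mk] at hb
  have hsupp : Function.support (fun i => ⟪v i, x⟫ * ⟪v i, y⟫) ⊆ I := by
    intro i hi hc
    simp [hc] at hi
  rw [← hasSum_subtype_iff_of_support_subset hsupp]
  refine hb.congr_fun ?_
  intro i
  simp [real_inner_comm]

theorem IsEigenDecomp.hasSum_inner_sq [CompleteSpace E] {T : E →L[ℝ] E} {lam : ℕ → ℝ}
    {v : ℕ → E} (h : IsEigenDecomp T lam v) (x : E) :
    HasSum (fun i => ⟪v i, x⟫ ^ 2) (‖x‖ ^ 2) := by
  simpa only [sq, real_inner_self_eq_norm_mul_norm] using h.hasSum_inner_mul_inner x x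

theorem IsEigenDecomp.inner_apply {T : E →L[ℝ] E} (hT : T.IsSymmetric) {lam : ℕ → ℝ}
    {v : ℕ → E} (h : IsEigenDecomp T lam v) (i : ℕ) (x : E) :
    ⟪v i, T x⟫ = lam i * ⟪v i, x⟫ := by
  have := hT (v i) x
  simp only [ContinuousLinearMap.coe_coe] at this
  rw [← this, h.eigen, real_inner_smul_left]

theorem IsEigenDecomp.hasSum_normSq [CompleteSpace E] {T : E →L[ℝ] E} (hT : T.IsSymmetric)
    {lam : ℕ → ℝ} {v : ℕ → E} (h : IsEigenDecomp T lam v) (x : E) :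
    HasSum (fun i => lam i * ⟪v i, x⟫ ^ 2) (normSq T x) := by
  refine (h.hasSum_inner_mul_inner x (T x)).congr_fun fun i => ?_
  rw [h.inner_apply hT]
  ring

theorem opTrace_comp_rankOne [CompleteSpace E] (T : E →L[ℝ] E) (x : E) :
    opTrace (T ∘L rankOne ℝ x x) = normSq T x := by
  have h := (exists_hilbertBasis ℝ E).choose_spec.choose.hasSum_inner_mul_inner x (T x)
  rw [opTrace, normSq, ← h.tsum_eq]
  refine tsum_congr fun i => ?_
  simp [real_inner_smul_right]

theorem normSq_add {T : E →L[ℝ] E} (hT : T.IsSymmetric) (x y : E) :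
    normSq T (x + y) = normSq T x + 2 * ⟪T x, y⟫ + normSq T y := by
  have := hT x y
  simp only [ContinuousLinearMap.coe_coe] at this
  simp only [normSq, map_add, inner_add_left, inner_add_right]
  rw [real_inner_comm (T x) y, this]
  ring

theorem continuous_normSq (T : E →L[ℝ] E) : Continuous (normSq T) := by
  unfold normSq
  fun_prop

theorem normSq_le_norm (T : E →L[ℝ] E) (x : E) : normSq T x ≤ ‖T‖ * ‖x‖ ^ 2 := by
  refine (real_inner_le_norm _ _).trans ?_
  have := mul_le_mul_of_nonneg_left (T.le_opNorm x) (norm_nonneg x)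
  nlinarith

end Eigen

/-! ### Integration -/

section Integration

variable {X : Type*} [MeasurableSpace X] {μ : Measure X}

/-- Partial sums of the integrals stay below the integral of `G`, which gives the absolute
summability needed to exchange sum and integral. -/
theorem hasSum_integral_of_nonneg {F : ℕ → X → ℝ} {G : X → ℝ} (hF : ∀ i, Integrable (F i) μ)
    (h0 : ∀ i x, 0 ≤ F i x) (hG : Integrable G μ) (hs : ∀ x, HasSum (fun i => F i x) (G x)) :
    HasSum (fun i => ∫ x, F i x ∂μ) (∫ x, G x ∂μ) := by
  have hsum : Summable fun i => ∫ x, ‖F i x‖ ∂μ := by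
    refine summable_of_sum_le (c := ∫ x, G x ∂μ) (fun i => integral_nonneg fun x => norm_nonneg _)
      fun u => ?_
    have : ∀ i, ∫ x, ‖F i x‖ ∂μ = ∫ x, F i x ∂μ := fun i =>
      integral_congr_ae (Filter.Eventually.of_forall fun x => Real.norm_of_nonneg (h0 i x))
    simp only [this]
    rw [← integral_finsetSum _ fun i _ => hF i]
    refine integral_mono (integrable_finsetSum _ fun i _ => hF i) hG fun x => ?_
    exact sum_le_hasSum u (fun i _ => h0 i x) (hs x)
  have h := hasSum_integral_of_summable_integral_norm hF hsum
  have h2 : ∀ x, ∑' i, F i x = G x := fun x => (hs x).tsum_eq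
  simpa only [h2] using h

/-- Second moments of the gradient are first bounded as lower integrals, where Tonelli asks for no
integrability; this lemma and the next one return to Bochner integrals. -/
theorem integrable_of_lintegral_ofReal_le {f : X → ℝ} (hf : AEStronglyMeasurable f μ)
    (h0 : ∀ x, 0 ≤ f x) {c : ℝ} (h : ∫⁻ x, ENNReal.ofReal (f x) ∂μ ≤ ENNReal.ofReal c) :
    Integrable f μ := by
  refine ⟨hf, ?_⟩
  rw [hasFiniteIntegral_iff_ofReal (Filter.Eventually.of_forall h0)]
  exact h.trans_lt ENNReal.ofReal_lt_top

theorem integral_le_of_lintegral_ofReal_le {f : X → ℝ} (hf : AEStronglyMeasurable f μ)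
    (h0 : ∀ x, 0 ≤ f x) {c : ℝ} (hc : 0 ≤ c)
    (h : ∫⁻ x, ENNReal.ofReal (f x) ∂μ ≤ ENNReal.ofReal c) : ∫ x, f x ∂μ ≤ c := by
  rw [integral_eq_lintegral_of_nonneg_ae (Filter.Eventually.of_forall h0) hf]
  exact ENNReal.toReal_le_of_le_ofReal hc h

theorem lintegral_ofReal_eq {f : X → ℝ} (hf : Integrable f μ) (h0 : ∀ x, 0 ≤ f x) :
    ∫⁻ x, ENNReal.ofReal (f x) ∂μ = ENNReal.ofReal (∫ x, f x ∂μ) :=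
  (ofReal_integral_eq_lintegral_ofReal hf (Filter.Eventually.of_forall h0)).symm

/-- A product of square-integrable functions is integrable. -/
theorem integrable_mul_of_sq {f g : X → ℝ} (hf : AEStronglyMeasurable f μ)
    (hg : AEStronglyMeasurable g μ) (hf2 : Integrable (fun x => f x ^ 2) μ)
    (hg2 : Integrable (fun x => g x ^ 2) μ) : Integrable (fun x => f x * g x) μ :=
  ((memLp_two_iff_integrable_sq hf).2 hf2).integrable_mul
    ((memLp_two_iff_integrable_sq hg).2 hg2)

theorem integrable_of_sq [IsFiniteMeasure μ] {f : X → ℝ} (hf : AEStronglyMeasurable f μ)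
    (hf2 : Integrable (fun x => f x ^ 2) μ) : Integrable f μ :=
  ((memLp_two_iff_integrable_sq hf).2 hf2).integrable one_le_two

theorem integrable_sq_add {f g : X → ℝ} (hf : AEStronglyMeasurable f μ)
    (hg : AEStronglyMeasurable g μ) (hf2 : Integrable (fun x => f x ^ 2) μ)
    (hg2 : Integrable (fun x => g x ^ 2) μ) : Integrable (fun x => (f x + g x) ^ 2) μ :=
  (memLp_two_iff_integrable_sq (hf.add hg)).1
    (((memLp_two_iff_integrable_sq hf).2 hf2).add ((memLp_two_iff_integrable_sq hg).2 hg2))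

variable {E : Type*} [NormedAddCommGroup E]

theorem integrable_norm_sq_add {f g : X → E} (hf : AEStronglyMeasurable f μ)
    (hg : AEStronglyMeasurable g μ) (hf2 : Integrable (fun x => ‖f x‖ ^ 2) μ)
    (hg2 : Integrable (fun x => ‖g x‖ ^ 2) μ) : Integrable (fun x => ‖f x + g x‖ ^ 2) μ :=
  (memLp_two_iff_integrable_sq_norm (hf.add hg)).1
    (((memLp_two_iff_integrable_sq_norm hf).2 hf2).add
      ((memLp_two_iff_integrable_sq_norm hg).2 hg2))

theorem integrable_of_norm_sq [IsFiniteMeasure μ] {f : X → E} (hf : AEStronglyMeasurable f μ)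
    (hf2 : Integrable (fun x => ‖f x‖ ^ 2) μ) : Integrable f μ :=
  ((memLp_two_iff_integrable_sq_norm hf).2 hf2).integrable one_le_two

variable [InnerProductSpace ℝ E]

theorem integrable_inner_sq {f : X → E} (hf : AEStronglyMeasurable f μ)
    (hf2 : Integrable (fun x => ‖f x‖ ^ 2) μ) (u : E) :
    Integrable (fun x => ⟪u, f x⟫ ^ 2) μ := by
  refine (hf2.const_mul (‖u‖ ^ 2)).mono' ((hf.const_inner (𝕜 := ℝ)).pow 2)
    (Filter.Eventually.of_forall fun x => ?_)
  rw [Real.norm_of_nonneg (sq_nonneg _), ← mul_pow, ← sq_abs]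
  exact pow_le_pow_left₀ (abs_nonneg _) (abs_real_inner_le_norm u (f x)) 2

theorem continuous_rankOne : Continuous fun p : E × E => rankOne ℝ p.1 p.2 :=
  (rankOne ℝ (E := E) (F := E)).continuous₂

theorem integrable_rankOne {f g : X → E} (hf : AEStronglyMeasurable f μ)
    (hg : AEStronglyMeasurable g μ) (hf2 : Integrable (fun x => ‖f x‖ ^ 2) μ)
    (hg2 : Integrable (fun x => ‖g x‖ ^ 2) μ) :
    Integrable (fun x => rankOne ℝ (f x) (g x)) μ := by
  refine Integrable.mono' (integrable_mul_of_sq hf.norm hg.norm hf2 hg2) ?_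
    (Filter.Eventually.of_forall fun x => by simp)
  have h := Continuous.comp_aestronglyMeasurable (continuous_rankOne (E := E)) (hf.prodMk hg)
  exact h

theorem inner_integral_rankOne [CompleteSpace E] {f g : X → E}
    (h : Integrable (fun x => rankOne ℝ (f x) (g x)) μ) (u w : E) :
    ⟪u, (∫ x, rankOne ℝ (f x) (g x) ∂μ) w⟫ = ∫ x, ⟪u, f x⟫ * ⟪g x, w⟫ ∂μ := by
  rw [ContinuousLinearMap.integral_apply h, ← integral_inner (h.apply_continuousLinearMap w)]
  refine integral_congr_ae (Filter.Eventually.of_forall fun x => ?_)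
  simp [real_inner_smul_right, mul_comm]

end Integration

/-! ### Quadratic functionals -/

/-- First-order condition at the minimum of a quadratic function of one variable. -/
theorem eq_zero_of_quadratic_nonneg {b c : ℝ} (h : ∀ t : ℝ, 0 ≤ t * b + t ^ 2 * c) : b = 0 := by
  by_contra hb
  have hb2 : 0 < b ^ 2 := by positivity
  have hc : 0 < |c| + 1 := by positivity
  -- The exact minimiser -b/(2c) requires c > 0; the denominator |c| + 1 is positive and exceeds c
  -- whatever the sign of c.
  have h1 := h (-b / (|c| + 1))
  have h2 : -b / (|c| + 1) * b + (-b / (|c| + 1)) ^ 2 * c =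
      b ^ 2 / (|c| + 1) ^ 2 * (c - (|c| + 1)) := by field_simp; ring
  rw [h2] at h1
  have h3 : c - (|c| + 1) < 0 := by linarith [le_abs_self c]
  have h4 : 0 < b ^ 2 / (|c| + 1) ^ 2 := by positivity
  nlinarith

section LeastSquares

variable {X : Type*} [MeasurableSpace X] {μ : Measure X}
  {E : Type*} [NormedAddCommGroup E] [InnerProductSpace ℝ E] {x : X → E} {y : X → ℝ}

theorem integrable_residual_sq (hx : AEStronglyMeasurable x μ) (hy : AEStronglyMeasurable y μ)
    (hx2 : Integrable (fun p => ‖x p‖ ^ 2) μ) (hy2 : Integrable (fun p => y p ^ 2) μ) (w : E) :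
    Integrable (fun p => (y p - ⟪w, x p⟫) ^ 2) μ := by
  have h := integrable_sq_add hy (hx.const_inner (𝕜 := ℝ) (c := -w)) hy2
    (integrable_inner_sq hx hx2 (-w))
  simpa only [inner_neg_left, ← sub_eq_add_neg] using h

theorem integral_residual_sq_add (hx : AEStronglyMeasurable x μ) (hy : AEStronglyMeasurable y μ)
    (hx2 : Integrable (fun p => ‖x p‖ ^ 2) μ) (hy2 : Integrable (fun p => y p ^ 2) μ) (w u : E) :
    ∫ p, (y p - ⟪w + u, x p⟫) ^ 2 ∂μ = ∫ p, (y p - ⟪w, x p⟫) ^ 2 ∂μ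
      - 2 * ∫ p, (y p - ⟪w, x p⟫) * ⟪u, x p⟫ ∂μ + ∫ p, ⟪u, x p⟫ ^ 2 ∂μ := by
  have h1 := integrable_residual_sq hx hy hx2 hy2 w
  have h3 := integrable_inner_sq hx hx2 u
  have h2 : Integrable (fun p => (y p - ⟪w, x p⟫) * ⟪u, x p⟫) μ :=
    integrable_mul_of_sq (hy.sub hx.const_inner) hx.const_inner h1 h3
  rw [← integral_const_mul, ← integral_sub h1 (h2.const_mul 2),
    ← integral_add (f := fun p => (y p - ⟪w, x p⟫) ^ 2 - 2 * ((y p - ⟪w, x p⟫) * ⟪u, x p⟫))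
      (h1.sub (h2.const_mul 2)) h3]
  refine integral_congr_ae (Filter.Eventually.of_forall fun p => ?_)
  simp only [inner_add_left]
  ring

/-- Normal equations of least squares. -/
theorem integral_residual_mul_inner_eq_zero (hx : AEStronglyMeasurable x μ)
    (hy : AEStronglyMeasurable y μ) (hx2 : Integrable (fun p => ‖x p‖ ^ 2) μ)
    (hy2 : Integrable (fun p => y p ^ 2) μ) {w : E}
    (hw : ∀ w', ∫ p, (y p - ⟪w, x p⟫) ^ 2 ∂μ ≤ ∫ p, (y p - ⟪w', x p⟫) ^ 2 ∂μ) (u : E) :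
    ∫ p, (y p - ⟪w, x p⟫) * ⟪u, x p⟫ ∂μ = 0 := by
  suffices h : -2 * ∫ p, (y p - ⟪w, x p⟫) * ⟪u, x p⟫ ∂μ = 0 by linarith
  -- Minimality is tested along the line w + t u.
  refine eq_zero_of_quadratic_nonneg (c := ∫ p, ⟪u, x p⟫ ^ 2 ∂μ) fun t => ?_
  have h1 := hw (w + t • u)
  rw [integral_residual_sq_add hx hy hx2 hy2] at h1
  have h2 : ∀ p, (y p - ⟪w, x p⟫) * ⟪t • u, x p⟫ = t * ((y p - ⟪w, x p⟫) * ⟪u, x p⟫) := fun p => by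
    rw [real_inner_smul_left]; ring
  have h3 : ∀ p, ⟪t • u, x p⟫ ^ 2 = t ^ 2 * ⟪u, x p⟫ ^ 2 := fun p => by
    rw [real_inner_smul_left]; ring
  simp only [h2, h3, integral_const_mul] at h1
  linarith

end LeastSquares

end QuantSGD

/-! ### Covariance operators, optima, excess risk and moment conditions -/

namespace QuantSGD

/-- The double series λ_i ⟨v_i, b_j⟩² has nonnegative terms: summed over j first it gives the
eigenvalues, over i first the diagonal entries in the basis b. This frees `opTrace` from the chosen
basis. -/
theorem IsEigenDecomp.opTrace_eq {E : Type*} [NormedAddCommGroup E] [InnerProductSpace ℝ E]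
    [CompleteSpace E] {T : E →L[ℝ] E} (hT : T.IsSymmetric) {lam : ℕ → ℝ} {v : ℕ → E}
    (h : IsEigenDecomp T lam v) (h0 : ∀ i, 0 ≤ lam i) {tr : ℝ} (htr : HasSum lam tr) :
    opTrace T = tr := by
  set b := (exists_hilbertBasis ℝ E).choose_spec.choose with hb
  have h1 : ∀ i, HasSum (fun j => lam i * ⟪v i, b j⟫ ^ 2) (lam i) := fun i => by
    have := (b.hasSum_inner_mul_inner (v i) (v i)).mul_left (lam i)
    have h2 : lam i * ⟪v i, v i⟫ = lam i := by
      rw [real_inner_self_eq_norm_sq]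
      rcases h.unit_or_zero i with h3 | ⟨_, h3⟩ <;> simp [h3]
    rw [h2] at this
    refine this.congr_fun fun j => ?_
    rw [real_inner_comm (v i) (b j), sq]
  have h2 : ∀ j, HasSum (fun i => lam i * ⟪v i, b j⟫ ^ 2) (normSq T (b j)) := fun j =>
    h.hasSum_normSq hT (b j)
  have hs : Summable (Function.uncurry fun i j => lam i * ⟪v i, b j⟫ ^ 2) := by
    refine (summable_prod_of_nonneg fun p => mul_nonneg (h0 _) (sq_nonneg _)).2
      ⟨fun i => (h1 i).summable, ?_⟩
    simpa only [Function.uncurry, (h1 _).tsum_eq] using htr.summable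
  have := hs.tsum_comm
  simp only [(h1 _).tsum_eq, (h2 _).tsum_eq, htr.tsum_eq] at this
  exact this

namespace Model

set_option linter.unusedSectionVars false

variable {E Sd Sl Sp Sa So : Type*} {B : ℕ} [NormedAddCommGroup E] [InnerProductSpace ℝ E]
  [CompleteSpace E] [SecondCountableTopology E] [MeasurableSpace E] [BorelSpace E]
  [MeasurableSpace Sd] [MeasurableSpace Sl] [MeasurableSpace Sp] [MeasurableSpace Sa]
  [MeasurableSpace So] {M : Model E Sd Sl Sp Sa So B}

theorem measurable_xq (M : Model E Sd Sl Sp Sa So B) : Measurable M.xq :=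
  M.Qd.measurable_toFun.comp (by fun_prop : Measurable fun p : Sample E Sd Sl => (p.1.1, p.2.1))

theorem measurable_yq (M : Model E Sd Sl Sp Sa So B) : Measurable M.yq :=
  M.Ql.measurable_toFun.comp (by fun_prop : Measurable fun p : Sample E Sd Sl => (p.1.2, p.2.2))

instance (M : Model E Sd Sl Sp Sa So B) : IsProbabilityMeasure M.sampleLaw := by
  unfold sampleLaw; infer_instance

/-! #### First and second moments of the samples -/

/-- Integrating out the feature seed first replaces x_q by x, provided that the other factor depends
on the raw sample only. -/
theorem integral_inner_xq_mul (hunb : M.UnbiasedQuantizers) (u : E) {f : E × ℝ → ℝ}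
    (hf : Integrable (fun p : Sample E Sd Sl => ⟪u, M.xq p⟫ * f p.1) M.sampleLaw) :
    ∫ p, ⟪u, M.xq p⟫ * f p.1 ∂M.sampleLaw = ∫ z, ⟪u, z.1⟫ * f z ∂M.law := by
  unfold sampleLaw at hf ⊢
  rw [integral_prod _ hf]
  refine integral_congr_ae (Filter.Eventually.of_forall fun z => ?_)
  have h := integral_prod_mul (μ := M.Qd.seedLaw) (ν := M.Ql.seedLaw)
    (fun s => ⟪u, M.Qd.toFun z.1 s⟫) (fun _ => f z)
  simp only [integral_const, probReal_univ, one_smul] at h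
  simp only [xq]
  rw [h, integral_inner (hunb.1 z.1).1 u, (hunb.1 z.1).2]

theorem integral_inner_xq_mul_yq (hunb : M.UnbiasedQuantizers) (u : E)
    (hf : Integrable (fun p => ⟪u, M.xq p⟫ * M.yq p) M.sampleLaw) :
    ∫ p, ⟪u, M.xq p⟫ * M.yq p ∂M.sampleLaw = ∫ z, ⟪u, z.1⟫ * z.2 ∂M.law := by
  unfold sampleLaw at hf ⊢
  rw [integral_prod _ hf]
  refine integral_congr_ae (Filter.Eventually.of_forall fun z => ?_)
  have h := integral_prod_mul (μ := M.Qd.seedLaw) (ν := M.Ql.seedLaw)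
    (fun s => ⟪u, M.Qd.toFun z.1 s⟫) (fun s => M.Ql.toFun z.2 s)
  simp only [xq, yq]
  rw [h, integral_inner (hunb.1 z.1).1 u, (hunb.1 z.1).2, (hunb.2.1 z.2).2]

theorem integrable_norm_sq_fst (hmom : M.FiniteMoments) :
    Integrable (fun p : Sample E Sd Sl => ‖p.1.1‖ ^ 2) M.sampleLaw :=
  hmom.1.comp_fst _

theorem integrable_inner_xq_sq (hmom : M.FiniteMoments) (u : E) :
    Integrable (fun p => ⟪u, M.xq p⟫ ^ 2) M.sampleLaw :=
  integrable_inner_sq M.measurable_xq.aestronglyMeasurable hmom.2.1 u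

theorem inner_Hq_apply (hmom : M.FiniteMoments) (u w : E) :
    ⟪u, M.Hq w⟫ = ∫ p, ⟪u, M.xq p⟫ * ⟪M.xq p, w⟫ ∂M.sampleLaw := by
  have hm := M.measurable_xq.aestronglyMeasurable (μ := M.sampleLaw)
  exact inner_integral_rankOne (integrable_rankOne hm hm hmom.2.1 hmom.2.1) u w

theorem inner_H_apply (hmom : M.FiniteMoments) (u w : E) :
    ⟪u, M.H w⟫ = ∫ z, ⟪u, z.1⟫ * ⟪z.1, w⟫ ∂M.law := by
  have hm : AEStronglyMeasurable (fun z : E × ℝ => z.1) M.law :=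
    measurable_fst.aestronglyMeasurable
  exact inner_integral_rankOne (integrable_rankOne hm hm hmom.1 hmom.1) u w

theorem integrable_err_sq (hmom : M.FiniteMoments) :
    Integrable (fun p => ‖M.xq p - p.1.1‖ ^ 2) M.sampleLaw := by
  have h := integrable_norm_sq_add (g := fun p : Sample E Sd Sl => -p.1.1)
    (M.measurable_xq.aestronglyMeasurable (μ := M.sampleLaw))
    (by fun_prop : Measurable fun p : Sample E Sd Sl => -p.1.1).aestronglyMeasurable hmom.2.1
    (by simpa only [norm_neg] using integrable_norm_sq_fst hmom)
  simpa only [← sub_eq_add_neg] using h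

theorem inner_D_apply (hmom : M.FiniteMoments) (u w : E) :
    ⟪u, M.D w⟫ = ∫ p, ⟪u, M.xq p - p.1.1⟫ * ⟪M.xq p - p.1.1, w⟫ ∂M.sampleLaw := by
  have hm : AEStronglyMeasurable (fun p : Sample E Sd Sl => M.xq p - p.1.1) M.sampleLaw :=
    (M.measurable_xq.sub (by fun_prop)).aestronglyMeasurable
  exact inner_integral_rankOne
    (integrable_rankOne hm hm (integrable_err_sq hmom) (integrable_err_sq hmom)) u w

theorem normSq_Hq (hmom : M.FiniteMoments) (u : E) :
    normSq M.Hq u = ∫ p, ⟪u, M.xq p⟫ ^ 2 ∂M.sampleLaw := by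
  rw [normSq, inner_Hq_apply hmom]
  simp only [real_inner_comm u, sq]

theorem normSq_H (hmom : M.FiniteMoments) (u : E) :
    normSq M.H u = ∫ z, ⟪u, z.1⟫ ^ 2 ∂M.law := by
  rw [normSq, inner_H_apply hmom]
  simp only [real_inner_comm u, sq]

theorem normSq_Hq_nonneg (hmom : M.FiniteMoments) (u : E) : 0 ≤ normSq M.Hq u := by
  rw [normSq_Hq hmom]
  exact integral_nonneg fun p => sq_nonneg _

theorem normSq_H_nonneg (hmom : M.FiniteMoments) (u : E) : 0 ≤ normSq M.H u := by
  rw [normSq_H hmom]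
  exact integral_nonneg fun p => sq_nonneg _

theorem normSq_D_nonneg (hmom : M.FiniteMoments) (u : E) : 0 ≤ normSq M.D u := by
  rw [normSq, inner_D_apply hmom]
  refine integral_nonneg fun p => ?_
  simp only [real_inner_comm u]
  exact mul_self_nonneg _

theorem isSymmetric_Hq (hmom : M.FiniteMoments) : M.Hq.IsSymmetric := fun u w => by
  simp only [ContinuousLinearMap.coe_coe]
  rw [real_inner_comm, inner_Hq_apply hmom, inner_Hq_apply hmom]
  refine integral_congr_ae (Filter.Eventually.of_forall fun p => ?_)
  simp only [real_inner_comm, mul_comm]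

theorem isSymmetric_H (hmom : M.FiniteMoments) : M.H.IsSymmetric := fun u w => by
  simp only [ContinuousLinearMap.coe_coe]
  rw [real_inner_comm, inner_H_apply hmom, inner_H_apply hmom]
  refine integral_congr_ae (Filter.Eventually.of_forall fun p => ?_)
  simp only [real_inner_comm, mul_comm]

/-- The covariance of the quantized features is the sum of the covariance of the features and of
the covariance of the quantization error. -/
theorem H_add_D (hunb : M.UnbiasedQuantizers) (hmom : M.FiniteMoments) :
    M.H + M.D = M.Hq := by
  have hmq := M.measurable_xq
  have hm : Measurable fun p : Sample E Sd Sl => p.1.1 := by fun_prop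
  have hx := integrable_norm_sq_fst hmom
  ext w
  refine ext_inner_left ℝ fun u => ?_
  rw [add_apply, inner_add_right, inner_D_apply hmom, inner_Hq_apply hmom,
    inner_H_apply hmom]
  have i1 : ∀ a b : E, Integrable (fun p => ⟪a, M.xq p⟫ * ⟪b, M.xq p⟫) M.sampleLaw := fun a b =>
    integrable_mul_of_sq hmq.const_inner.aestronglyMeasurable hmq.const_inner.aestronglyMeasurable
      (integrable_inner_xq_sq hmom a) (integrable_inner_xq_sq hmom b)
  have i2 : ∀ a b : E, Integrable (fun p => ⟪a, M.xq p⟫ * ⟪b, p.1.1⟫) M.sampleLaw := fun a b =>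
    integrable_mul_of_sq hmq.const_inner.aestronglyMeasurable hm.const_inner.aestronglyMeasurable
      (integrable_inner_xq_sq hmom a) (integrable_inner_sq hm.aestronglyMeasurable hx b)
  have i3 : ∀ a b : E, Integrable (fun p : Sample E Sd Sl => ⟪a, p.1.1⟫ * ⟪b, p.1.1⟫)
      M.sampleLaw := fun a b =>
    integrable_mul_of_sq hm.const_inner.aestronglyMeasurable hm.const_inner.aestronglyMeasurable
      (integrable_inner_sq hm.aestronglyMeasurable hx a)
      (integrable_inner_sq hm.aestronglyMeasurable hx b)
  -- Unbiasedness removes a single quantized factor, so both cross moments reduce to H and the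
  -- expansion collapses to Hq - H.
  have e2 : ∀ a b : E, ∫ p, ⟪a, M.xq p⟫ * ⟪b, p.1.1⟫ ∂M.sampleLaw =
      ∫ z, ⟪a, z.1⟫ * ⟪b, z.1⟫ ∂M.law := fun a b =>
    integral_inner_xq_mul hunb a (f := fun z => ⟪b, z.1⟫) (i2 a b)
  have e3 : ∀ a b : E, ∫ p : Sample E Sd Sl, ⟪a, p.1.1⟫ * ⟪b, p.1.1⟫ ∂M.sampleLaw =
      ∫ z, ⟪a, z.1⟫ * ⟪b, z.1⟫ ∂M.law := fun a b => by
    have := integral_fun_fst (μ := M.law) (ν := M.Qd.seedLaw.prod M.Ql.seedLaw)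
      (fun z => ⟪a, z.1⟫ * ⟪b, z.1⟫)
    simp only [probReal_univ, one_smul] at this
    exact this
  have hexp : ∀ p : Sample E Sd Sl, ⟪u, M.xq p - p.1.1⟫ * ⟪M.xq p - p.1.1, w⟫ =
      ⟪u, M.xq p⟫ * ⟪w, M.xq p⟫ - ⟪u, M.xq p⟫ * ⟪w, p.1.1⟫ -
        (⟪w, M.xq p⟫ * ⟪u, p.1.1⟫ - ⟪u, p.1.1⟫ * ⟪w, p.1.1⟫) := fun p => by
    simp only [inner_sub_right, real_inner_comm w]
    ring
  simp only [hexp]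
  rw [integral_sub (f := fun p => ⟪u, M.xq p⟫ * ⟪w, M.xq p⟫ - ⟪u, M.xq p⟫ * ⟪w, p.1.1⟫)
    (g := fun p => ⟪w, M.xq p⟫ * ⟪u, p.1.1⟫ - ⟪u, p.1.1⟫ * ⟪w, p.1.1⟫)
    ((i1 u w).sub (i2 u w)) ((i2 w u).sub (i3 u w)), integral_sub (i1 u w) (i2 u w),
    integral_sub (i2 w u) (i3 u w), e2, e2, e3]
  simp only [real_inner_comm w]
  have : ∀ z : E × ℝ, ⟪w, z.1⟫ * ⟪u, z.1⟫ = ⟪u, z.1⟫ * ⟪w, z.1⟫ := fun z => mul_comm _ _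
  simp only [this]
  ring

/-! #### Optima and excess risk -/

theorem integral_residual_wq (hmom : M.FiniteMoments) {wq : E}
    (hwq : IsMinOn M.quantRisk Set.univ wq) (u : E) :
    ∫ p, (M.yq p - ⟪wq, M.xq p⟫) * ⟪u, M.xq p⟫ ∂M.sampleLaw = 0 :=
  integral_residual_mul_inner_eq_zero M.measurable_xq.aestronglyMeasurable
    M.measurable_yq.aestronglyMeasurable hmom.2.1 hmom.2.2.2
    (fun w' => isMinOn_iff.1 hwq w' (Set.mem_univ _)) u

theorem integral_residual_wstar (hmom : M.FiniteMoments) {wstar : E}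
    (hwstar : IsMinOn M.risk Set.univ wstar) (u : E) :
    ∫ z, (z.2 - ⟪wstar, z.1⟫) * ⟪u, z.1⟫ ∂M.law = 0 :=
  integral_residual_mul_inner_eq_zero measurable_fst.aestronglyMeasurable
    measurable_snd.aestronglyMeasurable hmom.1 hmom.2.2.1
    (fun w' => by
      have h := isMinOn_iff.1 hwstar w' (Set.mem_univ _)
      simp only [risk] at h
      linarith) u

/-- Both sides equal E[y x]: the feature and label seeds are independent, so E[y_q x_q] = E[y x],
and the two normal equations finish. -/
theorem Hq_wq_eq (hunb : M.UnbiasedQuantizers) (hmom : M.FiniteMoments) {wstar wq : E}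
    (hwstar : IsMinOn M.risk Set.univ wstar) (hwq : IsMinOn M.quantRisk Set.univ wq) :
    M.Hq wq = M.H wstar := by
  have hmq := M.measurable_xq
  have hmy := M.measurable_yq
  refine ext_inner_left ℝ fun u => ?_
  have i1 : Integrable (fun p => ⟪u, M.xq p⟫ * M.yq p) M.sampleLaw :=
    integrable_mul_of_sq hmq.const_inner.aestronglyMeasurable hmy.aestronglyMeasurable
      (integrable_inner_xq_sq hmom u) hmom.2.2.2
  have i2 : Integrable (fun p => ⟪u, M.xq p⟫ * ⟪wq, M.xq p⟫) M.sampleLaw :=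
    integrable_mul_of_sq hmq.const_inner.aestronglyMeasurable hmq.const_inner.aestronglyMeasurable
      (integrable_inner_xq_sq hmom u) (integrable_inner_xq_sq hmom wq)
  have hm : AEStronglyMeasurable (fun z : E × ℝ => z.1) M.law :=
    measurable_fst.aestronglyMeasurable
  have i3 : Integrable (fun z : E × ℝ => ⟪u, z.1⟫ * z.2) M.law :=
    integrable_mul_of_sq hm.const_inner measurable_snd.aestronglyMeasurable
      (integrable_inner_sq hm hmom.1 u) hmom.2.2.1
  have i4 : Integrable (fun z : E × ℝ => ⟪u, z.1⟫ * ⟪wstar, z.1⟫) M.law :=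
    integrable_mul_of_sq hm.const_inner hm.const_inner
      (integrable_inner_sq hm hmom.1 u) (integrable_inner_sq hm hmom.1 wstar)
  have h1 := integral_residual_wq hmom hwq u
  have h2 := integral_residual_wstar hmom hwstar u
  have e1 : ∀ p, (M.yq p - ⟪wq, M.xq p⟫) * ⟪u, M.xq p⟫ =
      ⟪u, M.xq p⟫ * M.yq p - ⟪u, M.xq p⟫ * ⟪wq, M.xq p⟫ := fun p => by ring
  have e2 : ∀ z : E × ℝ, (z.2 - ⟪wstar, z.1⟫) * ⟪u, z.1⟫ =
      ⟪u, z.1⟫ * z.2 - ⟪u, z.1⟫ * ⟪wstar, z.1⟫ := fun p => by ring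
  simp only [e1] at h1
  simp only [e2] at h2
  rw [integral_sub i1 i2, integral_inner_xq_mul_yq hunb u i1] at h1
  rw [integral_sub i3 i4] at h2
  rw [inner_Hq_apply hmom, inner_H_apply hmom]
  simp only [real_inner_comm wq, real_inner_comm wstar] at h1 h2 ⊢
  linarith

theorem risk_sub_risk (hmom : M.FiniteMoments) {wstar : E}
    (hwstar : IsMinOn M.risk Set.univ wstar) (w : E) :
    M.risk w - M.risk wstar = 1 / 2 * normSq M.H (w - wstar) := by
  have h := integral_residual_sq_add (μ := M.law) measurable_fst.aestronglyMeasurable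
    measurable_snd.aestronglyMeasurable hmom.1 hmom.2.2.1 wstar (w - wstar)
  rw [integral_residual_wstar hmom hwstar, add_sub_cancel] at h
  rw [risk, risk, h, normSq_H hmom]
  ring

/-- Hq dominates H because D ≥ 0. Injectivity is what gives `opInv` its meaning on the range of Hq.
-/
theorem Hq_injective (hunb : M.UnbiasedQuantizers) (hmom : M.FiniteMoments)
    (hpos : ∀ u : E, u ≠ 0 → 0 < normSq M.H u) : Function.Injective M.Hq := by
  rw [injective_iff_map_eq_zero]
  intro u hu
  by_contra hne
  have h1 := hpos u hne
  have h2 : normSq M.Hq u = normSq M.H u + normSq M.D u := by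
    rw [← H_add_D hunb hmom, normSq, add_apply, inner_add_right, normSq,
      normSq]
  have h3 := normSq_D_nonneg hmom u
  rw [normSq, hu, inner_zero_right] at h2
  linarith

/-- The excess risk is controlled by the distance to the optimum on quantized data. -/
theorem risk_sub_risk_le (hunb : M.UnbiasedQuantizers) (hmom : M.FiniteMoments)
    (hpos : ∀ u : E, u ≠ 0 → 0 < normSq M.H u) {wstar wq : E}
    (hwstar : IsMinOn M.risk Set.univ wstar) (hwq : IsMinOn M.quantRisk Set.univ wq) (w : E) :
    M.risk w - M.risk wstar ≤ 1 / 2 * normSq M.Hq (w - wq) +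
      1 / 2 * d1NormSq M.H M.D wstar + 1 / 2 * d2NormSq M.H M.D wstar := by
  have hsum := H_add_D hunb hmom
  have hinj := Hq_injective hunb hmom hpos
  have hopt := Hq_wq_eq hunb hmom hwstar hwq
  have hD : ∀ u, M.D u = M.Hq u - M.H u := fun u => by
    rw [← hsum, add_apply, add_sub_cancel_left]
  have e1 : opInv (M.H + M.D) (M.H wstar) = wq := by
    rw [hsum, ← hopt]
    exact Function.leftInverse_invFun hinj wq
  -- D wstar = Hq wstar - H wstar = Hq (wstar - wq) by the relation between the optima.
  have e2 : opInv (M.H + M.D) (M.D wstar) = wstar - wq := by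
    rw [hsum, hD, ← hopt, ← map_sub]
    exact Function.leftInverse_invFun hinj _
  rw [risk_sub_risk hmom hwstar, d1NormSq, d2NormSq, e1, e2]
  have hHsym := isSymmetric_H hmom
  have hDsym : M.D.IsSymmetric := fun a b => by
    have h1 := isSymmetric_Hq hmom a b
    have h2 := hHsym a b
    simp only [ContinuousLinearMap.coe_coe] at h1 h2 ⊢
    rw [hD, hD, inner_sub_left, inner_sub_right, h1, h2]
  have h1 := normSq_add hHsym (w - wq) (wq - wstar)
  -- The only inequality of this proof: -2⟨D(w - wq), wq⟩ ≤ ‖w - wq‖²_D + ‖wq‖²_D. The sum is left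
  -- unsimplified so that `normSq_add` expands it.
  have h2 := normSq_D_nonneg hmom (w - wq + wq)
  rw [normSq_add hDsym] at h2
  have h3 : M.H (wq - wstar) = - M.D wq := by rw [map_sub, hD, ← hopt]; abel
  have h4 : ⟪M.H (w - wq), wq - wstar⟫ = -⟪M.D (w - wq), wq⟫ := by
    have ha := hHsym (w - wq) (wq - wstar)
    have hb := hDsym (w - wq) wq
    simp only [ContinuousLinearMap.coe_coe] at ha hb
    rw [ha, hb, h3, inner_neg_right]
  have h5 : normSq M.Hq (w - wq) = normSq M.H (w - wq) + normSq M.D (w - wq) := by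
    rw [← hsum, normSq, add_apply, inner_add_right, normSq, normSq]
  have h6 : normSq M.H (wstar - wq) = normSq M.H (wq - wstar) := by
    rw [← neg_sub wq wstar, normSq, normSq, map_neg, inner_neg_neg]
  rw [sub_add_sub_cancel] at h1
  rw [h4] at h1
  rw [h1, h5, h6]
  linarith

/-! #### Fourth moments and noise -/

/-- The operator condition is tested on A = a aᵀ, for which tr(Hq A) = ‖a‖²_Hq. -/
theorem fourthMoment_rankOne {α : ℝ} (hfourth : M.FourthMoment α) (u a : E) :
    Integrable (fun p => ⟪u, M.xq p⟫ ^ 2 * ⟪a, M.xq p⟫ ^ 2) M.sampleLaw ∧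
      ∫ p, ⟪u, M.xq p⟫ ^ 2 * ⟪a, M.xq p⟫ ^ 2 ∂M.sampleLaw ≤
        α * normSq M.Hq a * normSq M.Hq u := by
  obtain ⟨hi, hle⟩ := hfourth (rankOne ℝ a a) (isPositive_rankOne_self a)
  have e : ∀ p, ⟪u, (rankOne ℝ (M.xq p) (M.xq p) ∘L rankOne ℝ a a ∘L
      rankOne ℝ (M.xq p) (M.xq p)) u⟫ = ⟪u, M.xq p⟫ ^ 2 * ⟪a, M.xq p⟫ ^ 2 := fun p => by
    simp only [ContinuousLinearMap.comp_apply, rankOne_apply, real_inner_smul_right,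
      real_inner_comm u, real_inner_comm a]
    ring
  have hi' := Integrable.const_inner (𝕜 := ℝ) u (hi.apply_continuousLinearMap u)
  have hint := integral_inner (𝕜 := ℝ) (hi.apply_continuousLinearMap u) u
  rw [← ContinuousLinearMap.integral_apply hi] at hint
  simp only [e] at hi' hint
  refine ⟨hi', ?_⟩
  rw [opTrace_comp_rankOne] at hle
  have h := (ContinuousLinearMap.le_def _ _).1 hle |>.inner_nonneg_right u
  rw [sub_apply, inner_sub_right, ← hint, smul_apply,
    real_inner_smul_right] at h
  simp only [normSq] at h ⊢
  linarith

theorem noiseBound_inner {wq : E} {σ : ℝ} (hnoise : M.NoiseBound wq σ) (u : E) :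
    Integrable (fun p => (M.yq p - ⟪wq, M.xq p⟫) ^ 2 * ⟪u, M.xq p⟫ ^ 2) M.sampleLaw ∧
      ∫ p, (M.yq p - ⟪wq, M.xq p⟫) ^ 2 * ⟪u, M.xq p⟫ ^ 2 ∂M.sampleLaw ≤
        σ ^ 2 * normSq M.Hq u := by
  obtain ⟨hi, hle⟩ := hnoise
  have e : ∀ p, ⟪u, ((M.yq p - ⟪wq, M.xq p⟫) ^ 2 • rankOne ℝ (M.xq p) (M.xq p)) u⟫ =
      (M.yq p - ⟪wq, M.xq p⟫) ^ 2 * ⟪u, M.xq p⟫ ^ 2 := fun p => by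
    simp only [smul_apply, rankOne_apply, real_inner_smul_right,
      real_inner_comm u]
    ring
  have hi' := Integrable.const_inner (𝕜 := ℝ) u (hi.apply_continuousLinearMap u)
  have hint := integral_inner (𝕜 := ℝ) (hi.apply_continuousLinearMap u) u
  rw [← ContinuousLinearMap.integral_apply hi] at hint
  simp only [e] at hi' hint
  refine ⟨hi', ?_⟩
  have h := (ContinuousLinearMap.le_def _ _).1 hle |>.inner_nonneg_right u
  rw [sub_apply, inner_sub_right, ← hint, smul_apply,
    real_inner_smul_right] at h
  simp only [normSq] at h ⊢
  linarith

/-- Parseval for x_q, integrated term by term. It identifies tr Hq with E‖x_q‖² and makes the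
eigenvalues summable. -/
theorem hasSum_eigenvalues (hmom : M.FiniteMoments) {lam : ℕ → ℝ} {v : ℕ → E}
    (heig : IsEigenDecomp M.Hq lam v) : HasSum lam (∫ p, ‖M.xq p‖ ^ 2 ∂M.sampleLaw) := by
  have h := hasSum_integral_of_nonneg (fun i => integrable_inner_xq_sq hmom (v i))
    (fun i p => sq_nonneg _) hmom.2.1 fun p => heig.hasSum_inner_sq (M.xq p)
  refine h.congr_fun fun i => ?_
  rw [← normSq_Hq hmom, normSq, heig.inner_self]

theorem eigenvalue_nonneg (hmom : M.FiniteMoments) {lam : ℕ → ℝ} {v : ℕ → E}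
    (heig : IsEigenDecomp M.Hq lam v) (i : ℕ) : 0 ≤ lam i := by
  rw [← heig.inner_self]
  exact normSq_Hq_nonneg hmom _

/-- The constant of the fourth moment condition is at least one. -/
theorem one_le_of_fourthMoment (hmom : M.FiniteMoments) {α : ℝ} (hfourth : M.FourthMoment α)
    {u : E} (hu : 0 < normSq M.Hq u) : 1 ≤ α := by
  obtain ⟨hi, hle⟩ := fourthMoment_rankOne hfourth u u
  -- Nonnegative variance of ⟨u, x_q⟩²: the squared mean is at most the fourth moment, itself at
  -- most α times the squared mean.
  have h1 : 0 ≤ ∫ p, (⟪u, M.xq p⟫ ^ 2 - normSq M.Hq u) ^ 2 ∂M.sampleLaw :=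
    integral_nonneg fun p => sq_nonneg _
  have e : ∀ p, (⟪u, M.xq p⟫ ^ 2 - normSq M.Hq u) ^ 2 = ⟪u, M.xq p⟫ ^ 2 * ⟪u, M.xq p⟫ ^ 2 -
      2 * normSq M.Hq u * ⟪u, M.xq p⟫ ^ 2 + normSq M.Hq u ^ 2 := fun p => by ring
  have i2 := (integrable_inner_xq_sq hmom u).const_mul (2 * normSq M.Hq u)
  simp only [e] at h1
  rw [integral_add (f := fun p => ⟪u, M.xq p⟫ ^ 2 * ⟪u, M.xq p⟫ ^ 2 -
      2 * normSq M.Hq u * ⟪u, M.xq p⟫ ^ 2) (hi.sub i2) (integrable_const _),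
    integral_sub hi i2, integral_const_mul, ← normSq_Hq hmom, integral_const, probReal_univ,
    one_smul] at h1
  have h2 : normSq M.Hq u ^ 2 * 1 ≤ normSq M.Hq u ^ 2 * α := by linarith
  exact le_of_mul_le_mul_left h2 (by positivity)

end Model
end QuantSGD

/-! ### Conditional moments of the quantizers and i.i.d. sums -/

namespace QuantSGD

/-! ### Conditional moments of quantization errors -/

namespace Quantizer

set_option linter.unusedSectionVars false

variable {V S S' : Type*} [NormedAddCommGroup V] [InnerProductSpace ℝ V] [CompleteSpace V]
  [SecondCountableTopology V] [MeasurableSpace V] [BorelSpace V] [MeasurableSpace S]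
  [MeasurableSpace S'] {Q : Quantizer V S}

theorem measurable_toFun_left (Q : Quantizer V S) (u : V) : Measurable (Q.toFun u) :=
  Q.measurable_toFun.comp (measurable_const.prodMk measurable_id)

theorem measurable_sub (Q : Quantizer V S) (u : V) : Measurable fun s => Q.toFun u s - u :=
  (Q.measurable_toFun_left u).sub_const u

theorem integrable_inner_err_sq (hQ : Q.FiniteErrorMoment) (u c : V) :
    Integrable (fun s => ⟪c, Q.toFun u s - u⟫ ^ 2) Q.seedLaw :=
  integrable_inner_sq (Q.measurable_sub u).aestronglyMeasurable (hQ u) c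

theorem inner_errCov (hQ : Q.FiniteErrorMoment) (u c : V) :
    ⟪c, Q.errCov u c⟫ = ∫ s, ⟪c, Q.toFun u s - u⟫ ^ 2 ∂Q.seedLaw := by
  have hm := (Q.measurable_sub u).aestronglyMeasurable (μ := Q.seedLaw)
  rw [errCov, inner_integral_rankOne (integrable_rankOne hm hm (hQ u) (hQ u))]
  simp only [real_inner_comm c, sq]

theorem inner_errCov_nonneg (hQ : Q.FiniteErrorMoment) (u c : V) : 0 ≤ ⟪c, Q.errCov u c⟫ := by
  rw [inner_errCov hQ]
  exact integral_nonneg fun s => sq_nonneg _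

theorem integral_inner_err (hQ : Q.Unbiased) (u c : V) :
    ∫ s, ⟪c, Q.toFun u s - u⟫ ∂Q.seedLaw = 0 := by
  have h : Integrable (fun s => Q.toFun u s - u) Q.seedLaw := (hQ u).1.sub (integrable_const u)
  rw [integral_inner (𝕜 := ℝ) h, integral_sub (hQ u).1 (integrable_const u), (hQ u).2]
  simp

/-- Bias-variance decomposition of the second moment of a quantized quantity. -/
theorem integral_add_inner_sq (hQ : Q.Unbiased) (hQ2 : Q.FiniteErrorMoment) (u c : V) (r : ℝ) :
    Integrable (fun s => (r + ⟪c, Q.toFun u s⟫) ^ 2) Q.seedLaw ∧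
      ∫ s, (r + ⟪c, Q.toFun u s⟫) ^ 2 ∂Q.seedLaw = (r + ⟪c, u⟫) ^ 2 + ⟪c, Q.errCov u c⟫ := by
  have e : ∀ s, (r + ⟪c, Q.toFun u s⟫) ^ 2 = (r + ⟪c, u⟫) ^ 2 +
      2 * (r + ⟪c, u⟫) * ⟪c, Q.toFun u s - u⟫ + ⟪c, Q.toFun u s - u⟫ ^ 2 := fun s => by
    rw [inner_sub_right]; ring
  have i1 : Integrable (fun s => 2 * (r + ⟪c, u⟫) * ⟪c, Q.toFun u s - u⟫) Q.seedLaw :=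
    (Integrable.const_inner (𝕜 := ℝ) c ((hQ u).1.sub (integrable_const u))).const_mul _
  have i2 := integrable_inner_err_sq hQ2 u c
  have i3 : Integrable (fun s => (r + ⟪c, u⟫) ^ 2 +
      2 * (r + ⟪c, u⟫) * ⟪c, Q.toFun u s - u⟫) Q.seedLaw := (integrable_const _).add i1
  simp only [e]
  refine ⟨i3.add i2, ?_⟩
  rw [integral_add i3 i2, integral_add (integrable_const _) i1, integral_const_mul,
    integral_inner_err hQ, inner_errCov hQ2, integral_const, probReal_univ, one_smul]
  ring

/-- Second moment of a linear functional of `Q_o(y - Q_a(a))`. -/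
theorem lintegral_inner_sq_le {Qa : Quantizer V S} {Qo : Quantizer V S'} (ha : Qa.Unbiased)
    (ho : Qo.Unbiased) (ha2 : Qa.FiniteErrorMoment) (ho2 : Qo.FiniteErrorMoment) (c y a : V)
    {K : ℝ} (hK : ∀ᵐ s ∂Qa.seedLaw, ‖Qo.errCov (y - Qa.toFun a s) + Qa.errCov a‖ ≤ K) :
    ∫⁻ s, ∫⁻ s', ENNReal.ofReal (⟪c, Qo.toFun (y - Qa.toFun a s) s'⟫ ^ 2) ∂Qo.seedLaw ∂Qa.seedLaw
      ≤ ENNReal.ofReal (⟪c, y - a⟫ ^ 2 + K * ‖c‖ ^ 2) := by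
  have h1 : ∀ b, ∫⁻ s', ENNReal.ofReal (⟪c, Qo.toFun b s'⟫ ^ 2) ∂Qo.seedLaw =
      ENNReal.ofReal (⟪c, b⟫ ^ 2 + ⟪c, Qo.errCov b c⟫) := fun b => by
    obtain ⟨hi, he⟩ := integral_add_inner_sq ho ho2 b c 0
    simp only [zero_add] at hi he
    rw [lintegral_ofReal_eq hi fun s => sq_nonneg _, he]
  simp only [h1]
  -- `K` bounds the norm of the sum of the two covariances. The activation covariance is moved to
  -- the right, where it cancels the variance that `Qa` itself adds; no second copy of `K` is spent.
  have hK' : ∀ᵐ s ∂Qa.seedLaw, ⟪c, Qo.errCov (y - Qa.toFun a s) c⟫ ≤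
      K * ‖c‖ ^ 2 - ⟪c, Qa.errCov a c⟫ := by
    filter_upwards [hK] with s hs
    have h2 := (normSq_le_norm (Qo.errCov (y - Qa.toFun a s) + Qa.errCov a) c).trans
      (mul_le_mul_of_nonneg_right hs (sq_nonneg _))
    rw [normSq, add_apply, inner_add_right] at h2
    linarith
  -- One admissible seed suffices to see that the constant K‖c‖² - ⟨c, errCov c⟩ is nonnegative.
  obtain ⟨s0, hs0⟩ := hK'.exists
  have hc := (inner_errCov_nonneg ho2 _ c).trans hs0
  obtain ⟨hi, he⟩ := integral_add_inner_sq ha ha2 a (-c) ⟪c, y⟫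
  have e1 : ∀ b, ⟪c, y⟫ + ⟪-c, b⟫ = ⟪c, y - b⟫ := fun b => by
    rw [inner_neg_left, inner_sub_right]; ring
  simp only [e1, map_neg, inner_neg_neg] at hi he
  calc ∫⁻ s, ENNReal.ofReal (⟪c, y - Qa.toFun a s⟫ ^ 2 + ⟪c, Qo.errCov (y - Qa.toFun a s) c⟫)
        ∂Qa.seedLaw
      ≤ ∫⁻ s, ENNReal.ofReal (⟪c, y - Qa.toFun a s⟫ ^ 2 + (K * ‖c‖ ^ 2 - ⟪c, Qa.errCov a c⟫))
        ∂Qa.seedLaw := by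
        refine lintegral_mono_ae ?_
        filter_upwards [hK'] with s hs
        exact ENNReal.ofReal_le_ofReal (by linarith)
    _ = ENNReal.ofReal (⟪c, y - a⟫ ^ 2 + K * ‖c‖ ^ 2) := by
        rw [lintegral_ofReal_eq (f := fun s => ⟪c, y - Qa.toFun a s⟫ ^ 2 +
          (K * ‖c‖ ^ 2 - ⟪c, Qa.errCov a c⟫)) (hi.add (integrable_const _))
          fun s => add_nonneg (sq_nonneg _) hc, integral_add hi (integrable_const _), he,
          integral_const, probReal_univ, one_smul]
        congr 1
        ring

/-- The conditional mean of a linear functional of `Q_o(y - Q_a(a))`. -/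
theorem integral_inner_eq {Qa : Quantizer V S} {Qo : Quantizer V S'} (ha : Qa.Unbiased)
    (ho : Qo.Unbiased) (c y a : V) :
    ∫ s, ∫ s', ⟪c, Qo.toFun (y - Qa.toFun a s) s'⟫ ∂Qo.seedLaw ∂Qa.seedLaw = ⟪c, y - a⟫ := by
  have h1 : ∀ b, ∫ s', ⟪c, Qo.toFun b s'⟫ ∂Qo.seedLaw = ⟪c, b⟫ := fun b => by
    rw [integral_inner (𝕜 := ℝ) (ho b).1, (ho b).2]
  simp only [h1]
  have h : Integrable (fun s => y - Qa.toFun a s) Qa.seedLaw := (integrable_const y).sub (ha a).1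
  rw [integral_inner (𝕜 := ℝ) h, integral_sub (integrable_const y) (ha a).1, (ha a).2]
  simp

theorem stronglyMeasurable_errCov (Q : Quantizer V S) : StronglyMeasurable Q.errCov := by
  unfold errCov
  refine StronglyMeasurable.integral_prod_right
    (f := fun u s => rankOne ℝ (Q.toFun u s - u) (Q.toFun u s - u)) ?_
  have hm : StronglyMeasurable fun p : V × S => Q.toFun p.1 p.2 - p.1 :=
    (Q.measurable_toFun.sub measurable_fst).stronglyMeasurable
  have h := Continuous.comp_stronglyMeasurable (continuous_rankOne (E := V)) (hm.prodMk hm)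
  exact h

end Quantizer

/-! ### Sums over i.i.d. samples -/

section IID

variable {X : Type*} [MeasurableSpace X] {μ : Measure X} [IsProbabilityMeasure μ] {B : ℕ}

theorem integrable_eval {f : X → ℝ} (hf : Integrable f μ) (i : Fin B) :
    Integrable (fun z : Fin B → X => f (z i)) (Measure.pi fun _ => μ) :=
  (measurePreserving_eval (fun _ : Fin B => μ) i).integrable_comp_of_integrable hf

theorem integral_eval {f : X → ℝ} (hf : AEStronglyMeasurable f μ) (i : Fin B) :
    ∫ z : Fin B → X, f (z i) ∂(Measure.pi fun _ => μ) = ∫ x, f x ∂μ := by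
  have h := measurePreserving_eval (fun _ : Fin B => μ) i
  have h2 := integral_map (f := f) h.measurable.aemeasurable (by rw [h.map_eq]; exact hf)
  rw [h.map_eq] at h2
  exact h2.symm

theorem integrable_sum_eval {f : X → ℝ} (hf : Integrable f μ) :
    Integrable (fun z : Fin B → X => ∑ i, f (z i)) (Measure.pi fun _ => μ) :=
  integrable_finsetSum _ fun i _ => integrable_eval hf i

theorem integral_sum_eval {f : X → ℝ} (hf : Integrable f μ) :
    ∫ z : Fin B → X, ∑ i, f (z i) ∂(Measure.pi fun _ => μ) = B * ∫ x, f x ∂μ := by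
  rw [integral_finsetSum _ fun i _ => integrable_eval hf i]
  simp [integral_eval hf.1]

/-- Variances of independent terms add; the B² - B off-diagonal pairs contribute the squared mean.
-/
theorem integral_sum_eval_sq {f : X → ℝ} (hf : AEStronglyMeasurable f μ)
    (hf2 : Integrable (fun x => f x ^ 2) μ) :
    Integrable (fun z : Fin B → X => (∑ i, f (z i)) ^ 2) (Measure.pi fun _ => μ) ∧
    ∫ z : Fin B → X, (∑ i, f (z i)) ^ 2 ∂(Measure.pi fun _ => μ) =
      B * ∫ x, f x ^ 2 ∂μ + (B ^ 2 - B) * (∫ x, f x ∂μ) ^ 2 := by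
  set P := Measure.pi fun _ : Fin B => μ with hP
  have hL : MemLp f 2 μ := (memLp_two_iff_integrable_sq hf).2 hf2
  have hLi : ∀ i : Fin B, MemLp (fun z : Fin B → X => f (z i)) 2 P := fun i =>
    hL.comp_measurePreserving (measurePreserving_eval (fun _ : Fin B => μ) i)
  have hind : iIndepFun (fun (i : Fin B) (z : Fin B → X) => f (z i)) P :=
    iIndepFun_pi fun _ => hf.aemeasurable
  have hLs : MemLp (fun z : Fin B → X => ∑ i, f (z i)) 2 P := memLp_finsetSum _ fun i _ => hLi i
  refine ⟨hLs.integrable_sq, ?_⟩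
  have hvar := IndepFun.variance_sum (s := Finset.univ) (fun i _ => hLi i)
    (fun i _ j _ hij => hind.indepFun hij)
  have hsum : (∑ i : Fin B, fun z : Fin B → X => f (z i)) = fun z => ∑ i, f (z i) := by
    ext z; simp
  rw [hsum, variance_eq_sub hLs] at hvar
  have hvi : ∀ i : Fin B, Var[fun z : Fin B → X => f (z i); P] =
      ∫ x, f x ^ 2 ∂μ - (∫ x, f x ∂μ) ^ 2 := fun i => by
    rw [variance_eq_sub (hLi i)]
    simp only [Pi.pow_apply]
    rw [integral_eval hf, integral_eval (f := fun x => f x ^ 2) hf2.1]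
  simp only [hvi, Pi.pow_apply, Finset.sum_const, Finset.card_univ, Fintype.card_fin,
    nsmul_eq_mul] at hvar
  rw [hP, integral_sum_eval (hL.integrable one_le_two)] at hvar
  linarith

end IID

end QuantSGD

/-! ### Second moment of the gradient over the batch, the parameter quantizer and the history -/

namespace QuantSGD

namespace Model

set_option linter.unusedSectionVars false

variable {E Sd Sl Sp Sa So : Type*} {B : ℕ} [NormedAddCommGroup E] [InnerProductSpace ℝ E]
  [CompleteSpace E] [SecondCountableTopology E] [MeasurableSpace E] [BorelSpace E]
  [MeasurableSpace Sd] [MeasurableSpace Sl] [MeasurableSpace Sp] [MeasurableSpace Sa]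
  [MeasurableSpace So] {M : Model E Sd Sl Sp Sa So B}

/-! #### Second moment of the stochastic gradient over the samples of a batch -/

/-- The vector `ℓ` with `⟨ℓ, a⟩ = E[⟨u, x_q⟩² ξ ⟨a, x_q⟩]`, where `ξ` is the residual at `wq`. -/
noncomputable def crossMoment (M : Model E Sd Sl Sp Sa So B) (wq u : E) : E :=
  ∫ p, (⟪u, M.xq p⟫ ^ 2 * (M.yq p - ⟪wq, M.xq p⟫)) • M.xq p ∂M.sampleLaw

theorem measurable_residual (M : Model E Sd Sl Sp Sa So B) (w : E) :
    Measurable fun p => M.yq p - ⟪w, M.xq p⟫ :=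
  M.measurable_yq.sub M.measurable_xq.const_inner

/-- The integrability half of the fourth moment condition with A = 1. -/
theorem integrable_inner_sq_mul_norm_sq {α : ℝ} (hfourth : M.FourthMoment α) (u : E) :
    Integrable (fun p => ⟪u, M.xq p⟫ ^ 2 * ‖M.xq p‖ ^ 2) M.sampleLaw := by
  have hi := (hfourth 1 ContinuousLinearMap.isPositive_one).1
  refine (Integrable.const_inner (𝕜 := ℝ) u (hi.apply_continuousLinearMap u)).congr
    (Filter.Eventually.of_forall fun p => ?_)
  simp only [ContinuousLinearMap.comp_apply, one_apply_eq_self, rankOne_apply,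
    real_inner_smul_right, real_inner_comm u, real_inner_self_eq_norm_sq]
  ring

/-- Cauchy-Schwarz for ξ⟨u, x_q⟩ and ⟨u, x_q⟩‖x_q‖: the noise condition makes the first square
integrable, the fourth moment condition the second. -/
theorem integrable_crossMoment {α σ : ℝ} (hfourth : M.FourthMoment α) {wq : E}
    (hnoise : M.NoiseBound wq σ) (u : E) :
    Integrable (fun p => (⟪u, M.xq p⟫ ^ 2 * (M.yq p - ⟪wq, M.xq p⟫)) • M.xq p) M.sampleLaw := by
  have hx := M.measurable_xq
  have hr := M.measurable_residual wq
  have hu : Measurable fun p => ⟪u, M.xq p⟫ := hx.const_inner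
  have h1 : Integrable (fun p => ((M.yq p - ⟪wq, M.xq p⟫) * ⟪u, M.xq p⟫) ^ 2) M.sampleLaw := by
    simpa only [mul_pow] using (noiseBound_inner hnoise u).1
  have h2 : Integrable (fun p => (⟪u, M.xq p⟫ * ‖M.xq p‖) ^ 2) M.sampleLaw := by
    simpa only [mul_pow] using integrable_inner_sq_mul_norm_sq hfourth u
  refine (integrable_mul_of_sq (f := fun p => (M.yq p - ⟪wq, M.xq p⟫) * ⟪u, M.xq p⟫)
    (g := fun p => ⟪u, M.xq p⟫ * ‖M.xq p‖) (hr.mul hu).aestronglyMeasurable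
    (hu.mul hx.norm).aestronglyMeasurable h1 h2).norm.mono'
    (((hu.pow_const 2).mul hr).smul hx).aestronglyMeasurable
    (Filter.Eventually.of_forall fun p => ?_)
  simp only [norm_smul, norm_mul, norm_pow, norm_norm]
  exact le_of_eq (by ring)

theorem inner_crossMoment {α σ : ℝ} (hfourth : M.FourthMoment α) {wq : E}
    (hnoise : M.NoiseBound wq σ) (u a : E) :
    Integrable (fun p => (M.yq p - ⟪wq, M.xq p⟫) * ⟪u, M.xq p⟫ ^ 2 * ⟪a, M.xq p⟫)
      M.sampleLaw ∧
    ∫ p, (M.yq p - ⟪wq, M.xq p⟫) * ⟪u, M.xq p⟫ ^ 2 * ⟪a, M.xq p⟫ ∂M.sampleLaw =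
      ⟪M.crossMoment wq u, a⟫ := by
  have hi := integrable_crossMoment hfourth hnoise u
  have e : ∀ p, (M.yq p - ⟪wq, M.xq p⟫) * ⟪u, M.xq p⟫ ^ 2 * ⟪a, M.xq p⟫ =
      ⟪a, (⟪u, M.xq p⟫ ^ 2 * (M.yq p - ⟪wq, M.xq p⟫)) • M.xq p⟫ := fun p => by
    rw [real_inner_smul_right]; ring
  simp only [e]
  exact ⟨Integrable.const_inner (𝕜 := ℝ) a hi,
    by rw [integral_inner (𝕜 := ℝ) hi, crossMoment, real_inner_comm]⟩

/-- Second moment of the stochastic gradient of one sample. -/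
theorem integral_sample_sq_le {α σ : ℝ} (hfourth : M.FourthMoment α) {wq : E}
    (hnoise : M.NoiseBound wq σ) (u a : E) :
    Integrable (fun p => (⟪u, M.xq p⟫ * (M.yq p - ⟪wq + a, M.xq p⟫)) ^ 2) M.sampleLaw ∧
    ∫ p, (⟪u, M.xq p⟫ * (M.yq p - ⟪wq + a, M.xq p⟫)) ^ 2 ∂M.sampleLaw ≤
      σ ^ 2 * normSq M.Hq u - 2 * ⟪M.crossMoment wq u, a⟫ +
        α * normSq M.Hq a * normSq M.Hq u := by
  obtain ⟨i1, h1⟩ := noiseBound_inner hnoise u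
  obtain ⟨i2, h2⟩ := inner_crossMoment hfourth hnoise u a
  obtain ⟨i3, h3⟩ := fourthMoment_rankOne hfourth u a
  have e : ∀ p, (⟪u, M.xq p⟫ * (M.yq p - ⟪wq + a, M.xq p⟫)) ^ 2 =
      (M.yq p - ⟪wq, M.xq p⟫) ^ 2 * ⟪u, M.xq p⟫ ^ 2 -
        2 * ((M.yq p - ⟪wq, M.xq p⟫) * ⟪u, M.xq p⟫ ^ 2 * ⟪a, M.xq p⟫) +
        ⟪u, M.xq p⟫ ^ 2 * ⟪a, M.xq p⟫ ^ 2 := fun p => by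
    rw [inner_add_left]; ring
  have i4 : Integrable (fun p => (M.yq p - ⟪wq, M.xq p⟫) ^ 2 * ⟪u, M.xq p⟫ ^ 2 -
      2 * ((M.yq p - ⟪wq, M.xq p⟫) * ⟪u, M.xq p⟫ ^ 2 * ⟪a, M.xq p⟫)) M.sampleLaw :=
    i1.sub (i2.const_mul 2)
  simp only [e]
  refine ⟨i4.add i3, ?_⟩
  rw [integral_add i4 i3, integral_sub i1 (i2.const_mul 2), integral_const_mul, h2]
  linarith

/-- The linear term in the second moment of the stochastic gradient is dominated by the noise and
by the quadratic term. -/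
theorem abs_two_mul_inner_crossMoment_le {α σ : ℝ} (hfourth : M.FourthMoment α) {wq : E}
    (hnoise : M.NoiseBound wq σ) (u a : E) :
    |2 * ⟪M.crossMoment wq u, a⟫| ≤
      σ ^ 2 * normSq M.Hq u + α * normSq M.Hq a * normSq M.Hq u := by
  -- The bound of `integral_sample_sq_le` majorises a second moment, hence is nonnegative for every
  -- b; b = a and b = -a give the two signs.
  have key : ∀ b, 0 ≤ σ ^ 2 * normSq M.Hq u - 2 * ⟪M.crossMoment wq u, b⟫ +
        α * normSq M.Hq b * normSq M.Hq u := fun b =>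
    (integral_nonneg fun p => sq_nonneg _).trans (integral_sample_sq_le hfourth hnoise u b).2
  have h1 := key a
  have h2 := key (-a)
  have h3 : normSq M.Hq (-a) = normSq M.Hq a := by
    rw [normSq, normSq, map_neg, inner_neg_neg]
  rw [h3, inner_neg_right] at h2
  rw [abs_le]
  constructor <;> linarith

/-- The normal equations cancel the residual at `wq`, so only the drift towards `wq` survives in the
mean. -/
theorem integral_sample (hmom : M.FiniteMoments) {wq : E}
    (hwq : IsMinOn M.quantRisk Set.univ wq) (u a : E) :
    Integrable (fun p => ⟪u, M.xq p⟫ * (M.yq p - ⟪wq + a, M.xq p⟫)) M.sampleLaw ∧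
    ∫ p, ⟪u, M.xq p⟫ * (M.yq p - ⟪wq + a, M.xq p⟫) ∂M.sampleLaw = -⟪u, M.Hq a⟫ := by
  have hx := M.measurable_xq
  have i1 : Integrable (fun p => (M.yq p - ⟪wq, M.xq p⟫) * ⟪u, M.xq p⟫) M.sampleLaw :=
    integrable_mul_of_sq (M.measurable_residual wq).aestronglyMeasurable
      hx.const_inner.aestronglyMeasurable
      (integrable_residual_sq hx.aestronglyMeasurable M.measurable_yq.aestronglyMeasurable
        hmom.2.1 hmom.2.2.2 wq) (integrable_inner_xq_sq hmom u)
  have i2 : Integrable (fun p => ⟪u, M.xq p⟫ * ⟪M.xq p, a⟫) M.sampleLaw := by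
    simp only [real_inner_comm a]
    exact integrable_mul_of_sq hx.const_inner.aestronglyMeasurable
      hx.const_inner.aestronglyMeasurable (integrable_inner_xq_sq hmom u)
      (integrable_inner_xq_sq hmom a)
  have e : ∀ p, ⟪u, M.xq p⟫ * (M.yq p - ⟪wq + a, M.xq p⟫) =
      (M.yq p - ⟪wq, M.xq p⟫) * ⟪u, M.xq p⟫ - ⟪u, M.xq p⟫ * ⟪M.xq p, a⟫ := fun p => by
    rw [inner_add_left, real_inner_comm (M.xq p) a]; ring
  simp only [e]
  refine ⟨i1.sub i2, ?_⟩
  rw [integral_sub i1 i2, integral_residual_wq hmom hwq, inner_Hq_apply hmom]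
  ring

/-- The B diagonal terms carry the noise and the linear term, while the off-diagonal pairs give only
the squared mean. By Cauchy-Schwarz that square is at most α‖a‖²_Hq‖u‖²_Hq, so B + (B² - B) copies
add up to B². The linear term is kept exact, to be averaged over the history before it is bounded.
-/
theorem lintegral_batch_sq_le (hmom : M.FiniteMoments) {wq : E}
    (hwq : IsMinOn M.quantRisk Set.univ wq) {α σ : ℝ} (hfourth : M.FourthMoment α)
    (hnoise : M.NoiseBound wq σ) {K : ℝ} (hK : 0 ≤ K) (u a : E) :
    ∫⁻ z : Fin B → Sample E Sd Sl, ENNReal.ofReal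
        ((∑ i, ⟪u, M.xq (z i)⟫ * (M.yq (z i) - ⟪wq + a, M.xq (z i)⟫)) ^ 2 +
          K * ∑ i, ⟪u, M.xq (z i)⟫ ^ 2) ∂(Measure.pi fun _ => M.sampleLaw) ≤
      ENNReal.ofReal (B * (σ ^ 2 * normSq M.Hq u - 2 * ⟪M.crossMoment wq u, a⟫) +
        B ^ 2 * (α * normSq M.Hq a * normSq M.Hq u) + K * (B * normSq M.Hq u)) := by
  obtain ⟨i1, h1⟩ := integral_sample hmom hwq u a
  obtain ⟨i2, h2⟩ := integral_sample_sq_le hfourth hnoise u a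
  obtain ⟨i3, h3⟩ := integral_sum_eval_sq (B := B) i1.1 i2
  have i4 := integrable_inner_xq_sq hmom u
  have i5 : Integrable (fun z : Fin B → Sample E Sd Sl => K * ∑ i, ⟪u, M.xq (z i)⟫ ^ 2)
      (Measure.pi fun _ => M.sampleLaw) :=
    (integrable_sum_eval (f := fun p => ⟪u, M.xq p⟫ ^ 2) i4).const_mul K
  have h5 : ∫ z : Fin B → Sample E Sd Sl, K * ∑ i, ⟪u, M.xq (z i)⟫ ^ 2
      ∂(Measure.pi fun _ => M.sampleLaw) = K * (B * normSq M.Hq u) := by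
    rw [integral_const_mul, integral_sum_eval (f := fun p => ⟪u, M.xq p⟫ ^ 2) i4,
      normSq_Hq hmom]
  have hjensen : (⟪u, M.Hq a⟫) ^ 2 ≤ α * normSq M.Hq a * normSq M.Hq u := by
    obtain ⟨j1, j2⟩ := fourthMoment_rankOne hfourth u a
    refine le_trans ?_ j2
    have hx := M.measurable_xq
    have i6 : Integrable (fun p => ⟪u, M.xq p⟫ * ⟪a, M.xq p⟫) M.sampleLaw :=
      integrable_mul_of_sq hx.const_inner.aestronglyMeasurable
        hx.const_inner.aestronglyMeasurable i4 (integrable_inner_xq_sq hmom a)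
    have hL : MemLp (fun p => ⟪u, M.xq p⟫ * ⟪a, M.xq p⟫) 2 M.sampleLaw :=
      (memLp_two_iff_integrable_sq i6.1).2 (by simpa only [mul_pow] using j1)
    have hv := variance_nonneg (fun p => ⟪u, M.xq p⟫ * ⟪a, M.xq p⟫) M.sampleLaw
    rw [variance_eq_sub hL] at hv
    simp only [Pi.pow_apply, mul_pow] at hv
    rw [inner_Hq_apply hmom]
    simp only [real_inner_comm a]
    linarith
  rw [lintegral_ofReal_eq (f := fun z : Fin B → Sample E Sd Sl =>
      (∑ i, ⟪u, M.xq (z i)⟫ * (M.yq (z i) - ⟪wq + a, M.xq (z i)⟫)) ^ 2 +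
          K * ∑ i, ⟪u, M.xq (z i)⟫ ^ 2) (i3.add i5) (fun z => add_nonneg (sq_nonneg _)
      (mul_nonneg hK (Finset.sum_nonneg fun i _ => sq_nonneg _))), integral_add i3 i5, h3, h5, h1,
    neg_sq]
  refine ENNReal.ofReal_le_ofReal ?_
  have hB0 : (0 : ℝ) ≤ B := Nat.cast_nonneg B
  have hB : (0 : ℝ) ≤ (B : ℝ) ^ 2 - B := by
    rcases Nat.eq_zero_or_pos B with h | h
    · simp [h]
    · have : (1 : ℝ) ≤ B := by exact_mod_cast h
      nlinarith
  have := mul_le_mul_of_nonneg_left h2 hB0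
  have := mul_le_mul_of_nonneg_left hjensen hB
  linarith

/-! #### Averaging over the parameter quantizer -/

section History

variable {X : Type*} [MeasurableSpace X] {ρ : Measure X} [IsProbabilityMeasure ρ] {W : X → E}

theorem measurable_Qp (hW : Measurable W) :
    Measurable fun p : X × Sp => M.Qp.toFun (W p.1) p.2 :=
  M.Qp.measurable_toFun.comp ((hW.comp measurable_fst).prodMk measurable_snd)

/-- Mean and energy of the quantized parameters. -/
theorem integral_normSq_Qp_le (hunb : M.UnbiasedQuantizers) (hmom : M.FiniteMoments)
    (hW : Measurable W) (hW2 : Integrable (fun x => ‖W x‖ ^ 2) ρ) (wq : E) {e : ℝ} (he0 : 0 ≤ e)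
    (he : ∫⁻ p, ENNReal.ofReal (normSq M.Hq (M.Qp.toFun (W p.1) p.2 - W p.1))
      ∂(ρ.prod M.Qp.seedLaw) ≤ ENNReal.ofReal e) :
    Integrable (fun p : X × Sp => normSq M.Hq (M.Qp.toFun (W p.1) p.2 - wq))
        (ρ.prod M.Qp.seedLaw) ∧
      ∫ p, normSq M.Hq (M.Qp.toFun (W p.1) p.2 - wq) ∂(ρ.prod M.Qp.seedLaw) ≤
        ∫ x, normSq M.Hq (W x - wq) ∂ρ + e := by
  have hsym := isSymmetric_Hq hmom
  have hQ := measurable_Qp (M := M) hW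
  have hW1 : Measurable fun p : X × Sp => W p.1 := hW.comp measurable_fst
  have hcont := continuous_normSq M.Hq
  have mE : AEStronglyMeasurable (fun p : X × Sp =>
      normSq M.Hq (M.Qp.toFun (W p.1) p.2 - W p.1)) (ρ.prod M.Qp.seedLaw) :=
    (hcont.measurable.comp (hQ.sub hW1)).aestronglyMeasurable
  have iE := integrable_of_lintegral_ofReal_le mE (fun p => normSq_Hq_nonneg hmom _) he
  have hE := integral_le_of_lintegral_ofReal_le mE (fun p => normSq_Hq_nonneg hmom _) he0 he
  have iW : Integrable (fun x => normSq M.Hq (W x - wq)) ρ := by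
    have h1 := integrable_norm_sq_add (μ := ρ) (f := W) (g := fun _ => -wq)
      hW.aestronglyMeasurable aestronglyMeasurable_const hW2 (integrable_const _)
    simp only [← sub_eq_add_neg] at h1
    refine (h1.const_mul ‖M.Hq‖).mono'
      (hcont.measurable.comp (hW.sub_const wq)).aestronglyMeasurable
      (Filter.Eventually.of_forall fun x => ?_)
    rw [Real.norm_of_nonneg (normSq_Hq_nonneg hmom _)]
    exact normSq_le_norm _ _
  have iW' : Integrable (fun p : X × Sp => normSq M.Hq (W p.1 - wq)) (ρ.prod M.Qp.seedLaw) :=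
    iW.comp_fst _
  have exp1 : ∀ p : X × Sp, normSq M.Hq (M.Qp.toFun (W p.1) p.2 - wq) =
      normSq M.Hq (W p.1 - wq) + 2 * ⟪M.Hq (W p.1 - wq), M.Qp.toFun (W p.1) p.2 - W p.1⟫ +
        normSq M.Hq (M.Qp.toFun (W p.1) p.2 - W p.1) := fun p => by
    rw [← normSq_add hsym]; congr 1; abel
  -- Only the Hq-energy of the parameter error is controlled, not its norm; the cross term is
  -- integrable by the arithmetic-geometric inequality in the Hq seminorm.
  have exp2 : ∀ a b : E, |2 * ⟪M.Hq a, b⟫| ≤ normSq M.Hq a + normSq M.Hq b := fun a b => by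
    have h1 := normSq_Hq_nonneg hmom (a + b)
    have h2 := normSq_Hq_nonneg hmom (a + -b)
    have h3 : normSq M.Hq (-b) = normSq M.Hq b := by
      rw [normSq, normSq, map_neg, inner_neg_neg]
    rw [normSq_add hsym] at h1 h2
    rw [h3, inner_neg_right] at h2
    rw [abs_le]
    constructor <;> linarith
  have iC : Integrable (fun p : X × Sp =>
      2 * ⟪M.Hq (W p.1 - wq), M.Qp.toFun (W p.1) p.2 - W p.1⟫) (ρ.prod M.Qp.seedLaw) :=
    (iW'.add iE).mono' (((M.Hq.continuous.measurable.comp (hW1.sub_const wq)).inner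
      (hQ.sub hW1)).const_mul 2).aestronglyMeasurable
      (Filter.Eventually.of_forall fun p => exp2 _ _)
  have hC : ∫ p : X × Sp, 2 * ⟪M.Hq (W p.1 - wq), M.Qp.toFun (W p.1) p.2 - W p.1⟫
      ∂(ρ.prod M.Qp.seedLaw) = 0 := by
    rw [integral_prod _ iC]
    refine integral_eq_zero_of_ae (Filter.Eventually.of_forall fun x => ?_)
    simp only [integral_const_mul, Quantizer.integral_inner_err hunb.2.2.1, mul_zero,
      Pi.zero_apply]
  have hW0 : ∫ p : X × Sp, normSq M.Hq (W p.1 - wq) ∂(ρ.prod M.Qp.seedLaw) =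
      ∫ x, normSq M.Hq (W x - wq) ∂ρ := by
    have := integral_fun_fst (μ := ρ) (ν := M.Qp.seedLaw) (fun x => normSq M.Hq (W x - wq))
    rwa [probReal_univ, one_smul] at this
  have i2 : Integrable (fun p : X × Sp => normSq M.Hq (W p.1 - wq) +
      2 * ⟪M.Hq (W p.1 - wq), M.Qp.toFun (W p.1) p.2 - W p.1⟫) (ρ.prod M.Qp.seedLaw) :=
    iW'.add iC
  simp only [exp1]
  refine ⟨i2.add iE, ?_⟩
  rw [integral_add i2 iE, integral_add iW' iC, hC, hW0]
  linarith

theorem integral_inner_Qp (hunb : M.UnbiasedQuantizers)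
    (hWi : Integrable W ρ) (wq l : E)
    (hi : Integrable (fun p : X × Sp => ⟪l, M.Qp.toFun (W p.1) p.2 - wq⟫)
      (ρ.prod M.Qp.seedLaw)) :
    ∫ p : X × Sp, ⟪l, M.Qp.toFun (W p.1) p.2 - wq⟫ ∂(ρ.prod M.Qp.seedLaw) =
      ⟪l, ∫ x, (W x - wq) ∂ρ⟫ := by
  have hi2 : Integrable (fun x => W x - wq) ρ := hWi.sub (integrable_const _)
  rw [integral_prod _ hi, ← integral_inner (𝕜 := ℝ) hi2]
  refine integral_congr_ae (Filter.Eventually.of_forall fun x => ?_)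
  have h := hunb.2.2.1 (W x)
  have h2 : Integrable (fun s => M.Qp.toFun (W x) s - wq) M.Qp.seedLaw :=
    h.1.sub (integrable_const _)
  simp only
  rw [integral_inner (𝕜 := ℝ) h2, integral_sub h.1 (integrable_const _), h.2]
  simp

/-- Second moment of the stochastic gradient, averaged over the samples, the parameter quantizer
and the history. -/
theorem lintegral_history_le (hunb : M.UnbiasedQuantizers) (hmom : M.FiniteMoments) {wq : E}
    {α σ : ℝ} (hα : 0 ≤ α) (hfourth : M.FourthMoment α)
    (hnoise : M.NoiseBound wq σ) (hB : 1 ≤ B)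
    (hW : Measurable W) (hW2 : Integrable (fun x => ‖W x‖ ^ 2) ρ) {K e : ℝ} (hK : 0 ≤ K)
    (he0 : 0 ≤ e)
    (he : ∫⁻ p, ENNReal.ofReal (normSq M.Hq (M.Qp.toFun (W p.1) p.2 - W p.1))
      ∂(ρ.prod M.Qp.seedLaw) ≤ ENNReal.ofReal e) (u : E) :
    ∫⁻ p : X × Sp, ENNReal.ofReal (B * (σ ^ 2 * normSq M.Hq u -
          2 * ⟪M.crossMoment wq u, M.Qp.toFun (W p.1) p.2 - wq⟫) +
        B ^ 2 * (α * normSq M.Hq (M.Qp.toFun (W p.1) p.2 - wq) * normSq M.Hq u) +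
        K * (B * normSq M.Hq u)) ∂(ρ.prod M.Qp.seedLaw) ≤
      ENNReal.ofReal (B ^ 2 * normSq M.Hq u * (α * ∫ x, normSq M.Hq (W x - wq) ∂ρ +
        α * normSq M.Hq (∫ x, (W x - wq) ∂ρ) + 2 * ((σ ^ 2 + K) / B + α * e))) := by
  set U := normSq M.Hq u with hU
  have hU0 : 0 ≤ U := normSq_Hq_nonneg hmom u
  have hB' : (1 : ℝ) ≤ B := by exact_mod_cast hB
  obtain ⟨iq, hq⟩ := integral_normSq_Qp_le hunb hmom hW hW2 wq he0 he
  have hQ := measurable_Qp (M := M) hW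
  set l := M.crossMoment wq u with hl
  have il : Integrable (fun p : X × Sp => 2 * ⟪l, M.Qp.toFun (W p.1) p.2 - wq⟫)
      (ρ.prod M.Qp.seedLaw) := by
    refine ((integrable_const (σ ^ 2 * U)).add ((iq.const_mul α).mul_const U)).mono'
      ((hQ.sub_const wq).const_inner.const_mul 2).aestronglyMeasurable
      (Filter.Eventually.of_forall fun p => ?_)
    exact abs_two_mul_inner_crossMoment_le hfourth hnoise u _
  have hl1 := integral_inner_Qp (M := M) hunb (integrable_of_norm_sq hW.aestronglyMeasurable hW2)
    wq l (by simpa using il.const_mul (1 / 2))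
  have i1 : Integrable (fun p : X × Sp => (B : ℝ) * (σ ^ 2 * U -
      2 * ⟪l, M.Qp.toFun (W p.1) p.2 - wq⟫)) (ρ.prod M.Qp.seedLaw) :=
    ((integrable_const _).sub il).const_mul _
  have i2 : Integrable (fun p : X × Sp => (B : ℝ) ^ 2 *
      (α * normSq M.Hq (M.Qp.toFun (W p.1) p.2 - wq) * U)) (ρ.prod M.Qp.seedLaw) :=
    ((iq.const_mul α).mul_const U).const_mul _
  have i3 : Integrable (fun p : X × Sp => (B : ℝ) * (σ ^ 2 * U -
      2 * ⟪l, M.Qp.toFun (W p.1) p.2 - wq⟫) + (B : ℝ) ^ 2 *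
      (α * normSq M.Hq (M.Qp.toFun (W p.1) p.2 - wq) * U)) (ρ.prod M.Qp.seedLaw) := i1.add i2
  -- The linear term is at most σ²U + α‖a‖²_Hq U, which leaves (B² - B) α‖a‖²_Hq U ≥ 0 because B ≥
  -- 1.
  have hnn : ∀ p : X × Sp, 0 ≤ (B : ℝ) * (σ ^ 2 * U -
      2 * ⟪l, M.Qp.toFun (W p.1) p.2 - wq⟫) + (B : ℝ) ^ 2 *
      (α * normSq M.Hq (M.Qp.toFun (W p.1) p.2 - wq) * U) + K * (B * U) := fun p => by
    set a := M.Qp.toFun (W p.1) p.2 - wq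
    have h1 := (abs_le.1 (abs_two_mul_inner_crossMoment_le hfourth hnoise u a)).2
    have h2 : 0 ≤ α * normSq M.Hq a * U :=
      mul_nonneg (mul_nonneg hα (normSq_Hq_nonneg hmom a)) hU0
    have h3 : 0 ≤ K * (B * U) := by positivity
    have h4 : (B : ℝ) * (2 * ⟪l, a⟫) ≤ B * (σ ^ 2 * U + α * normSq M.Hq a * U) :=
      mul_le_mul_of_nonneg_left h1 (by linarith)
    nlinarith [mul_nonneg h2 (sub_nonneg.2 hB'), mul_nonneg (mul_nonneg h2 (sub_nonneg.2 hB'))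
      (by linarith : (0 : ℝ) ≤ B)]
  have i4 : Integrable (fun p : X × Sp => (B : ℝ) * (σ ^ 2 * U -
      2 * ⟪l, M.Qp.toFun (W p.1) p.2 - wq⟫) + (B : ℝ) ^ 2 *
      (α * normSq M.Hq (M.Qp.toFun (W p.1) p.2 - wq) * U) + K * (B * U)) (ρ.prod M.Qp.seedLaw) :=
    i3.add (integrable_const _)
  rw [lintegral_ofReal_eq i4 hnn, integral_add i3 (integrable_const _),
    integral_add i1 i2, integral_const_mul, integral_const_mul, integral_sub (integrable_const _) il,
    integral_const_mul (2 : ℝ), hl1, integral_mul_const U (fun p : X × Sp =>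
      α * normSq M.Hq (M.Qp.toFun (W p.1) p.2 - wq)), integral_const_mul α, integral_const,
    integral_const, probReal_univ, one_smul, one_smul]
  refine ENNReal.ofReal_le_ofReal ?_
  set β := ∫ x, (W x - wq) ∂ρ
  set τ := ∫ x, normSq M.Hq (W x - wq) ∂ρ
  -- Applied after integration, at the mean β: the cost is α‖β‖²_Hq rather than a second α τ.
  have h1 := (abs_le.1 (abs_two_mul_inner_crossMoment_le hfourth hnoise u β)).1
  rw [← hU] at h1
  have h2 : 0 ≤ α * normSq M.Hq β * U :=
    mul_nonneg (mul_nonneg hα (normSq_Hq_nonneg hmom β)) hU0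
  have h3 := mul_le_mul_of_nonneg_left hq (mul_nonneg hα hU0)
  have h4 : (B : ℝ) * (σ ^ 2 * U - 2 * ⟪l, β⟫) ≤
      B * (2 * (σ ^ 2 * U)) + B ^ 2 * (α * normSq M.Hq β * U) := by
    have h5 := mul_le_mul_of_nonneg_left h1 (by linarith : (0 : ℝ) ≤ B)
    have h6 : (B : ℝ) * (α * normSq M.Hq β * U) ≤ B ^ 2 * (α * normSq M.Hq β * U) :=
      mul_le_mul_of_nonneg_right (by nlinarith) h2
    linarith
  have h7 := mul_le_mul_of_nonneg_left h3 (sq_nonneg (B : ℝ))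
  -- Only σ² really needs the factor 2; the second copies of the `K` and `e` terms are slack (`h9`,
  -- `h10`).
  have h8 : (B : ℝ) ^ 2 * U * (α * τ + α * normSq M.Hq β + 2 * ((σ ^ 2 + K) / B + α * e)) =
      B ^ 2 * (α * U * (τ + e)) + B ^ 2 * (α * normSq M.Hq β * U) + B * (2 * (σ ^ 2 * U)) +
        2 * (K * (B * U)) + B ^ 2 * U * (α * e) := by field_simp; ring
  have h9 : 0 ≤ K * (B * U) := by positivity
  have h10 : 0 ≤ (B : ℝ) ^ 2 * U * (α * e) := by positivity
  rw [h8]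
  linarith

end History

end Model

end QuantSGD

/-! ### The stochastic gradient under the full law of a step -/

namespace QuantSGD

namespace Model

set_option linter.unusedSectionVars false

variable {E Sd Sl Sp Sa So : Type*} {B : ℕ} [NormedAddCommGroup E] [InnerProductSpace ℝ E]
  [CompleteSpace E] [SecondCountableTopology E] [MeasurableSpace E] [BorelSpace E]
  [MeasurableSpace Sd] [MeasurableSpace Sl] [MeasurableSpace Sp] [MeasurableSpace Sa]
  [MeasurableSpace So] {M : Model E Sd Sl Sp Sa So B}

instance (M : Model E Sd Sl Sp Sa So B) : IsProbabilityMeasure M.stepLaw := by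
  unfold stepLaw; infer_instance

/-- The unnormalized stochastic gradient `Q_d(X)ᵀ Q_o(o)`. -/
def stepDir (M : Model E Sd Sl Sp Sa So B) (w : E) (z : StepInput E Sd Sl Sp Sa So B) : E :=
  ∑ i, M.Qo.toFun (M.outGrad w z) z.2.2.2 i • M.xq (z.1 i)

/-- The coordinates `⟨u, Q_d(x_i)⟩` along a batch. -/
def batchInner (M : Model E Sd Sl Sp Sa So B) (u : E) (b : Fin B → Sample E Sd Sl) :
    EuclideanSpace ℝ (Fin B) :=
  WithLp.toLp 2 fun i => ⟪u, M.xq (b i)⟫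

/-- The quantized labels of a batch. -/
def batchLabel (M : Model E Sd Sl Sp Sa So B) (b : Fin B → Sample E Sd Sl) :
    EuclideanSpace ℝ (Fin B) :=
  WithLp.toLp 2 fun i => M.yq (b i)

theorem step_eq (γ : ℝ) (w : E) (z : StepInput E Sd Sl Sp Sa So B) :
    M.step γ w z = w + (γ * (1 / (B : ℝ))) • M.stepDir w z := rfl

/-! #### Measurability -/

theorem measurable_batch_xq (M : Model E Sd Sl Sp Sa So B) (i : Fin B) :
    Measurable fun b : Fin B → Sample E Sd Sl => M.xq (b i) :=
  M.measurable_xq.comp (measurable_pi_apply i)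

theorem measurable_batch_yq (M : Model E Sd Sl Sp Sa So B) (i : Fin B) :
    Measurable fun b : Fin B → Sample E Sd Sl => M.yq (b i) :=
  M.measurable_yq.comp (measurable_pi_apply i)

theorem measurable_wquant (M : Model E Sd Sl Sp Sa So B) :
    Measurable fun p : E × StepInput E Sd Sl Sp Sa So B => M.wquant p.1 p.2 :=
  M.Qp.measurable_toFun.comp (by fun_prop :
    Measurable fun p : E × StepInput E Sd Sl Sp Sa So B => (p.1, p.2.2.1))

theorem measurable_activation (M : Model E Sd Sl Sp Sa So B) :
    Measurable fun p : E × StepInput E Sd Sl Sp Sa So B => M.activation p.1 p.2 := by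
  unfold activation
  refine (WithLp.measurable_toLp 2 _).comp (measurable_pi_lambda _ fun i => ?_)
  exact ((M.measurable_batch_xq i).comp (by fun_prop)).inner M.measurable_wquant

theorem measurable_outGrad (M : Model E Sd Sl Sp Sa So B) :
    Measurable fun p : E × StepInput E Sd Sl Sp Sa So B => M.outGrad p.1 p.2 := by
  unfold outGrad
  refine Measurable.sub ((WithLp.measurable_toLp 2 _).comp (measurable_pi_lambda _ fun i => ?_)) ?_
  · exact (M.measurable_batch_yq i).comp (by fun_prop)
  · exact M.Qa.measurable_toFun.comp (M.measurable_activation.prodMk (by fun_prop))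

theorem measurable_stepDir (M : Model E Sd Sl Sp Sa So B) :
    Measurable fun p : E × StepInput E Sd Sl Sp Sa So B => M.stepDir p.1 p.2 := by
  unfold stepDir
  have h : Measurable fun p : E × StepInput E Sd Sl Sp Sa So B =>
      M.Qo.toFun (M.outGrad p.1 p.2) p.2.2.2.2 :=
    M.Qo.measurable_toFun.comp (M.measurable_outGrad.prodMk (by fun_prop))
  refine Finset.measurable_sum _ fun i _ => Measurable.smul ?_ ?_
  · exact (measurable_pi_apply i).comp ((WithLp.measurable_ofLp 2 _).comp h)
  · exact (M.measurable_batch_xq i).comp (by fun_prop)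

theorem measurable_step (M : Model E Sd Sl Sp Sa So B) (γ : ℝ) :
    Measurable fun p : E × StepInput E Sd Sl Sp Sa So B => M.step γ p.1 p.2 := by
  simp only [step_eq]
  exact measurable_fst.add (M.measurable_stepDir.const_smul _)

theorem measurable_errCov_norm (M : Model E Sd Sl Sp Sa So B) :
    Measurable fun p : E × StepInput E Sd Sl Sp Sa So B =>
      ‖M.Qo.errCov (M.outGrad p.1 p.2) + M.Qa.errCov (M.activation p.1 p.2)‖ :=
  ((M.Qo.stronglyMeasurable_errCov.comp_measurable M.measurable_outGrad).add
    (M.Qa.stronglyMeasurable_errCov.comp_measurable M.measurable_activation)).norm.measurable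

/-! #### The stochastic gradient in terms of the batch -/

theorem inner_stepDir (u w : E) (b : Fin B → Sample E Sd Sl) (sp : Sp) (sa : Sa) (so : So) :
    ⟪u, M.stepDir w (b, sp, sa, so)⟫ = ⟪M.batchInner u b, M.Qo.toFun (M.batchLabel b -
      M.Qa.toFun (WithLp.toLp 2 fun i => ⟪M.xq (b i), M.Qp.toFun w sp⟫) sa) so⟫ := by
  simp only [stepDir, inner_sum, real_inner_smul_right, PiLp.inner_apply, batchInner]
  rfl

theorem inner_batchInner_sub (u q : E) (b : Fin B → Sample E Sd Sl) :
    ⟪M.batchInner u b, M.batchLabel b - WithLp.toLp 2 fun i => ⟪M.xq (b i), q⟫⟫ =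
      ∑ i, ⟪u, M.xq (b i)⟫ * (M.yq (b i) - ⟪q, M.xq (b i)⟫) := by
  simp only [PiLp.inner_apply, batchInner, batchLabel, PiLp.sub_apply]
  refine Finset.sum_congr rfl fun i _ => ?_
  rw [real_inner_comm q]
  exact mul_comm _ _

theorem norm_batchInner_sq (u : E) (b : Fin B → Sample E Sd Sl) :
    ‖M.batchInner u b‖ ^ 2 = ∑ i, ⟪u, M.xq (b i)⟫ ^ 2 := by
  rw [EuclideanSpace.real_norm_sq_eq]
  rfl

section History

variable {X : Type*} [MeasurableSpace X] {ρ : Measure X} [IsProbabilityMeasure ρ] {W : X → E}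

theorem measurable_stepDir_comp (hW : Measurable W) :
    Measurable fun p : X × StepInput E Sd Sl Sp Sa So B => M.stepDir (W p.1) p.2 := by
  have h : Measurable fun p : X × StepInput E Sd Sl Sp Sa So B => (W p.1, p.2) :=
    (hW.comp measurable_fst).prodMk measurable_snd
  have h2 := M.measurable_stepDir.comp h
  exact h2

/-- Second moments of the stochastic gradient. -/
theorem lintegral_inner_stepDir_sq_le (hunb : M.UnbiasedQuantizers)
    (hQa : M.Qa.FiniteErrorMoment) (hQo : M.Qo.FiniteErrorMoment)
    (hmom : M.FiniteMoments) {wq : E} (hwq : IsMinOn M.quantRisk Set.univ wq)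
    {α σ : ℝ} (hα : 0 ≤ α) (hfourth : M.FourthMoment α)
    (hnoise : M.NoiseBound wq σ) (hB : 1 ≤ B)
    (hW : Measurable W) (hW2 : Integrable (fun x => ‖W x‖ ^ 2) ρ) {K e : ℝ}
    (he0 : 0 ≤ e)
    (hK : ∀ᵐ p ∂(ρ.prod M.stepLaw), ‖M.Qo.errCov (M.outGrad (W p.1) p.2) +
      M.Qa.errCov (M.activation (W p.1) p.2)‖ ≤ K)
    (he : ∫⁻ p, ENNReal.ofReal (normSq M.Hq (M.wquant (W p.1) p.2 - W p.1))
      ∂(ρ.prod M.stepLaw) ≤ ENNReal.ofReal e) (u : E) :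
    ∫⁻ p, ENNReal.ofReal (⟪u, M.stepDir (W p.1) p.2⟫ ^ 2) ∂(ρ.prod M.stepLaw) ≤
      ENNReal.ofReal (B ^ 2 * normSq M.Hq u * (α * ∫ x, normSq M.Hq (W x - wq) ∂ρ +
        α * normSq M.Hq (∫ x, (W x - wq) ∂ρ) + 2 * ((σ ^ 2 + K) / B + α * e))) := by
  have hK0 : 0 ≤ K := by
    obtain ⟨p, hp⟩ := hK.exists
    exact (norm_nonneg _).trans hp
  have hcont := (continuous_normSq M.Hq).measurable
  have hQm := measurable_Qp (M := M) hW
  have he' : ∫⁻ p, ENNReal.ofReal (normSq M.Hq (M.Qp.toFun (W p.1) p.2 - W p.1))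
      ∂(ρ.prod M.Qp.seedLaw) ≤ ENNReal.ofReal e := by
    have hmp : MeasurePreserving (fun z : StepInput E Sd Sl Sp Sa So B => z.2.1)
        M.stepLaw M.Qp.seedLaw :=
      measurePreserving_fst.comp measurePreserving_snd
    have hmp2 := (MeasurePreserving.id ρ).prod hmp
    refine le_trans (le_of_eq ?_) he
    exact (hmp2.lintegral_comp (f := fun p : X × Sp => ENNReal.ofReal
      (normSq M.Hq (M.Qp.toFun (W p.1) p.2 - W p.1)))
      (hcont.comp (hQm.sub (hW.comp measurable_fst))).ennreal_ofReal).symm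
  refine le_trans ?_ (lintegral_history_le hunb hmom hα hfourth hnoise hB hW hW2 hK0 he0 he' u)
  have hF : Measurable fun p : X × StepInput E Sd Sl Sp Sa So B =>
      ENNReal.ofReal (⟪u, M.stepDir (W p.1) p.2⟫ ^ 2) :=
    ((measurable_stepDir_comp hW).const_inner.pow_const 2).ennreal_ofReal
  have hH : Measurable fun p : X × Sp => ENNReal.ofReal (B * (σ ^ 2 * normSq M.Hq u -
          2 * ⟪M.crossMoment wq u, M.Qp.toFun (W p.1) p.2 - wq⟫) +
        B ^ 2 * (α * normSq M.Hq (M.Qp.toFun (W p.1) p.2 - wq) * normSq M.Hq u) +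
        K * (B * normSq M.Hq u)) := by
    have h1 : Measurable fun p : X × Sp => ⟪M.crossMoment wq u, M.Qp.toFun (W p.1) p.2 - wq⟫ :=
      (hQm.sub_const wq).const_inner
    have h2 : Measurable fun p : X × Sp => normSq M.Hq (M.Qp.toFun (W p.1) p.2 - wq) :=
      hcont.comp (hQm.sub_const wq)
    fun_prop
  rw [lintegral_prod _ hF.aemeasurable, lintegral_prod _ hH.aemeasurable]
  refine lintegral_mono_ae ?_
  filter_upwards [Measure.ae_ae_of_ae_prod hK] with x hx
  have hFx := hF.comp (measurable_prodMk_left (x := x))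
  simp only [Function.comp_def] at hFx
  -- The form wq + (Q_p(w) - wq) is the one in which `lintegral_batch_sq_le` takes its argument.
  set G : (Fin B → Sample E Sd Sl) → Sp → ℝ≥0∞ := fun b sp => ENNReal.ofReal
    ((∑ i, ⟪u, M.xq (b i)⟫ * (M.yq (b i) - ⟪wq + (M.Qp.toFun (W x) sp - wq), M.xq (b i)⟫)) ^ 2 +
      K * ∑ i, ⟪u, M.xq (b i)⟫ ^ 2) with hG
  calc ∫⁻ z, ENNReal.ofReal (⟪u, M.stepDir (W x) z⟫ ^ 2) ∂M.stepLaw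
      ≤ ∫⁻ b, ∫⁻ sp, G b sp ∂M.Qp.seedLaw ∂(Measure.pi fun _ => M.sampleLaw) := by
        unfold stepLaw at hx ⊢
        rw [lintegral_prod _ hFx.aemeasurable]
        refine lintegral_mono_ae ?_
        filter_upwards [Measure.ae_ae_of_ae_prod hx] with b hb
        have hFb := hFx.comp (measurable_prodMk_left (x := b))
        simp only [Function.comp_def] at hFb
        rw [lintegral_prod _ hFb.aemeasurable]
        refine lintegral_mono_ae ?_
        filter_upwards [Measure.ae_ae_of_ae_prod hb] with sp hsp
        have hFs := hFb.comp (measurable_prodMk_left (x := sp))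
        simp only [Function.comp_def] at hFs
        rw [lintegral_prod _ hFs.aemeasurable]
        simp only [inner_stepDir]
        have hsa : ∀ᵐ sa ∂M.Qa.seedLaw, ‖M.Qo.errCov (M.batchLabel b - M.Qa.toFun
            (WithLp.toLp 2 fun i => ⟪M.xq (b i), M.Qp.toFun (W x) sp⟫) sa) +
            M.Qa.errCov (WithLp.toLp 2 fun i => ⟪M.xq (b i), M.Qp.toFun (W x) sp⟫)‖ ≤ K := by
          filter_upwards [Measure.ae_ae_of_ae_prod hsp] with sa hsa
          -- The bounded quantity does not depend on the gradient seed, so one seed is enough.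
          obtain ⟨so, hso⟩ := hsa.exists
          exact hso
        refine (Quantizer.lintegral_inner_sq_le hunb.2.2.2.1 hunb.2.2.2.2 hQa hQo _ _ _ hsa).trans
          (le_of_eq ?_)
        simp only [hG]
        rw [inner_batchInner_sub, norm_batchInner_sq, add_sub_cancel]
    _ = ∫⁻ sp, ∫⁻ b, G b sp ∂(Measure.pi fun _ => M.sampleLaw) ∂M.Qp.seedLaw := by
        -- After the exchange the batch is averaged with the quantized parameter held fixed, which
        -- is possible since their seeds are independent.
        refine lintegral_lintegral_swap (Measurable.aemeasurable ?_)
        simp only [hG, Function.uncurry_def]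
        have hq : Measurable fun p : (Fin B → Sample E Sd Sl) × Sp =>
            wq + (M.Qp.toFun (W x) p.2 - wq) :=
          ((M.Qp.measurable_toFun_left (W x)).comp measurable_snd).sub_const wq |>.const_add wq
        have hxi : ∀ i, Measurable fun p : (Fin B → Sample E Sd Sl) × Sp => M.xq (p.1 i) :=
          fun i => (M.measurable_batch_xq i).comp measurable_fst
        have hyi : ∀ i, Measurable fun p : (Fin B → Sample E Sd Sl) × Sp => M.yq (p.1 i) :=
          fun i => (M.measurable_batch_yq i).comp measurable_fst
        refine Measurable.ennreal_ofReal (Measurable.add (Measurable.pow_const ?_ 2)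
          (Measurable.const_mul ?_ K))
        · exact Finset.measurable_sum _ fun i _ =>
            (hxi i).const_inner.mul ((hyi i).sub (hq.inner (hxi i)))
        · exact Finset.measurable_sum _ fun i _ => (hxi i).const_inner.pow_const 2
    _ ≤ _ := by
        refine lintegral_mono fun sp => ?_
        exact lintegral_batch_sq_le hmom hwq hfourth hnoise hK0 u _

/-- Conditional mean of the stochastic gradient. -/
theorem integral_inner_stepDir (hunb : M.UnbiasedQuantizers) (hmom : M.FiniteMoments) {wq : E}
    (hwq : IsMinOn M.quantRisk Set.univ wq) (u w : E)
    (hi : Integrable (fun z => ⟪u, M.stepDir w z⟫) M.stepLaw) :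
    ∫ z, ⟪u, M.stepDir w z⟫ ∂M.stepLaw = -B * ⟪u, M.Hq (w - wq)⟫ := by
  unfold stepLaw at hi ⊢
  rw [integral_prod _ hi]
  have h1 : ∀ᵐ b ∂(Measure.pi fun _ : Fin B => M.sampleLaw),
      ∫ r, ⟪u, M.stepDir w (b, r)⟫ ∂(M.Qp.seedLaw.prod (M.Qa.seedLaw.prod M.Qo.seedLaw)) =
        ∑ i, ⟪u, M.xq (b i)⟫ * (M.yq (b i) - ⟪wq + (w - wq), M.xq (b i)⟫) := by
    filter_upwards [hi.prod_right_ae] with b hb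
    rw [integral_prod _ hb]
    have h2 : ∀ᵐ sp ∂M.Qp.seedLaw,
        ∫ r, ⟪u, M.stepDir w (b, sp, r)⟫ ∂(M.Qa.seedLaw.prod M.Qo.seedLaw) =
          ∑ i, ⟪u, M.xq (b i)⟫ * (M.yq (b i) - ⟪M.Qp.toFun w sp, M.xq (b i)⟫) := by
      filter_upwards [hb.prod_right_ae] with sp hsp
      rw [integral_prod _ hsp]
      simp only [inner_stepDir]
      rw [Quantizer.integral_inner_eq hunb.2.2.2.1 hunb.2.2.2.2, inner_batchInner_sub]
    have hp := hunb.2.2.1 w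
    rw [integral_congr_ae h2, integral_finsetSum]
    · refine Finset.sum_congr rfl fun i _ => ?_
      rw [integral_const_mul, integral_sub (integrable_const _) (hp.1.inner_const _),
        integral_const, probReal_univ, one_smul, add_sub_cancel]
      simp only [real_inner_comm (M.xq (b i))]
      rw [integral_inner (𝕜 := ℝ) hp.1, hp.2]
    · exact fun i _ => ((integrable_const _).sub (hp.1.inner_const _)).const_mul _
  obtain ⟨i1, h3⟩ := integral_sample hmom hwq u (w - wq)
  rw [integral_congr_ae h1, integral_sum_eval i1, h3]
  ring

/-- The stochastic gradient has mean `-B H^(q) (w - wq)` conditionally on the history. -/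
theorem integral_mul_inner_stepDir (hunb : M.UnbiasedQuantizers) (hmom : M.FiniteMoments) {wq : E}
    (hwq : IsMinOn M.quantRisk Set.univ wq) (hW : Measurable W) {Y : X → ℝ} (hY : Measurable Y)
    (hY2 : Integrable (fun x => Y x ^ 2) ρ) (u : E)
    (hi : Integrable (fun p => ⟪u, M.stepDir (W p.1) p.2⟫ ^ 2) (ρ.prod M.stepLaw)) :
    Integrable (fun p => Y p.1 * ⟪u, M.stepDir (W p.1) p.2⟫) (ρ.prod M.stepLaw) ∧
      ∫ p, Y p.1 * ⟪u, M.stepDir (W p.1) p.2⟫ ∂(ρ.prod M.stepLaw) =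
        -B * ∫ x, Y x * ⟪u, M.Hq (W x - wq)⟫ ∂ρ := by
  have hm : AEStronglyMeasurable (fun p => ⟪u, M.stepDir (W p.1) p.2⟫) (ρ.prod M.stepLaw) :=
    (measurable_stepDir_comp hW).const_inner.aestronglyMeasurable
  have h1 := integrable_mul_of_sq (hY.comp measurable_fst).aestronglyMeasurable hm
    (hY2.comp_fst M.stepLaw) hi
  refine ⟨h1, ?_⟩
  rw [integral_prod (fun p => Y p.1 * ⟪u, M.stepDir (W p.1) p.2⟫) h1, ← integral_const_mul]
  refine integral_congr_ae ?_
  filter_upwards [(integrable_of_sq hm hi).prod_right_ae] with x hx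
  rw [integral_const_mul, integral_inner_stepDir hunb hmom hwq u (W x) hx]
  ring

end History

end Model

end QuantSGD

/-! ### Moments along the trajectory and the history of the iteration -/

namespace QuantSGD

theorem integral_add_mul_sq {X : Type*} [MeasurableSpace X] {μ : Measure X} {f y : X → ℝ}
    (hf : AEStronglyMeasurable f μ) (hy : AEStronglyMeasurable y μ)
    (hf2 : Integrable (fun x => f x ^ 2) μ) (hy2 : Integrable (fun x => y x ^ 2) μ) (c : ℝ) :
    Integrable (fun x => (f x + c * y x) ^ 2) μ ∧
    ∫ x, (f x + c * y x) ^ 2 ∂μ =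
      ∫ x, f x ^ 2 ∂μ + 2 * c * ∫ x, f x * y x ∂μ + c ^ 2 * ∫ x, y x ^ 2 ∂μ := by
  have h1 := (integrable_mul_of_sq hf hy hf2 hy2).const_mul (2 * c)
  have h2 := hy2.const_mul (c ^ 2)
  have h3 : Integrable (fun x => f x ^ 2 + 2 * c * (f x * y x)) μ := hf2.add h1
  have e : ∀ x, (f x + c * y x) ^ 2 = f x ^ 2 + 2 * c * (f x * y x) + c ^ 2 * y x ^ 2 :=
    fun x => by ring
  simp only [e]
  refine ⟨h3.add h2, ?_⟩
  rw [integral_add h3 h2, integral_add hf2 h1, integral_const_mul, integral_const_mul]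

namespace Model

set_option linter.unusedSectionVars false

variable {E Sd Sl Sp Sa So : Type*} {B : ℕ} [NormedAddCommGroup E] [InnerProductSpace ℝ E]
  [CompleteSpace E] [SecondCountableTopology E] [MeasurableSpace E] [BorelSpace E]
  [MeasurableSpace Sd] [MeasurableSpace Sl] [MeasurableSpace Sp] [MeasurableSpace Sa]
  [MeasurableSpace So] {M : Model E Sd Sl Sp Sa So B}
  {Ω : Type*} [MeasurableSpace Ω] {P : Measure Ω} [IsProbabilityMeasure P]

/-- First and second moments of the stochastic gradient at a parameter `W h` which depends on a
history `h` independent of the input `ζ` of the step. -/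
theorem stepDir_moments (hunb : M.UnbiasedQuantizers)
    (hQa : M.Qa.FiniteErrorMoment) (hQo : M.Qo.FiniteErrorMoment)
    (hmom : M.FiniteMoments) {wq : E} (hwq : IsMinOn M.quantRisk Set.univ wq)
    {α σ : ℝ} (hα : 0 ≤ α) (hfourth : M.FourthMoment α)
    (hnoise : M.NoiseBound wq σ) (hB : 1 ≤ B) {X : Type*} [MeasurableSpace X]
    {h : Ω → X} {ζ : Ω → StepInput E Sd Sl Sp Sa So B} (hh : Measurable h) (hζ : Measurable ζ)
    (hind : IndepFun h ζ P) (hlaw : P.map ζ = M.stepLaw) {W : X → E} (hW : Measurable W)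
    (hW2 : Integrable (fun ω => ‖W (h ω)‖ ^ 2) P) {K e : ℝ} (he0 : 0 ≤ e)
    (hK : ∀ᵐ ω ∂P, ‖M.Qo.errCov (M.outGrad (W (h ω)) (ζ ω)) +
      M.Qa.errCov (M.activation (W (h ω)) (ζ ω))‖ ≤ K)
    (he : ∫⁻ ω, ENNReal.ofReal (normSq M.Hq (M.wquant (W (h ω)) (ζ ω) - W (h ω))) ∂P ≤
      ENNReal.ofReal e) (u : E) :
    (Integrable (fun ω => ⟪u, M.stepDir (W (h ω)) (ζ ω)⟫ ^ 2) P ∧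
      ∫ ω, ⟪u, M.stepDir (W (h ω)) (ζ ω)⟫ ^ 2 ∂P ≤
        B ^ 2 * normSq M.Hq u * (α * ∫ ω, normSq M.Hq (W (h ω) - wq) ∂P +
        α * normSq M.Hq (∫ ω, (W (h ω) - wq) ∂P) + 2 * ((σ ^ 2 + K) / B + α * e))) ∧
    ∀ Y : X → ℝ, Measurable Y → Integrable (fun ω => Y (h ω) ^ 2) P →
      ∫ ω, Y (h ω) * ⟪u, M.stepDir (W (h ω)) (ζ ω)⟫ ∂P =
        -B * ∫ ω, Y (h ω) * ⟪u, M.Hq (W (h ω) - wq)⟫ ∂P := by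
  have : IsProbabilityMeasure (P.map h) := Measure.isProbabilityMeasure_map hh.aemeasurable
  have hmeas : Measurable fun ω => (h ω, ζ ω) := hh.prodMk hζ
  have hmap : P.map (fun ω => (h ω, ζ ω)) = (P.map h).prod M.stepLaw := by
    rw [← hlaw]
    exact (indepFun_iff_map_prod_eq_prod_map_map hh.aemeasurable hζ.aemeasurable).1 hind
  have hcont := (continuous_normSq M.Hq).measurable
  have hW1 : Measurable fun p : X × StepInput E Sd Sl Sp Sa So B => (W p.1, p.2) :=
    (hW.comp measurable_fst).prodMk measurable_snd
  have hi2 : Integrable (fun x => ‖W x‖ ^ 2) (P.map h) :=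
    (integrable_map_measure (hW.norm.pow_const 2).aestronglyMeasurable hh.aemeasurable).2 hW2
  have hKm := M.measurable_errCov_norm.comp hW1
  have hK' : ∀ᵐ p ∂((P.map h).prod M.stepLaw), ‖M.Qo.errCov (M.outGrad (W p.1) p.2) +
      M.Qa.errCov (M.activation (W p.1) p.2)‖ ≤ K := by
    rw [← hmap]
    exact (ae_map_iff hmeas.aemeasurable (measurableSet_le hKm measurable_const)).2 hK
  have hem : Measurable fun p : X × StepInput E Sd Sl Sp Sa So B =>
      ENNReal.ofReal (normSq M.Hq (M.wquant (W p.1) p.2 - W p.1)) := by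
    have h1 := M.measurable_wquant.comp hW1
    exact (hcont.comp (h1.sub (hW.comp measurable_fst))).ennreal_ofReal
  have he' : ∫⁻ p, ENNReal.ofReal (normSq M.Hq (M.wquant (W p.1) p.2 - W p.1))
      ∂((P.map h).prod M.stepLaw) ≤ ENNReal.ofReal e := by
    rw [← hmap, lintegral_map hem hmeas]
    exact he
  have hsm : Measurable fun p : X × StepInput E Sd Sl Sp Sa So B =>
      ⟪u, M.stepDir (W p.1) p.2⟫ := (measurable_stepDir_comp hW).const_inner
  have hle := lintegral_inner_stepDir_sq_le hunb hQa hQo hmom hwq hα hfourth hnoise hB hW hi2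
    he0 hK' he' u
  have hτ : ∫ x, normSq M.Hq (W x - wq) ∂(P.map h) = ∫ ω, normSq M.Hq (W (h ω) - wq) ∂P :=
    integral_map hh.aemeasurable (hcont.comp (hW.sub_const wq)).aestronglyMeasurable
  have hβ : ∫ x, (W x - wq) ∂(P.map h) = ∫ ω, (W (h ω) - wq) ∂P :=
    integral_map hh.aemeasurable (hW.sub_const wq).aestronglyMeasurable
  have hint := integrable_of_lintegral_ofReal_le (hsm.pow_const 2).aestronglyMeasurable
    (fun p => sq_nonneg _) hle
  have hK0 : 0 ≤ K := by
    obtain ⟨p, hp⟩ := hK.exists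
    exact (norm_nonneg _).trans hp
  have hR0 : 0 ≤ (B : ℝ) ^ 2 * normSq M.Hq u * (α * ∫ x, normSq M.Hq (W x - wq) ∂(P.map h) +
        α * normSq M.Hq (∫ x, (W x - wq) ∂(P.map h)) + 2 * ((σ ^ 2 + K) / B + α * e)) := by
    have h1 := normSq_Hq_nonneg hmom u
    have h2 := normSq_Hq_nonneg hmom (∫ x, (W x - wq) ∂(P.map h))
    have h3 : 0 ≤ ∫ x, normSq M.Hq (W x - wq) ∂(P.map h) :=
      integral_nonneg fun x => normSq_Hq_nonneg hmom _
    positivity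
  have hle2 := integral_le_of_lintegral_ofReal_le (hsm.pow_const 2).aestronglyMeasurable
    (fun p => sq_nonneg _) hR0 hle
  rw [hτ, hβ] at hle2
  refine ⟨⟨?_, ?_⟩, fun Y hY hY2 => ?_⟩
  · rw [← hmap] at hint
    exact (integrable_map_measure (hsm.pow_const 2).aestronglyMeasurable hmeas.aemeasurable).1 hint
  · rw [← hmap, integral_map hmeas.aemeasurable (hsm.pow_const 2).aestronglyMeasurable] at hle2
    exact hle2
  · have hY2' : Integrable (fun x => Y x ^ 2) (P.map h) :=
      (integrable_map_measure (hY.pow_const 2).aestronglyMeasurable hh.aemeasurable).2 hY2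
    have h1 := (integral_mul_inner_stepDir hunb hmom hwq hW hY hY2' u hint).2
    rw [← hmap, integral_map (f := fun p => Y p.1 * ⟪u, M.stepDir (W p.1) p.2⟫)
        hmeas.aemeasurable ((hY.comp measurable_fst).mul hsm).aestronglyMeasurable,
      integral_map (f := fun x => Y x * ⟪u, M.Hq (W x - wq)⟫) hh.aemeasurable
      (hY.mul (M.Hq.continuous.measurable.comp
        (hW.sub_const wq)).const_inner).aestronglyMeasurable] at h1
    exact h1

/-- The stochastic gradient is square integrable. -/
theorem integrable_norm_sq_of_inner {g : Ω → E} (hg : Measurable g)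
    {lam : ℕ → ℝ} {v : ℕ → E} {T : E →L[ℝ] E} (heig : IsEigenDecomp T lam v)
    (hi : ∀ i, Integrable (fun ω => ⟪v i, g ω⟫ ^ 2) P) {c : ℕ → ℝ} (hc : Summable c)
    (hle : ∀ i, ∫ ω, ⟪v i, g ω⟫ ^ 2 ∂P ≤ c i) : Integrable (fun ω => ‖g ω‖ ^ 2) P := by
  have hc0 : ∀ i, 0 ≤ c i := fun i => (integral_nonneg fun ω => sq_nonneg _).trans (hle i)
  refine integrable_of_lintegral_ofReal_le (hg.norm.pow_const 2).aestronglyMeasurable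
    (fun ω => sq_nonneg _) (c := ∑' i, c i) ?_
  -- Integrability of the norm is the goal, so Parseval is integrated in `ℝ≥0∞`, coordinate by
  -- coordinate.
  have h1 : ∀ ω, ENNReal.ofReal (‖g ω‖ ^ 2) = ∑' i, ENNReal.ofReal (⟪v i, g ω⟫ ^ 2) := fun ω => by
    have := heig.hasSum_inner_sq (g ω)
    rw [← this.tsum_eq, ENNReal.ofReal_tsum_of_nonneg (fun i => sq_nonneg _) this.summable]
  simp only [h1]
  rw [lintegral_tsum fun i => (hg.const_inner.pow_const 2).ennreal_ofReal.aemeasurable,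
    ENNReal.ofReal_tsum_of_nonneg hc0 hc]
  refine ENNReal.tsum_le_tsum fun i => ?_
  rw [lintegral_ofReal_eq (hi i) fun ω => sq_nonneg _]
  exact ENNReal.ofReal_le_ofReal (hle i)

/-! #### The history of the iteration -/

/-- Sum of the iterates before time `t`, and iterate at time `t`. -/
noncomputable def history (M : Model E Sd Sl Sp Sa So B) (γ : ℝ) (z : ℕ → StepInput E Sd Sl Sp Sa So B) (t : ℕ) :
    E × E :=
  (∑ r ∈ Finset.range t, M.iter γ z r, M.iter γ z t)

/-- The history factors through the inputs 1, …, t only, so independence of disjoint blocks of `Z`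
separates it from input t + 1. The sum of the iterates is carried along because the martingale
depends on it as well as on the current iterate. -/
theorem exists_history_eq (M : Model E Sd Sl Sp Sa So B) (γ : ℝ) (t : ℕ) :
    ∃ φ : (Finset.Icc 1 t → StepInput E Sd Sl Sp Sa So B) → E × E, Measurable φ ∧
      ∀ z, M.history γ z t = φ fun i => z i := by
  induction t with
  | zero => exact ⟨fun _ => (0, 0), measurable_const, fun z => by simp [history, iter]⟩
  | succ t ih =>
    obtain ⟨φ, hφ, he⟩ := ih
    have hsub : ∀ i ∈ Finset.Icc 1 t, i ∈ Finset.Icc 1 (t + 1) := fun i hi => by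
      rw [Finset.mem_Icc] at hi ⊢; omega
    have hmem : t + 1 ∈ Finset.Icc 1 (t + 1) := by simp
    set r : (Finset.Icc 1 (t + 1) → StepInput E Sd Sl Sp Sa So B) → E × E :=
      fun f => φ fun i => f ⟨i, hsub i i.2⟩ with hr
    have hrm : Measurable r := hφ.comp (measurable_pi_lambda _ fun i => measurable_pi_apply _)
    refine ⟨fun f => ((r f).1 + (r f).2, M.step γ (r f).2 (f ⟨t + 1, hmem⟩)), ?_, fun z => ?_⟩
    · have h1 := (M.measurable_step γ).comp (hrm.snd.prodMk (measurable_pi_apply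
        (⟨t + 1, hmem⟩ : Finset.Icc 1 (t + 1))))
      exact (hrm.fst.add hrm.snd).prodMk h1
    · simp only [hr, ← he z]
      simp only [history, Finset.sum_range_succ, iter]

theorem measurable_history {γ : ℝ} {Z : ℕ → Ω → StepInput E Sd Sl Sp Sa So B}
    (hZ : ∀ t, Measurable (Z t)) (t : ℕ) :
    Measurable fun ω => M.history γ (fun r => Z r ω) t := by
  obtain ⟨φ, hφ, he⟩ := M.exists_history_eq γ t
  simp only [he]
  exact hφ.comp (measurable_pi_lambda _ fun i => hZ i)

/-- The history up to time `t` is independent of the input of step `t + 1`. -/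
theorem indepFun_history {γ : ℝ} {Z : ℕ → Ω → StepInput E Sd Sl Sp Sa So B}
    (hZ : ∀ t, Measurable (Z t)) (hind : iIndepFun Z P) (t : ℕ) :
    IndepFun (fun ω => M.history γ (fun r => Z r ω) t) (Z (t + 1)) P := by
  obtain ⟨φ, hφ, he⟩ := M.exists_history_eq γ t
  simp only [he]
  have h := hind.indepFun_finset (Finset.Icc 1 t) {t + 1} (by simp) hZ
  exact h.comp hφ (measurable_pi_apply (⟨t + 1, by simp⟩ : ({t + 1} : Finset ℕ)))

end Model

end QuantSGD

/-! ### The averaged iterate: coordinate recursions and the martingale -/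

namespace QuantSGD

namespace Model

set_option linter.unusedSectionVars false

variable {E Sd Sl Sp Sa So : Type*} {B : ℕ} [NormedAddCommGroup E] [InnerProductSpace ℝ E]
  [CompleteSpace E] [SecondCountableTopology E] [MeasurableSpace E] [BorelSpace E]
  [MeasurableSpace Sd] [MeasurableSpace Sl] [MeasurableSpace Sp] [MeasurableSpace Sa]
  [MeasurableSpace So] {M : Model E Sd Sl Sp Sa So B}
  {Ω : Type*} [MeasurableSpace Ω] {P : Measure Ω} [IsProbabilityMeasure P]

/-- A finite effective noise level yields uniform bounds for the quantization errors. -/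
theorem exists_noise_bounds {γ α σ : ℝ} (hα : 0 < α) {N : ℕ}
    {Z : ℕ → Ω → StepInput E Sd Sl Sp Sa So B} (hfin : M.sigmaG2 γ α σ N P Z ≠ ∞) :
    ∃ K e : ℝ, 0 ≤ K ∧ 0 ≤ e ∧ (σ ^ 2 + K) / B + α * e = (M.sigmaG2 γ α σ N P Z).toReal ∧
      ∀ t < N, (∀ᵐ ω ∂P,
        ‖M.Qo.errCov (M.outGrad (M.iter γ (fun r => Z r ω) t) (Z (t + 1) ω)) +
          M.Qa.errCov (M.activation (M.iter γ (fun r => Z r ω) t) (Z (t + 1) ω))‖ ≤ K) ∧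
        ∫⁻ ω, ENNReal.ofReal (normSq M.Hq (M.wquant (M.iter γ (fun r => Z r ω) t) (Z (t + 1) ω) -
          M.iter γ (fun r => Z r ω) t)) ∂P ≤ ENNReal.ofReal e := by
  unfold sigmaG2 at hfin ⊢
  simp only [opTrace_comp_rankOne] at hfin ⊢
  set A := ⨆ t ∈ Finset.Icc 1 N, essSup (fun ω =>
        ‖M.Qo.errCov (M.outGrad (M.iter γ (fun s => Z s ω) (t - 1)) (Z t ω)) +
          M.Qa.errCov (M.activation (M.iter γ (fun s => Z s ω) (t - 1)) (Z t ω))‖ₑ) P with hA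
  set D := ⨆ t ∈ Finset.Icc 1 N, ∫⁻ ω, ENNReal.ofReal (normSq M.Hq
      (M.wquant (M.iter γ (fun s => Z s ω) (t - 1)) (Z t ω) - M.iter γ (fun s => Z s ω) (t - 1)))
        ∂P with hD
  -- An infinite supremum would survive division by the finite `B`, or multiplication by the nonzero
  -- α, and make the noise level infinite.
  have hB0 : (B : ℝ≥0∞) ≠ ∞ := ENNReal.natCast_ne_top B
  have hα0 : ENNReal.ofReal α ≠ 0 := by simpa using hα
  obtain ⟨h1, h2⟩ := ENNReal.add_ne_top.1 hfin
  have hsum : ENNReal.ofReal (σ ^ 2) + A ≠ ∞ := fun h => h1 (by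
    rw [h]; exact ENNReal.top_div_of_ne_top hB0)
  have hA' : A ≠ ∞ := (ENNReal.add_ne_top.1 hsum).2
  have hD' : D ≠ ∞ := fun h => h2 (by rw [h]; exact ENNReal.mul_top hα0)
  refine ⟨A.toReal, D.toReal, ENNReal.toReal_nonneg, ENNReal.toReal_nonneg, ?_, fun t ht => ?_⟩
  · rw [ENNReal.toReal_add h1 h2, ENNReal.toReal_div, ENNReal.toReal_add ENNReal.ofReal_ne_top hA',
      ENNReal.toReal_mul, ENNReal.toReal_ofReal (sq_nonneg _), ENNReal.toReal_ofReal hα.le,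
      ENNReal.toReal_natCast]
  -- The step from w_t to w_{t+1} uses input t + 1, so t < N matches the index range 1, …, N of the
  -- suprema.
  · have hmem : t + 1 ∈ Finset.Icc 1 N := by rw [Finset.mem_Icc]; omega
    constructor
    · have hle : essSup (fun ω =>
          ‖M.Qo.errCov (M.outGrad (M.iter γ (fun s => Z s ω) t) (Z (t + 1) ω)) +
            M.Qa.errCov (M.activation (M.iter γ (fun s => Z s ω) t) (Z (t + 1) ω))‖ₑ) P ≤ A := by
        rw [hA]
        exact le_iSup₂_of_le (t + 1) hmem le_rfl
      filter_upwards [ae_le_essSup (μ := P) (f := fun ω =>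
          ‖M.Qo.errCov (M.outGrad (M.iter γ (fun s => Z s ω) t) (Z (t + 1) ω)) +
            M.Qa.errCov (M.activation (M.iter γ (fun s => Z s ω) t) (Z (t + 1) ω))‖ₑ)] with ω hω
      rw [← toReal_enorm]
      exact ENNReal.toReal_mono hA' (hω.trans hle)
    · rw [ENNReal.ofReal_toReal hD', hD]
      exact le_iSup₂_of_le (t + 1) hmem le_rfl

/-- Energy of the averaged iterate, centred at the optimum on quantized data. -/
theorem average_energy_bound (hB : 1 ≤ B) {N : ℕ} (hN : 1 ≤ N) (hunb : M.UnbiasedQuantizers)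
    (hQa : M.Qa.FiniteErrorMoment) (hQo : M.Qo.FiniteErrorMoment) (hmom : M.FiniteMoments)
    {wq : E} (hwq : IsMinOn M.quantRisk Set.univ wq)
    {α σ : ℝ} (hα : 0 < α) (hfourth : M.FourthMoment α) (hnoise : M.NoiseBound wq σ)
    {lam : ℕ → ℝ} {v : ℕ → E} (heig : IsEigenDecomp M.Hq lam v)
    {γ : ℝ} (hγ : 0 < γ) (hstep : γ * α * opTrace M.Hq < 1)
    {Z : ℕ → Ω → StepInput E Sd Sl Sp Sa So B} (hZmeas : ∀ t, Measurable (Z t))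
    (hZindep : iIndepFun Z P) (hZlaw : ∀ t, P.map (Z t) = M.stepLaw)
    (hfin : M.sigmaG2 γ α σ N P Z ≠ ∞) (k : ℕ) :
    Integrable (fun ω => normSq M.Hq (M.avgIter γ N (fun t => Z t ω) - wq)) P ∧
    1 / 2 * ∫ ω, normSq M.Hq (M.avgIter γ N (fun t => Z t ω) - wq) ∂P ≤
      ((M.sigmaG2 γ α σ N P Z).toReal + 2 * α / (N * γ) *
        ((∑ i ∈ Finset.range k, ⟪v i, wq⟫ ^ 2) +
          N * γ * ∑' i, lam (k + i) * ⟪v (k + i), wq⟫ ^ 2)) / (1 - γ * α * opTrace M.Hq) *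
        ((k : ℝ) / N + N * γ ^ 2 * ∑' i, lam (k + i) ^ 2) +
      (1 / (γ ^ 2 * N ^ 2) * (∑ i ∈ Finset.range k, (lam i)⁻¹ * ⟪v i, wq⟫ ^ 2) +
        ∑' i, lam (k + i) * ⟪v (k + i), wq⟫ ^ 2) := by
  obtain ⟨K, e, hK0, he0, hs, hKe⟩ := exists_noise_bounds (M := M) (P := P) (σ := σ) (γ := γ)
    hα hfin
  rw [← hs]
  set s : ℝ := (σ ^ 2 + K) / B + α * e with hsdef
  have hs0 : 0 ≤ s := by positivity
  have hBr : (0 : ℝ) < B := by exact_mod_cast hB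
  have hsym := isSymmetric_Hq hmom
  have hcont := (continuous_normSq M.Hq).measurable
  have hlam := eigenvalue_nonneg hmom heig
  have htr := hasSum_eigenvalues hmom heig
  rw [← heig.opTrace_eq hsym hlam htr] at htr
  -- A positive eigenvalue forces α ≥ 1, and λ_i ≤ tr Hq, so γλ_i ≤ γ α tr Hq < 1.
  have hq : ∀ i, γ * lam i ≤ 1 := fun i => by
    rcases (hlam i).eq_or_lt with h | h
    · rw [← h]; simp
    · have h1 : 1 ≤ α := one_le_of_fourthMoment hmom hfourth (u := v i) (by
        rw [normSq, heig.inner_self]; exact h)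
      have h2 : lam i ≤ opTrace M.Hq := le_hasSum htr i fun j _ => hlam j
      have h3 : γ * lam i ≤ γ * opTrace M.Hq := mul_le_mul_of_nonneg_left h2 hγ.le
      have h4 : γ * opTrace M.Hq * 1 ≤ γ * opTrace M.Hq * α :=
        mul_le_mul_of_nonneg_left h1 (mul_nonneg hγ.le (h.le.trans h2))
      linarith
  -- the processes
  set w : ℕ → Ω → E := fun t ω => M.iter γ (fun r => Z r ω) t with hw
  set S : ℕ → Ω → E := fun t ω => ∑ r ∈ Finset.range t, w r ω with hS
  set h : ℕ → Ω → E × E := fun t ω => M.history γ (fun r => Z r ω) t with hh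
  have hhm : ∀ t, Measurable (h t) := measurable_history hZmeas
  have hwm : ∀ t, Measurable (w t) := fun t => (hhm t).snd
  have hSm : ∀ t, Measurable (S t) := fun t => (hhm t).fst
  set g : ℕ → Ω → E := fun t ω => M.stepDir (w t ω) (Z (t + 1) ω) with hg
  have hgm : ∀ t, Measurable (g t) := fun t => by
    have := M.measurable_stepDir.comp ((hwm t).prodMk (hZmeas (t + 1)))
    exact this
  have hwsucc : ∀ t ω, w (t + 1) ω = w t ω + (γ * (1 / (B : ℝ))) • g t ω := fun t ω => rfl
  set τ : ℕ → ℝ := fun t => ∫ ω, normSq M.Hq (w t ω - wq) ∂P with hτ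
  set β : ℕ → E := fun t => ∫ ω, (w t ω - wq) ∂P with hβ
  set R : ℕ → ℝ := fun t => α * τ t + α * normSq M.Hq (β t) + 2 * s with hR
  have hmoments : ∀ t < N, Integrable (fun ω => ‖w t ω‖ ^ 2) P → ∀ u,
      (Integrable (fun ω => ⟪u, g t ω⟫ ^ 2) P ∧
        ∫ ω, ⟪u, g t ω⟫ ^ 2 ∂P ≤ B ^ 2 * normSq M.Hq u * R t) ∧
      ∀ Y : E × E → ℝ, Measurable Y → Integrable (fun ω => Y (h t ω) ^ 2) P →
        ∫ ω, Y (h t ω) * ⟪u, g t ω⟫ ∂P = -B * ∫ ω, Y (h t ω) * ⟪u, M.Hq (w t ω - wq)⟫ ∂P :=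
    fun t ht hw2 u => stepDir_moments hunb hQa hQo hmom hwq hα.le hfourth hnoise hB (hhm t)
      (hZmeas (t + 1)) (indepFun_history hZmeas hZindep t) (hZlaw (t + 1)) measurable_snd hw2 he0
      (hKe t ht).1 (hKe t ht).2 u
  -- square integrability
  have hw2 : ∀ t ≤ N, Integrable (fun ω => ‖w t ω‖ ^ 2) P := by
    intro t
    induction t with
    | zero => intro _; simp [hw, iter]
    | succ t ih =>
      intro ht
      have h1 := hmoments t (by omega) (ih (by omega))
      -- The coordinate bounds B²λ_i R_t are summable because the trace is finite.
      have h2 : Integrable (fun ω => ‖g t ω‖ ^ 2) P :=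
        integrable_norm_sq_of_inner (hgm t) heig (fun i => (h1 (v i)).1.1)
          (c := fun i => B ^ 2 * lam i * R t) ((htr.summable.mul_left _).mul_right _) fun i => by
            have := (h1 (v i)).1.2
            rwa [normSq, heig.inner_self] at this
      simp only [hwsucc]
      refine integrable_norm_sq_add (hwm t).aestronglyMeasurable
        ((hgm t).const_smul _).aestronglyMeasurable (ih (by omega)) ?_
      simp only [norm_smul, mul_pow]
      exact h2.const_mul _
  have hS2 : ∀ t ≤ N, Integrable (fun ω => ‖S t ω‖ ^ 2) P := by
    intro t
    induction t with
    | zero => intro _; simp [hS]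
    | succ t ih =>
      intro ht
      simp only [hS, Finset.sum_range_succ]
      exact integrable_norm_sq_add (hSm t).aestronglyMeasurable (hwm t).aestronglyMeasurable
        (ih (by omega)) (hw2 t (by omega))
  have hsubc : ∀ (f : Ω → E) (c : E), Measurable f → Integrable (fun ω => ‖f ω‖ ^ 2) P →
      Integrable (fun ω => ‖f ω - c‖ ^ 2) P := fun f c hf hf2 => by
    simpa only [← sub_eq_add_neg] using integrable_norm_sq_add (g := fun _ => -c)
      hf.aestronglyMeasurable aestronglyMeasurable_const hf2 (integrable_const _)
  have hnsq : ∀ (f : Ω → E), Measurable f → Integrable (fun ω => ‖f ω‖ ^ 2) P →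
      Integrable (fun ω => normSq M.Hq (f ω)) P ∧
      HasSum (fun i => lam i * ∫ ω, ⟪v i, f ω⟫ ^ 2 ∂P) (∫ ω, normSq M.Hq (f ω) ∂P) :=
    fun f hf hf2 => by
      have h1 : Integrable (fun ω => normSq M.Hq (f ω)) P := by
        refine (hf2.const_mul ‖M.Hq‖).mono' (hcont.comp hf).aestronglyMeasurable
          (Filter.Eventually.of_forall fun ω => ?_)
        rw [Real.norm_of_nonneg (normSq_Hq_nonneg hmom _)]
        exact normSq_le_norm _ _
      have h2 := hasSum_integral_of_nonneg (μ := P) (F := fun i ω => lam i * ⟪v i, f ω⟫ ^ 2)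
        (fun i => (integrable_inner_sq hf.aestronglyMeasurable hf2 (v i)).const_mul _)
        (fun i ω => mul_nonneg (hlam i) (sq_nonneg _)) h1 fun ω => heig.hasSum_normSq hsym (f ω)
      simp only [integral_const_mul] at h2
      exact ⟨h1, h2⟩
  -- coordinates of the centred iterates
  set a : ℕ → ℕ → Ω → ℝ := fun t i ω => ⟪v i, w t ω - wq⟫ with ha
  set m : ℕ → ℕ → ℝ := fun t i => ∫ ω, a t i ω ^ 2 ∂P with hm
  have ham : ∀ t i, Measurable (a t i) := fun t i => ((hwm t).sub_const wq).const_inner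
  have ha2 : ∀ t ≤ N, ∀ i, Integrable (fun ω => a t i ω ^ 2) P := fun t ht i =>
    integrable_inner_sq ((hwm t).sub_const wq).aestronglyMeasurable
      (hsubc _ wq (hwm t) (hw2 t ht)) (v i)
  set y : ℕ → ℕ → Ω → ℝ := fun t i ω => ⟪v i, g t ω⟫ with hy
  have hym : ∀ t i, Measurable (y t i) := fun t i => (hgm t).const_inner
  have hy2 : ∀ t < N, ∀ i, Integrable (fun ω => y t i ω ^ 2) P ∧
      ∫ ω, y t i ω ^ 2 ∂P ≤ B ^ 2 * lam i * R t := fun t ht i => by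
    have := (hmoments t ht (hw2 t ht.le) (v i)).1
    rwa [normSq, heig.inner_self] at this
  have hY : ∀ t < N, ∀ i, ∀ Y : E × E → ℝ, Measurable Y →
      Integrable (fun ω => Y (h t ω) ^ 2) P →
      ∫ ω, Y (h t ω) * y t i ω ∂P = -(B * lam i) * ∫ ω, Y (h t ω) * a t i ω ∂P :=
    fun t ht i Y hYm hY2 => by
      rw [(hmoments t ht (hw2 t ht.le) (v i)).2 Y hYm hY2, ← integral_const_mul,
        ← integral_const_mul]
      refine integral_congr_ae (Filter.Eventually.of_forall fun ω => ?_)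
      simp only [ha, heig.inner_apply hsym]
      ring
  have hasucc : ∀ t i ω, a (t + 1) i ω = a t i ω + γ * (1 / (B : ℝ)) * y t i ω := fun t i ω => by
    simp only [ha, hy, hwsucc, add_sub_right_comm, inner_add_right, real_inner_smul_right]
  have hay : ∀ t < N, ∀ i, ∫ ω, a t i ω * y t i ω ∂P = -(B * lam i) * m t i := fun t ht i => by
    have := hY t ht i (fun p => ⟪v i, p.2 - wq⟫) (measurable_snd.sub_const wq).const_inner
      (ha2 t ht.le i)
    rw [show m t i = ∫ ω, a t i ω * a t i ω ∂P by simp only [hm, sq]]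
    exact this
  have hmn : ∀ t i, 0 ≤ m t i := fun t i => integral_nonneg fun ω => sq_nonneg _
  -- Expanding the square gives the factor 1 - 2γλ_i; adding the nonnegative (γλ_i)² m completes it
  -- to (1 - γλ_i)².
  have hmrec : ∀ t < N, ∀ i, m (t + 1) i ≤
      (1 - γ * lam i) ^ 2 * m t i + γ ^ 2 * lam i * R t := fun t ht i => by
    have h1 := (integral_add_mul_sq (ham t i).aestronglyMeasurable
      (hym t i).aestronglyMeasurable (ha2 t ht.le i) (hy2 t ht i).1 (γ * (1 / (B : ℝ)))).2
    have h2 : m (t + 1) i = ∫ ω, (a t i ω + γ * (1 / (B : ℝ)) * y t i ω) ^ 2 ∂P := by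
      simp only [hm, hasucc]
    rw [h2, h1, hay t ht i]
    have h3 := mul_le_mul_of_nonneg_left (hy2 t ht i).2 (sq_nonneg (γ * (1 / (B : ℝ))))
    have h4 : (γ * (1 / (B : ℝ))) ^ 2 * (B ^ 2 * lam i * R t) = γ ^ 2 * lam i * R t := by
      field_simp
    have h5 : 2 * (γ * (1 / (B : ℝ))) * (-(B * lam i) * m t i) = -(2 * (γ * lam i) * m t i) := by
      field_simp
    have h6 := mul_nonneg (sq_nonneg (γ * lam i)) (hmn t i)
    have h7 : ∫ ω, a t i ω ^ 2 ∂P = m t i := rfl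
    rw [h5, h7]
    nlinarith
  -- means
  have hai : ∀ t ≤ N, ∀ i, Integrable (a t i) P := fun t ht i =>
    integrable_of_sq (ham t i).aestronglyMeasurable (ha2 t ht i)
  -- Since w_0 = 0, the centred coordinates start at -⟨v_i, wq⟩; the sign disappears on squaring.
  have hmean : ∀ t ≤ N, ∀ i, ∫ ω, a t i ω ∂P = (1 - γ * lam i) ^ t * -⟪v i, wq⟫ := by
    intro t
    induction t with
    | zero => intro _ i; simp [ha, hw, iter]
    | succ t ih =>
      intro ht i
      have h1 := hY t (by omega) i (fun _ => 1) measurable_const (integrable_const _)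
      simp only [one_mul] at h1
      simp only [hasucc]
      rw [integral_add (hai t (by omega) i) ((integrable_of_sq (hym t i).aestronglyMeasurable
        (hy2 t (by omega) i).1).const_mul _), integral_const_mul, h1, ih (by omega) i]
      field_simp
      ring
  have hbsum : ∀ t < N, HasSum (fun i => lam i * ((1 - γ * lam i) ^ t * ⟪v i, wq⟫) ^ 2)
      (normSq M.Hq (β t)) := fun t ht => by
    refine (heig.hasSum_normSq hsym (β t)).congr_fun fun i => ?_
    have h1 : Integrable (fun ω => w t ω - wq) P :=
      integrable_of_norm_sq ((hwm t).sub_const wq).aestronglyMeasurable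
        (hsubc _ wq (hwm t) (hw2 t ht.le))
    have h2 : ⟪v i, β t⟫ = (1 - γ * lam i) ^ t * -⟪v i, wq⟫ := by
      rw [← hmean t ht.le i]
      exact (integral_inner (𝕜 := ℝ) h1 (v i)).symm
    rw [h2, mul_neg, neg_sq]
  have hτsum : ∀ t < N, HasSum (fun i => lam i * m t i) (τ t) := fun t ht =>
    (hnsq _ ((hwm t).sub_const wq) (hsubc _ wq (hwm t) (hw2 t ht.le))).2
  -- the sum of the centred iterates, through a martingale
  set G : ℕ → ℕ → ℝ := fun i n => ∑ j ∈ Finset.range n, (1 - γ * lam i) ^ j with hG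
  -- The conditional expectation, given the history up to t, of the i-th coordinate of ∑_{r<N} (w_r
  -- - wq): the N - t terms still missing have conditional means (1 - γλ_i)^j times the current
  -- coordinate.
  set F : ℕ → ℕ → E × E → ℝ := fun i t p =>
    ⟪v i, p.1 - (t : ℝ) • wq⟫ + G i (N - t) * ⟪v i, p.2 - wq⟫ with hF
  have hFm : ∀ i t, Measurable (F i t) := fun i t =>
    (measurable_fst.sub_const _).const_inner.add ((measurable_snd.sub_const _).const_inner.const_mul _)
  have hF2 : ∀ i, ∀ t ≤ N, Integrable (fun ω => F i t (h t ω) ^ 2) P := fun i t ht => by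
    refine integrable_sq_add (f := fun ω => ⟪v i, S t ω - (t : ℝ) • wq⟫)
      (g := fun ω => G i (N - t) * a t i ω)
      ((hSm t).sub_const _).const_inner.aestronglyMeasurable
      ((ham t i).const_mul _).aestronglyMeasurable
      (integrable_inner_sq ((hSm t).sub_const _).aestronglyMeasurable
        (hsubc _ _ (hSm t) (hS2 t ht)) (v i)) ?_
    simp only [mul_pow]
    exact (ha2 t ht i).const_mul _
  have hFsucc : ∀ i, ∀ t < N, ∀ ω, F i (t + 1) (h (t + 1) ω) = F i t (h t ω) +
      G i (N - 1 - t) * (γ * lam i * a t i ω + γ * (1 / (B : ℝ)) * y t i ω) := fun i t ht ω => by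
    have h1 : N - t = (N - 1 - t) + 1 := by omega
    have h2 : N - (t + 1) = N - 1 - t := by omega
    -- The 1 is the current iterate entering the sum; the rest is its decayed influence on later
    -- terms.
    have h3 : G i (N - t) = 1 + (1 - γ * lam i) * G i (N - 1 - t) := by
      simp only [hG]
      rw [h1, geom_sum_succ]
      ring
    have h4 : F i (t + 1) (h (t + 1) ω) = ⟪v i, S (t + 1) ω - ((t + 1 : ℕ) : ℝ) • wq⟫ +
        G i (N - 1 - t) * a (t + 1) i ω := by
      rw [← h2]; rfl
    have h5 : F i t (h t ω) = ⟪v i, S t ω - (t : ℝ) • wq⟫ + G i (N - t) * a t i ω := rfl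
    have h6 : S (t + 1) ω - ((t + 1 : ℕ) : ℝ) • wq = (S t ω - (t : ℝ) • wq) + (w t ω - wq) := by
      simp only [hS, Finset.sum_range_succ, Nat.cast_add, Nat.cast_one, add_smul, one_smul]
      abel
    rw [h4, h5, h6, inner_add_right, hasucc, h3]
    simp only [ha]
    ring
  have hFrec : ∀ i, ∀ t < N, ∫ ω, F i (t + 1) (h (t + 1) ω) ^ 2 ∂P ≤
      ∫ ω, F i t (h t ω) ^ 2 ∂P + G i (N - 1 - t) ^ 2 * (γ ^ 2 * lam i * R t) := fun i t ht => by
    set d : Ω → ℝ := fun ω => γ * lam i * a t i ω + γ * (1 / (B : ℝ)) * y t i ω with hd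
    have hga2 : Integrable (fun ω => (γ * lam i * a t i ω) ^ 2) P := by
      simp only [mul_pow]
      exact (ha2 t ht.le i).const_mul _
    have hgam : AEStronglyMeasurable (fun ω => γ * lam i * a t i ω) P :=
      ((ham t i).const_mul _).aestronglyMeasurable
    obtain ⟨hd2, hd3⟩ := integral_add_mul_sq hgam (hym t i).aestronglyMeasurable hga2
      (hy2 t ht i).1 (γ * (1 / (B : ℝ)))
    have hdm : AEStronglyMeasurable d P :=
      (((ham t i).const_mul _).add ((hym t i).const_mul _)).aestronglyMeasurable
    have hFtm : AEStronglyMeasurable (fun ω => F i t (h t ω)) P :=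
      ((hFm i t).comp (hhm t)).aestronglyMeasurable
    have h1 := (integral_add_mul_sq hFtm hdm (hF2 i t ht.le) hd2 (G i (N - 1 - t))).2
    -- γλ_i a + (γ/B) y is centred given the history, and `F i t` is a function of the history, so
    -- the increment is orthogonal to the past.
    have hFd : ∫ ω, F i t (h t ω) * d ω ∂P = 0 := by
      have i1 := (integrable_mul_of_sq hFtm (ham t i).aestronglyMeasurable (hF2 i t ht.le)
        (ha2 t ht.le i)).const_mul (γ * lam i)
      have i2 := (integrable_mul_of_sq hFtm (hym t i).aestronglyMeasurable (hF2 i t ht.le)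
        (hy2 t ht i).1).const_mul (γ * (1 / (B : ℝ)))
      have e1 : ∀ ω, F i t (h t ω) * d ω = γ * lam i * (F i t (h t ω) * a t i ω) +
          γ * (1 / (B : ℝ)) * (F i t (h t ω) * y t i ω) := fun ω => by simp only [hd]; ring
      simp only [e1]
      rw [integral_add i1 i2, integral_const_mul, integral_const_mul,
        hY t ht i (F i t) (hFm i t) (hF2 i t ht.le)]
      field_simp
      ring
    -- The centred increment loses (γλ_i)² m from the second moment of (γ/B) y; this gain is
    -- dropped.
    have hdle : ∫ ω, d ω ^ 2 ∂P ≤ γ ^ 2 * lam i * R t := by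
      have e2 : ∫ ω, γ * lam i * a t i ω * y t i ω ∂P = γ * lam i * (-(B * lam i) * m t i) := by
        rw [← hay t ht i, ← integral_const_mul]
        simp only [mul_assoc]
      have e3 : ∫ ω, (γ * lam i * a t i ω) ^ 2 ∂P = (γ * lam i) ^ 2 * m t i := by
        simp only [hm, ← integral_const_mul, mul_pow]
      have h3 := mul_le_mul_of_nonneg_left (hy2 t ht i).2 (sq_nonneg (γ * (1 / (B : ℝ))))
      have h4 : (γ * (1 / (B : ℝ))) ^ 2 * (B ^ 2 * lam i * R t) = γ ^ 2 * lam i * R t := by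
        field_simp
      have h5 : 2 * (γ * (1 / (B : ℝ))) * (γ * lam i * (-(B * lam i) * m t i)) =
          -(2 * (γ * lam i) ^ 2 * m t i) := by field_simp
      have h6 := mul_nonneg (sq_nonneg (γ * lam i)) (hmn t i)
      simp only [hd]
      rw [hd3, e2, e3, h5]
      linarith
    have h2 : ∫ ω, F i (t + 1) (h (t + 1) ω) ^ 2 ∂P =
        ∫ ω, (F i t (h t ω) + G i (N - 1 - t) * d ω) ^ 2 ∂P := by
      simp only [hFsucc i t ht, hd]
    rw [h2, h1, hFd, mul_zero, add_zero]
    have := mul_le_mul_of_nonneg_left hdle (sq_nonneg (G i (N - 1 - t)))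
    linarith
  have hFN : ∀ i, ∀ n ≤ N, ∫ ω, F i n (h n ω) ^ 2 ∂P ≤ G i N ^ 2 * ⟪v i, wq⟫ ^ 2 +
      ∑ t ∈ Finset.range n, G i (N - 1 - t) ^ 2 * (γ ^ 2 * lam i * R t) := by
    intro i n
    induction n with
    | zero =>
      intro _
      simp [hF, hh, history, iter, mul_pow]
    | succ n ih =>
      intro hn
      rw [Finset.sum_range_succ]
      linarith [hFrec i n (by omega), ih (by omega)]
  -- conclusion
  obtain ⟨hTi, hT⟩ := hnsq (fun ω => S N ω - (N : ℝ) • wq) ((hSm N).sub_const _)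
    (hsubc _ _ (hSm N) (hS2 N le_rfl))
  -- At time N no term is missing: G_0 = 0, and the martingale equals the coordinate of the centred
  -- sum.
  have hScoord : ∀ i, ∫ ω, ⟪v i, S N ω - (N : ℝ) • wq⟫ ^ 2 ∂P ≤
      G i N ^ 2 * ⟪v i, wq⟫ ^ 2 +
      ∑ t ∈ Finset.range N, G i (N - 1 - t) ^ 2 * (γ ^ 2 * lam i * R t) := fun i => by
    refine le_trans (le_of_eq ?_) (hFN i N le_rfl)
    refine integral_congr_ae (Filter.Eventually.of_forall fun ω => ?_)
    simp only [hF, hG, Nat.sub_self, Finset.range_zero, Finset.sum_empty, zero_mul, add_zero]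
    rfl
  have hNr : (0 : ℝ) < N := by exact_mod_cast hN
  have havg : ∀ ω, normSq M.Hq (M.avgIter γ N (fun t => Z t ω) - wq) =
      (1 / (N : ℝ)) ^ 2 * normSq M.Hq (S N ω - (N : ℝ) • wq) := fun ω => by
    have h1 : M.avgIter γ N (fun t => Z t ω) - wq = (1 / (N : ℝ)) • (S N ω - (N : ℝ) • wq) := by
      rw [smul_sub, smul_smul, one_div_mul_cancel hNr.ne', one_smul]
      rfl
    rw [h1, normSq, normSq, map_smul, real_inner_smul_left, real_inner_smul_right]
    ring
  simp only [havg]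
  refine ⟨hTi.const_mul _, ?_⟩
  have hsummable : Summable fun i => ⟪v i, wq⟫ ^ 2 := (heig.hasSum_inner_sq wq).summable
  have hm0 : ∀ i, m 0 i ≤ ⟪v i, wq⟫ ^ 2 := fun i => by simp [hm, ha, hw, iter]
  have hmain := average_energy_le hN hγ hα.le hs0 hlam htr hstep hq hsummable hmn hm0 hmrec
    hτsum hbsum hScoord hT k
  rw [integral_const_mul]
  refine le_trans (le_of_eq ?_) hmain
  field_simp

end Model

end QuantSGD

/-! ### Assembly: risk comparison plus the averaged energy bound -/

theorem theorem1
    {E Sd Sl Sp Sa So Ω : Type*} [NormedAddCommGroup E] [InnerProductSpace ℝ E] [CompleteSpace E]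
    [SecondCountableTopology E] [MeasurableSpace E] [BorelSpace E]
    [MeasurableSpace Sd] [MeasurableSpace Sl] [MeasurableSpace Sp] [MeasurableSpace Sa]
    [MeasurableSpace So] [MeasurableSpace Ω]
    {B N : ℕ} (hB : 1 ≤ B) (hN : 1 ≤ N)
    (M : QuantSGD.Model E Sd Sl Sp Sa So B)
    -- unbiased quantizers; conditional error covariances of activations / output gradients exist
    (hunb : M.UnbiasedQuantizers)
    (hQa : M.Qa.FiniteErrorMoment) (hQo : M.Qo.FiniteErrorMoment)
    -- finite traces, and a strictly positive data covariance
    (hmom : M.FiniteMoments)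
    (hpos : ∀ u : E, u ≠ 0 → 0 < QuantSGD.normSq M.H u)
    -- the optima on raw and on quantized data
    (wstar wq : E) (hwstar : IsMinOn M.risk Set.univ wstar) (hwq : IsMinOn M.quantRisk Set.univ wq)
    -- fourth-order moment and model noise
    {α σ : ℝ} (hα : 0 < α) (hfourth : M.FourthMoment α)
    (hσ : 0 < σ) (hnoise : M.NoiseBound wq σ)
    -- eigen-decomposition of the quantized covariance
    {lam : ℕ → ℝ} {v : ℕ → E} (heig : QuantSGD.IsEigenDecomp M.Hq lam v)
    -- stepsize
    {γ : ℝ} (hγ : 0 < γ) (hstep : γ < 1 / (α * QuantSGD.opTrace (M.H + M.D)))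
    -- i.i.d. inputs of the iterations
    {P : Measure Ω} [IsProbabilityMeasure P]
    (Z : ℕ → Ω → QuantSGD.StepInput E Sd Sl Sp Sa So B) (hZmeas : ∀ t, Measurable (Z t))
    (hZindep : iIndepFun Z P) (hZlaw : ∀ t, P.map (Z t) = M.stepLaw)
    -- the effective noise level is finite (otherwise the bound is `∞`)
    (hfin : M.sigmaG2 γ α σ N P Z ≠ ∞)
    {s : ℝ} (hs : s = (M.sigmaG2 γ α σ N P Z).toReal)
    {k : ℕ} (hk : k = QuantSGD.effDim lam (1 / (N * γ))) :
    Integrable (fun ω => M.risk (M.avgIter γ N fun t => Z t ω) - M.risk wstar) P ∧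
    ∫ ω, (M.risk (M.avgIter γ N fun t => Z t ω) - M.risk wstar) ∂P ≤
      M.varErr γ α s N lam v k wq + QuantSGD.biasErr γ N lam v k wq
        + M.approxErr wstar + M.quantizedErr γ α s N lam v k wq := by
  have hsum := QuantSGD.Model.H_add_D hunb hmom
  have hsym := QuantSGD.Model.isSymmetric_Hq hmom
  have hlam := QuantSGD.Model.eigenvalue_nonneg hmom heig
  have htr := QuantSGD.Model.hasSum_eigenvalues hmom heig
  have htrace := heig.opTrace_eq hsym hlam htr
  have hstep' : γ * α * QuantSGD.opTrace M.Hq < 1 := by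
    rw [hsum] at hstep
    have h0 : 0 ≤ QuantSGD.opTrace M.Hq := by
      rw [htrace]; exact integral_nonneg fun p => sq_nonneg _
    -- Clearing the denominator needs a positive trace; for a zero trace the goal is 0 < 1.
    rcases h0.eq_or_lt with h | h
    · rw [← h]; simp
    · rw [lt_div_iff₀ (mul_pos hα h)] at hstep
      linarith
  obtain ⟨hint, hle⟩ := QuantSGD.Model.average_energy_bound hB hN hunb hQa hQo hmom hwq hα hfourth
    hnoise heig hγ hstep' hZmeas hZindep hZlaw hfin k
  have hrisk := QuantSGD.Model.risk_sub_risk_le hunb hmom hpos hwstar hwq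
  have hnonneg : ∀ w, 0 ≤ M.risk w - M.risk wstar := fun w => by
    rw [QuantSGD.Model.risk_sub_risk hmom hwstar]
    have := QuantSGD.Model.normSq_H_nonneg hmom (w - wstar)
    positivity
  have havg : Measurable fun ω => M.avgIter γ N fun t => Z t ω := by
    have h := (QuantSGD.Model.measurable_history (M := M) (γ := γ) hZmeas N).fst
    exact h.const_smul (1 / (N : ℝ))
  have hmajor : Integrable (fun ω =>
      1 / 2 * QuantSGD.normSq M.Hq (M.avgIter γ N (fun t => Z t ω) - wq) +
        (1 / 2 * QuantSGD.d1NormSq M.H M.D wstar + 1 / 2 * QuantSGD.d2NormSq M.H M.D wstar)) P :=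
    (hint.const_mul _).add (integrable_const _)
  have hexcess : Integrable
      (fun ω => M.risk (M.avgIter γ N fun t => Z t ω) - M.risk wstar) P := by
    refine hmajor.mono' ?_ (Filter.Eventually.of_forall fun ω => ?_)
    · simp only [QuantSGD.Model.risk_sub_risk hmom hwstar]
      exact (((QuantSGD.continuous_normSq M.H).measurable.comp
        (havg.sub_const wstar)).const_mul _).aestronglyMeasurable
    · rw [Real.norm_of_nonneg (hnonneg _)]
      linarith [hrisk (M.avgIter γ N fun t => Z t ω)]
  refine ⟨hexcess, ?_⟩
  have hbound : ∫ ω, (M.risk (M.avgIter γ N fun t => Z t ω) - M.risk wstar) ∂P ≤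
      1 / 2 * ∫ ω, QuantSGD.normSq M.Hq (M.avgIter γ N (fun t => Z t ω) - wq) ∂P +
        (1 / 2 * QuantSGD.d1NormSq M.H M.D wstar + 1 / 2 * QuantSGD.d2NormSq M.H M.D wstar) := by
    refine (integral_mono hexcess hmajor fun ω => ?_).trans (le_of_eq ?_)
    · simp only
      linarith [hrisk (M.avgIter γ N fun t => Z t ω)]
    · rw [integral_add (hint.const_mul _) (integrable_const _), integral_const_mul, integral_const,
        probReal_univ, one_smul]
  have hs0 : 0 ≤ s := by rw [hs]; exact ENNReal.toReal_nonneg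
  rw [← hs] at hle
  have hden : 0 ≤ 1 - γ * α * QuantSGD.opTrace (M.H + M.D) := by rw [hsum]; linarith
  have hV : 0 ≤ M.varFactor γ α s N lam v k wq := by
    unfold QuantSGD.Model.varFactor QuantSGD.headNormSq QuantSGD.tailNormSq
    have h1 : 0 ≤ ∑ i ∈ Finset.range k, 1 * ⟪v i, wq⟫ ^ 2 :=
      Finset.sum_nonneg fun i _ => mul_nonneg zero_le_one (sq_nonneg _)
    have h2 : 0 ≤ ∑' i, lam (k + i) * ⟪v (k + i), wq⟫ ^ 2 :=
      tsum_nonneg fun i => mul_nonneg (hlam _) (sq_nonneg _)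
    positivity
  -- Only the sign of QuantizedErr matters: the risk comparison already measures the distance to
  -- `wq` in Hq = H + D.
  have hquant : 0 ≤ M.quantizedErr γ α s N lam v k wq := by
    unfold QuantSGD.Model.quantizedErr QuantSGD.headNormSq QuantSGD.tailNormSq
    have h1 : 0 ≤ ∑ i ∈ Finset.range k, (lam i ^ 2)⁻¹ * ⟪v i, wq⟫ ^ 2 :=
      Finset.sum_nonneg fun i _ => mul_nonneg (inv_nonneg.2 (sq_nonneg _)) (sq_nonneg _)
    have h2 : 0 ≤ ∑' i, 1 * ⟪v (k + i), wq⟫ ^ 2 :=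
      tsum_nonneg fun i => mul_nonneg zero_le_one (sq_nonneg _)
    have h3 : 0 ≤ ∑ i ∈ Finset.range k, 1 / (N * lam i) :=
      Finset.sum_nonneg fun i _ => div_nonneg zero_le_one (mul_nonneg (Nat.cast_nonneg _) (hlam i))
    have h4 : 0 ≤ ∑' i, lam (k + i) := tsum_nonneg fun i => hlam _
    positivity
  have hlabel : 0 ≤ ∫ p, (M.yq p - p.1.2) ^ 2 ∂M.sampleLaw := integral_nonneg fun p => sq_nonneg _
  have hd1 : 0 ≤ QuantSGD.d1NormSq M.H M.D wstar := QuantSGD.Model.normSq_D_nonneg hmom _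
  have hvb : M.varErr γ α s N lam v k wq + QuantSGD.biasErr γ N lam v k wq =
      (s + 2 * α / (N * γ) * ((∑ i ∈ Finset.range k, ⟪v i, wq⟫ ^ 2) +
          N * γ * ∑' i, lam (k + i) * ⟪v (k + i), wq⟫ ^ 2)) /
            (1 - γ * α * QuantSGD.opTrace M.Hq) *
        ((k : ℝ) / N + N * γ ^ 2 * ∑' i, lam (k + i) ^ 2) +
      (1 / (γ ^ 2 * N ^ 2) * (∑ i ∈ Finset.range k, (lam i)⁻¹ * ⟪v i, wq⟫ ^ 2) +
        ∑' i, lam (k + i) * ⟪v (k + i), wq⟫ ^ 2) := by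
    simp only [QuantSGD.Model.varErr, QuantSGD.Model.varFactor, QuantSGD.biasErr,
      QuantSGD.headNormSq, QuantSGD.tailNormSq, one_mul, hsum]
  rw [hvb, QuantSGD.Model.approxErr]
  -- The label error, one full D₁ term and QuantizedErr are discarded as nonnegative.
  linarith
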